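/- A rank $k$ distribution $\mathcal D$ on a smooth manifold $M$ is a smooth rank $k$ subbundle of $TM$, that is, an assignment $p\mapsto\mathcal D(p)\subset T_pM$ of linear subspaces that is locally spanned by $k$ pointwise linearly independent smooth vector fields. Its derived flag is defined by $\mathcal D^{(0)}=\mathcal D$ and $\mathcal D^{(i+1)}=\mathcal D^{(i)}+[\mathcal D^{(i)},\mathcal D^{(i)}]$ for $i\ge 0$ (computed on locally defined smooth vector fields), and $\mathcal D^{(i)}(p)\subset T_pM$ is the space of values at $p$ of its elements. A Goursat structure on a manifold $M$ of dimension $m\ge 3$ is a rank two distribution $\mathcal D$ such that $\dim\mathcal D^{(i)}(p)=i+2$ for all $0\le i\le m-2$ and all $p\in M$. Distributions $\mathcal D$ on $M$ and $\tilde{\mathcal D}$ on $\tilde M$ are locally equivalent at $q\in M$ and $p\in\tilde M$ if there are open neighbourhoods $U$ of $q$ and $\tilde U$ of $p$ and a smooth diffeomorphism $\varphi:U\to\tilde U$ with $\varphi(q)=p$ and $\varphi_*\mathcal D=\tilde{\mathcal D}$ on $\tilde U$. For $n\ge 0$, the $n$-trailer system is the distribution on $\mathbb R^2\times(S^1)^{n+1}$,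 with coordinates $(\xi_1,\xi_2,\theta_0,\dots,\theta_n)$, spanned by the two vector fields $$\frac{\partial}{\partial\theta_n},\qquad \pi_0\cos(\theta_0)\frac{\partial}{\partial\xi_1}+\pi_0\sin(\theta_0)\frac{\partial}{\partial\xi_2}+\sum_{i=0}^{n-1}\pi_{i+1}\sin(\theta_{i+1}-\theta_i)\frac{\partial}{\partial\theta_i},$$ where $\pi_i=\prod_{j=i+1}^{n}\cos(\theta_j-\theta_{j-1})$ and $\pi_n=1$. **Theorem.** Let $n\ge 0$ and let $\mathcal D$ be a Goursat structure on a smooth manifold $M$ of dimension $n+3$. For every point $q\in M$ there is a point $p\in\mathbb R^2\times(S^1)^{n+1}$ such that $\mathcal D$, at $q$, is locally equivalent to the $n$-trailer system, at $p$. -/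

import Mathlib

open scoped Manifold ContDiff Topology
open VectorField

noncomputable section

namespace Goursat

section Distributions

variable {E : Type*} [NormedAddCommGroup E] [NormedSpace ℝ E]
  {H : Type*} [TopologicalSpace H] (I : ModelWithCorners ℝ E H)
  {M : Type*} [TopologicalSpace M] [ChartedSpace H M] [IsManifold I ∞ M]

/-- The (not necessarily continuous) vector field `V` is smooth at `x`. -/
def SmoothAt (V : (x : M) → TangentSpace I x) (x : M) : Prop :=
  ContMDiffAt I I.tangent ∞ (fun y => (⟨y, V y⟩ : TangentBundle I M)) x

/-- `D` is a smooth distribution of rank `k`: locally it is spanned by `k` pointwise linearly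
independent smooth vector fields. -/
def IsDistribution (k : ℕ) (D : (p : M) → Submodule ℝ (TangentSpace I p)) : Prop :=
  ∀ p : M, ∃ U : Set M, IsOpen U ∧ p ∈ U ∧
    ∃ f : Fin k → (x : M) → TangentSpace I x,
      ∀ x ∈ U, (∀ i, SmoothAt I (f i) x) ∧
        LinearIndependent ℝ (fun i => f i x) ∧
        Submodule.span ℝ (Set.range fun i => f i x) = D x

/-- The vector fields that are smooth and tangent to `D` on a neighbourhood of `p`. -/
def sections (D : (p : M) → Submodule ℝ (TangentSpace I p)) (p : M) :
    Submodule ℝ ((x : M) → TangentSpace I x) where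
  carrier := {V | ∀ᶠ x in 𝓝 p, SmoothAt I V x ∧ V x ∈ D x}
  add_mem' := by
    intro V W hV hW
    filter_upwards [hV, hW] with x hVx hWx
    exact ⟨ContMDiffAt.add_section hVx.1 hWx.1, (D x).add_mem hVx.2 hWx.2⟩
  zero_mem' := Filter.Eventually.of_forall fun x =>
    ⟨Bundle.contMDiff_zeroSection ℝ (TangentSpace I : M → Type _) x, (D x).zero_mem⟩
  smul_mem' := by
    intro c V hV
    filter_upwards [hV] with x hVx
    exact ⟨ContMDiffAt.const_smul_section hVx.1, (D x).smul_mem c hVx.2⟩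

/-- The vector fields defined near `p` that belong to the `i`-th element of the derived flag
of `D`, where `D⁽⁰⁾ = D` and `D⁽ⁱ⁺¹⁾ = D⁽ⁱ⁾ + [D⁽ⁱ⁾, D⁽ⁱ⁾]`.
(Brackets of sections form a module over the smooth functions modulo `D⁽ⁱ⁾`, because
`f [V, W] = [f V, W] + (W f) V`; so real linear combinations suffice.) -/
def derivedSections (D : (p : M) → Submodule ℝ (TangentSpace I p)) (p : M) :
    ℕ → Submodule ℝ ((x : M) → TangentSpace I x)
  | 0 => sections I D p
  | i + 1 => derivedSections D p i ⊔
      Submodule.span ℝ {X | ∃ V ∈ derivedSections D p i, ∃ W ∈ derivedSections D p i,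
        X = mlieBracket I V W}

/-- The linear subspace `D⁽ⁱ⁾(p)` of the tangent space at `p`. -/
def derivedFlag (D : (p : M) → Submodule ℝ (TangentSpace I p)) (i : ℕ) (p : M) :
    Submodule ℝ (TangentSpace I p) :=
  (derivedSections I D p i).map (LinearMap.proj p)

/-- `D` is a Goursat structure on the manifold `M` of dimension `m = dim E ≥ 3`: a distribution
of rank two with `dim D⁽ⁱ⁾(p) = i + 2` for `0 ≤ i ≤ m - 2` and all `p`. -/
def IsGoursatStructure (D : (p : M) → Submodule ℝ (TangentSpace I p)) : Prop :=
  3 ≤ Module.finrank ℝ E ∧ IsDistribution I 2 D ∧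
    ∀ i : ℕ, i + 2 ≤ Module.finrank ℝ E →
      ∀ p : M, Module.finrank ℝ (derivedFlag I D i p) = i + 2

end Distributions

section Equivalence

variable {E : Type*} [NormedAddCommGroup E] [NormedSpace ℝ E]
  {H : Type*} [TopologicalSpace H] (I : ModelWithCorners ℝ E H)
  {M : Type*} [TopologicalSpace M] [ChartedSpace H M]
  {E' : Type*} [NormedAddCommGroup E'] [NormedSpace ℝ E']
  {H' : Type*} [TopologicalSpace H'] (J : ModelWithCorners ℝ E' H')
  {N : Type*} [TopologicalSpace N] [ChartedSpace H' N]

/-- The distributions `D` on `M` and `D'` on `N` are locally equivalent at `q` and `p`: some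
smooth diffeomorphism `φ` between open neighbourhoods of `q` and `p` maps `q` to `p` and
`D` onto `D'`. -/
def LocallyEquivalent (D : (x : M) → Submodule ℝ (TangentSpace I x)) (q : M)
    (D' : (y : N) → Submodule ℝ (TangentSpace J y)) (p : N) : Prop :=
  ∃ φ : OpenPartialHomeomorph M N, q ∈ φ.source ∧ φ q = p ∧
    ContMDiffOn I J ∞ φ φ.source ∧ ContMDiffOn J I ∞ φ.symm φ.target ∧
    ∀ x ∈ φ.source, (D x).map (mfderiv I J φ x).toLinearMap = D' (φ x)

end Equivalence

section Trailer

/-- The configuration space `ℝ² × (S¹)ⁿ⁺¹` of the `n`-trailer; a point `p` consists of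
`p.1 = (ξ₁, ξ₂)` and `p.2 = (exp (i θ₀), …, exp (i θₙ))`. -/
abbrev Config (n : ℕ) : Type := (ℝ × ℝ) × (Fin (n + 1) → Circle)

/-- The model with corners of `ℝ² × (S¹)ⁿ⁺¹` as a product of manifolds. -/
abbrev configModel (n : ℕ) :
    ModelWithCorners ℝ ((ℝ × ℝ) × (Fin (n + 1) → EuclideanSpace ℝ (Fin 1)))
      (ModelProd (ℝ × ℝ) (ModelPi fun _ : Fin (n + 1) => EuclideanSpace ℝ (Fin 1))) :=
  𝓘(ℝ, ℝ × ℝ).prod (ModelWithCorners.pi fun _ : Fin (n + 1) => 𝓡 1)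

variable {n : ℕ}

/-- The coordinate vector field `∂/∂ξ₁`: the velocity at time `0` of the coordinate line
through `p`. -/
def dXi₁ (p : Config n) : TangentSpace (configModel n) p :=
  mfderiv 𝓘(ℝ, ℝ) (configModel n)
    (fun t : ℝ => (((p.1.1 + t, p.1.2), p.2) : Config n)) 0 (1 : ℝ)

/-- The coordinate vector field `∂/∂ξ₂`. -/
def dXi₂ (p : Config n) : TangentSpace (configModel n) p :=
  mfderiv 𝓘(ℝ, ℝ) (configModel n)
    (fun t : ℝ => (((p.1.1, p.1.2 + t), p.2) : Config n)) 0 (1 : ℝ)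

/-- The coordinate vector field `∂/∂θᵢ`: the velocity at time `0` of the curve through `p` that
turns the `i`-th angle with unit speed and keeps the other coordinates fixed. -/
def dTheta (i : Fin (n + 1)) (p : Config n) : TangentSpace (configModel n) p :=
  mfderiv 𝓘(ℝ, ℝ) (configModel n)
    (fun t : ℝ => ((p.1, Function.update p.2 i (Circle.exp t * p.2 i)) : Config n)) 0 (1 : ℝ)

/-- `cos (θᵢ₊₁ - θᵢ)`. -/
def cosDiff (p : Config n) (i : Fin n) : ℝ := ((p.2 i.succ / p.2 i.castSucc : Circle) : ℂ).re

/-- `sin (θᵢ₊₁ - θᵢ)`. -/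
def sinDiff (p : Config n) (i : Fin n) : ℝ := ((p.2 i.succ / p.2 i.castSucc : Circle) : ℂ).im

/-- `πᵢ = ∏_{j = i+1}^{n} cos (θⱼ - θⱼ₋₁)`, with the product reindexed by `j - 1 ≥ i`;
in particular `πₙ = 1`. -/
def piCoeff (p : Config n) (i : Fin (n + 1)) : ℝ :=
  ∏ j : Fin n with i ≤ j.castSucc, cosDiff p j

/-- The first vector field `∂/∂θₙ` of the `n`-trailer system. -/
def trailerField₁ (p : Config n) : TangentSpace (configModel n) p :=
  dTheta (Fin.last n) p

/-- The second vector field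
`π₀ cos θ₀ ∂/∂ξ₁ + π₀ sin θ₀ ∂/∂ξ₂ + ∑_{i < n} πᵢ₊₁ sin (θᵢ₊₁ - θᵢ) ∂/∂θᵢ`. -/
def trailerField₂ (p : Config n) : TangentSpace (configModel n) p :=
  (piCoeff p 0 * (p.2 0 : ℂ).re) • dXi₁ p + (piCoeff p 0 * (p.2 0 : ℂ).im) • dXi₂ p +
    ∑ i : Fin n, (piCoeff p i.succ * sinDiff p i) • dTheta i.castSucc p

/-- The `n`-trailer system, a distribution on `ℝ² × (S¹)ⁿ⁺¹`. -/
def trailerSystem (n : ℕ) (p : Config n) : Submodule ℝ (TangentSpace (configModel n) p) :=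
  Submodule.span ℝ {trailerField₁ p, trailerField₂ p}

end Trailer

end Goursat

end

/-! The proof is Cartan's deprolongation. Near every point a Goursat structure in dimension m + 1 ≥
3 comes from one in dimension m by adjoining a direction as a new coordinate, and the trailer
systems arise from the plane by exactly this construction.

Modulo D⁽¹⁾ the bracket is a skew form on the rank three distribution D⁽¹⁾ with values in the line
D⁽²⁾/D⁽¹⁾. It is nonzero, so its kernel is a line field L, and L lies in D because [D, D] ⊂ D⁽¹⁾ (in
dimension three D⁽¹⁾ is everything and any L in D will do). A flow box turns L into ∂/∂t on S × ℝ.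
As D⁽¹⁾ contains ∂/∂t and is invariant under its flow, it is the preimage of a rank two distribution
Δ on S. The later members of the flag descend as well, so Δ is again of Goursat type. Finally D(x,
t) is spanned by ∂/∂t and a vector v(x, t) of Δ(x), and the line through v(x, t) turns with nonzero
speed in t because D is not involutive.

On the trailer side, let A be ∂/∂θ for the last angle θ and let B be the driving field. The next
system is spanned by the derivative along the new angle θ' and by cos(θ' - θ) B + sin(θ' - θ) A,
that is, by a line in the plane ⟨A, B⟩ with its own angle as the new coordinate. So if Φ carries Δ
to ⟨A, B⟩, then Φ together with θ ∘ Φ plus the angle of dΦ(v) carries D to the next system. Every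
direction has an angle, A included, so no genericity at q is needed. The induction ends in dimension
two, where the distribution is the whole tangent plane, with ∂/∂ξ₂ in the role of A and ∂/∂ξ₁ in the
role of B.

`IsGoursatStructure.exists_goursatFrame` replaces the manifold by a frame of iterated brackets in a
chart. `IsGoursatFrame.exists_characteristic`, `exists_flowBox`, `IsGoursatFrame.exists_base` and
`IsGoursatFrame.exists_quotient_frame` give the descent, `exists_prolongation` the ascent, and
`IsGoursatFrame.exists_angle_coordinates` the induction. The smooth flow behind the flow box comes
from the inverse function theorem on the Banach space of paths. -/

noncomputable section

namespace Goursat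

open Set Filter

/-! ### Germs of smooth maps -/

section SmoothNear

variable {E F G : Type*} [NormedAddCommGroup E] [NormedSpace ℝ E] [NormedAddCommGroup F]
  [NormedSpace ℝ F] [NormedAddCommGroup G] [NormedSpace ℝ G]

/-- `f` is smooth on a neighbourhood of `q`. -/
def SmoothNear (f : E → F) (q : E) : Prop := ∀ᶠ x in 𝓝 q, ContDiffAt ℝ ∞ f x

protected theorem SmoothNear.contDiffAt {f : E → F} {q : E}
    (h : SmoothNear f q) : ContDiffAt ℝ ∞ f q :=
  h.self_of_nhds

protected theorem SmoothNear.differentiableAt {f : E → F} {q : E} (h : SmoothNear f q) :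
    DifferentiableAt ℝ f q := h.contDiffAt.differentiableAt (by simp)

protected theorem SmoothNear.continuousAt {f : E → F} {q : E} (h : SmoothNear f q) :
    ContinuousAt f q := h.contDiffAt.continuousAt

protected theorem SmoothNear.eventually {f : E → F} {q : E} (h : SmoothNear f q) :
    ∀ᶠ x in 𝓝 q, SmoothNear f x := h.eventually_nhds

theorem _root_.ContDiff.smoothNear {f : E → F} (h : ContDiff ℝ ∞ f) (q : E) : SmoothNear f q :=
  Eventually.of_forall fun _ => h.contDiffAt

protected theorem SmoothNear.comp {g : F → G} {f : E → F} {q : E} (hg : SmoothNear g (f q))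
    (hf : SmoothNear f q) : SmoothNear (fun x => g (f x)) q := by
  filter_upwards [hf, hf.continuousAt.eventually hg] with x hx hx'
  exact hx'.comp x hx

protected theorem SmoothNear.add {f g : E → F} {q : E} (hf : SmoothNear f q) (hg : SmoothNear g q) :
    SmoothNear (fun x => f x + g x) q := by
  filter_upwards [hf, hg] with x h1 h2 using h1.add h2

protected theorem SmoothNear.sub {f g : E → F} {q : E} (hf : SmoothNear f q) (hg : SmoothNear g q) :
    SmoothNear (fun x => f x - g x) q := by
  filter_upwards [hf, hg] with x h1 h2 using h1.sub h2

protected theorem SmoothNear.neg {f : E → F} {q : E} (hf : SmoothNear f q) :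
    SmoothNear (fun x => -f x) q := by
  filter_upwards [hf] with x h1 using h1.neg

protected theorem SmoothNear.smul {f : E → ℝ} {g : E → F} {q : E} (hf : SmoothNear f q)
    (hg : SmoothNear g q) : SmoothNear (fun x => f x • g x) q := by
  filter_upwards [hf, hg] with x h1 h2 using h1.smul h2

protected theorem SmoothNear.sum {ι : Type*} {s : Finset ι} {f : ι → E → F} {q : E}
    (hf : ∀ i ∈ s, SmoothNear (f i) q) : SmoothNear (fun x => ∑ i ∈ s, f i x) q := by
  filter_upwards [(eventually_all_finset s).2 hf] with x hx
  exact ContDiffAt.sum hx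

protected theorem SmoothNear.prodMk {f : E → F} {g : E → G} {q : E} (hf : SmoothNear f q)
    (hg : SmoothNear g q) : SmoothNear (fun x => (f x, g x)) q := by
  filter_upwards [hf, hg] with x h1 h2 using h1.prodMk h2

protected theorem SmoothNear.clm_apply {f : E → F →L[ℝ] G} {g : E → F} {q : E} (hf : SmoothNear f q)
    (hg : SmoothNear g q) : SmoothNear (fun x => f x (g x)) q := by
  filter_upwards [hf, hg] with x h1 h2 using h1.clm_apply h2

protected theorem SmoothNear.fderiv {f : E → F} {q : E} (hf : SmoothNear f q) :
    SmoothNear (fderiv ℝ f) q := by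
  filter_upwards [hf] with x h1 using h1.fderiv_right (by simp)

protected theorem SmoothNear.lieBracket {V W : E → E} {q : E} (hV : SmoothNear V q)
    (hW : SmoothNear W q) : SmoothNear (lieBracket ℝ V W) q :=
  (hW.fderiv.clm_apply hV).sub (hV.fderiv.clm_apply hW)

end SmoothNear

/-! ### Superposition and integration operators on the space of paths -/

section Superposition

open scoped unitInterval

variable {E F : Type} [NormedAddCommGroup E] [NormedSpace ℝ E] [NormedAddCommGroup F]
  [NormedSpace ℝ F]

/-- The pointwise action of a continuous family of linear maps on continuous paths. -/
def pathApply : C(I, E →L[ℝ] F) →L[ℝ] C(I, E) →L[ℝ] C(I, F) :=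
  LinearMap.mkContinuous₂
    (LinearMap.mk₂ ℝ (fun (A : C(I, E →L[ℝ] F)) (h : C(I, E)) =>
        (⟨fun t => A t (h t), by fun_prop⟩ : C(I, F)))
      (by intros; ext; simp) (by intros; ext; simp) (by intros; ext; simp)
      (by intros; ext; simp)) 1 (by
    intro A h
    rw [one_mul]
    refine (ContinuousMap.norm_le _ (by positivity)).2 fun t => ?_
    exact ((A t).le_opNorm _).trans
      (mul_le_mul (A.norm_coe_le_norm t) (h.norm_coe_le_norm t) (by positivity) (by positivity)))

@[simp] theorem pathApply_apply (A : C(I, E →L[ℝ] F)) (h : C(I, E)) (t : I) :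
    pathApply A h t = A t (h t) := rfl

/-- The mean value inequality at each time gives an error ε‖h‖. It is uniform in time because the
image of the path is compact. -/
theorem hasFDerivAt_postcomp (f : C(E, F)) (f' : C(E, E →L[ℝ] F))
    (hf : ∀ x, HasFDerivAt f (f' x) x) (γ : C(I, E)) :
    HasFDerivAt (fun γ : C(I, E) => f.comp γ) (pathApply (f'.comp γ)) γ := by
  rw [hasFDerivAt_iff_isLittleO_nhds_zero, Asymptotics.isLittleO_iff]
  intro ε hε
  have hK : IsCompact (range γ) := isCompact_range γ.continuous
  -- Only the first of the two compared points has to lie on the compact image, which matters since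
  -- `E` need not be locally compact.
  have hu := hK.uniformContinuousAt_of_continuousAt f' (fun x _ => f'.continuous.continuousAt)
    (Metric.dist_mem_uniformity hε)
  obtain ⟨δ, hδ, H⟩ := Metric.mem_uniformity_dist.1 hu
  filter_upwards [Metric.ball_mem_nhds (0 : C(I, E)) hδ] with h hh
  rw [mem_ball_zero_iff] at hh
  refine (ContinuousMap.norm_le _ (by positivity)).2 fun t => ?_
  have hht : ‖h t‖ < δ := (h.norm_coe_le_norm t).trans_lt hh
  have key := (convex_ball (γ t) δ).norm_image_sub_le_of_norm_hasFDerivWithin_le'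
    (f := f) (f' := fun x => f' x) (φ := f' (γ t)) (C := ε)
    (fun x _ => (hf x).hasFDerivWithinAt)
    (fun x hx => by
      have h2 := H (a := γ t) (b := x) (by rwa [dist_comm]) (mem_range_self t)
      rw [← dist_eq_norm, dist_comm]
      exact le_of_lt h2)
    (x := γ t) (y := γ t + h t) (Metric.mem_ball_self hδ) (by simpa using hht)
  simp only [add_sub_cancel_left] at key
  refine (le_trans ?_ key).trans (by gcongr; exact h.norm_coe_le_norm t)
  simp

/-- The derivative is the superposition operator of `fderiv ℝ f` followed by the continuous linear
map `pathApply`, so the induction must let `F` vary. -/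
theorem contDiff_postcomp_nat (n : ℕ) : ∀ {F : Type} [NormedAddCommGroup F] [NormedSpace ℝ F]
    (f : C(E, F)), ContDiff ℝ ∞ f → ContDiff ℝ n (fun γ : C(I, E) => f.comp γ) := by
  induction n with
  | zero =>
    intro F _ _ f _
    exact contDiff_zero.2 (ContinuousMap.continuous_postcomp f)
  | succ n ih =>
    intro F _ _ f hf
    have hf' : ContDiff ℝ ∞ (fderiv ℝ f) := hf.fderiv_right (by simp)
    have hd := hasFDerivAt_postcomp f ⟨fderiv ℝ f, hf'.continuous⟩
      fun x => (hf.differentiable (by simp) x).hasFDerivAt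
    push_cast
    rw [contDiff_succ_iff_hasFDerivAt]
    refine ⟨_, ?_, hd⟩
    exact (ContinuousLinearMap.contDiff (E := C(I, E →L[ℝ] F)) (F := C(I, E) →L[ℝ] C(I, F))
      pathApply).comp (ih ⟨fderiv ℝ f, hf'.continuous⟩ hf')

theorem contDiff_postcomp (f : C(E, F)) (hf : ContDiff ℝ ∞ f) :
    ContDiff ℝ ∞ (fun γ : C(I, E) => f.comp γ) :=
  contDiff_infty.2 fun n => contDiff_postcomp_nat n f hf

end Superposition

section Primitive

open scoped unitInterval

variable {E : Type*} [NormedAddCommGroup E] [NormedSpace ℝ E]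

/-- The primitive of a continuous path that vanishes at `0`. -/
def primitive : C(I, E) →L[ℝ] C(I, E) :=
  LinearMap.mkContinuous
    { toFun := fun γ => ⟨fun t => ∫ s in (0 : ℝ)..t, IccExtend zero_le_one γ s,
        (intervalIntegral.continuous_primitive
          (fun a b => (γ.continuous.Icc_extend').intervalIntegrable a b) 0).comp
          continuous_subtype_val⟩
      map_add' := by
        intro γ δ
        ext t
        simp only [ContinuousMap.coe_mk, ContinuousMap.add_apply]
        rw [← intervalIntegral.integral_add
          (γ.continuous.Icc_extend'.intervalIntegrable _ _)
          (δ.continuous.Icc_extend'.intervalIntegrable _ _)]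
        rfl
      map_smul' := by
        intro c γ
        ext t
        simp only [ContinuousMap.coe_mk, ContinuousMap.smul_apply, RingHom.id_apply]
        rw [← intervalIntegral.integral_smul]
        rfl } 1 (by
    intro γ
    rw [one_mul]
    refine (ContinuousMap.norm_le _ (by positivity)).2 fun t => ?_
    refine (intervalIntegral.norm_integral_le_of_norm_le_const (C := ‖γ‖) ?_).trans ?_
    · intro s _
      exact γ.norm_coe_le_norm _
    · have := t.2
      rw [sub_zero, abs_of_nonneg this.1]
      exact mul_le_of_le_one_right (norm_nonneg _) this.2)


theorem primitive_apply (γ : C(I, E)) (t : I) :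
    primitive γ t = ∫ s in (0 : ℝ)..t, IccExtend zero_le_one γ s := rfl

end Primitive

/-! ### The inverse function theorem with smooth inverse -/

section LocalInverse

variable {E F : Type*} [NormedAddCommGroup E] [NormedSpace ℝ E] [CompleteSpace E]
  [NormedAddCommGroup F] [NormedSpace ℝ F]

theorem eventually_isInvertible {L : E →L[ℝ] F} (h : L.IsInvertible) :
    ∀ᶠ A : E →L[ℝ] F in 𝓝 L, A.IsInvertible := by
  obtain ⟨e, rfl⟩ := h
  exact e.nhds

protected theorem SmoothNear.eventually_isInvertible {g : E → F} {a : E} (hg : SmoothNear g a)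
    (h : (fderiv ℝ g a).IsInvertible) : ∀ᶠ x in 𝓝 a, (fderiv ℝ g x).IsInvertible :=
  hg.fderiv.continuousAt.eventually (Goursat.eventually_isInvertible h)

/-- The source is shrunk until smoothness and invertibility of the derivative hold at each of its
points. The inverse is then smooth on the whole target and not just at the image of `a`. -/
protected theorem SmoothNear.exists_openPartialHomeomorph {g : E → F} {a : E} (hg : SmoothNear g a)
    (h : (fderiv ℝ g a).IsInvertible) :
    ∃ e : OpenPartialHomeomorph E F, (e : E → F) = g ∧ a ∈ e.source ∧
      (∀ x ∈ e.source, ContDiffAt ℝ ∞ g x) ∧ (∀ x ∈ e.source, (fderiv ℝ g x).IsInvertible) ∧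
      ∀ y ∈ e.target, ContDiffAt ℝ ∞ e.symm y := by
  obtain ⟨e', he'⟩ := h
  have hd : HasFDerivAt g (e' : E →L[ℝ] F) a := by
    rw [he']; exact hg.differentiableAt.hasFDerivAt
  let e₀ := hg.contDiffAt.toOpenPartialHomeomorph g hd (by simp)
  obtain ⟨U, hU, hUo, haU⟩ := eventually_nhds_iff.1
    (Filter.Eventually.and hg (hg.eventually_isInvertible ⟨e', he'⟩))
  let e := e₀.restrOpen U hUo
  have hsrc : ∀ x ∈ e.source, x ∈ U := fun x hx => hx.2
  refine ⟨e, rfl, ⟨hg.contDiffAt.mem_toOpenPartialHomeomorph_source hd (by simp), haU⟩,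
    fun x hx => (hU x (hsrc x hx)).1, fun x hx => (hU x (hsrc x hx)).2, fun y hy => ?_⟩
  have hx := hU _ (hsrc _ (e.map_target hy))
  obtain ⟨ex, hex⟩ := hx.2
  refine e.contDiffAt_symm hy (f₀' := ex) ?_ hx.1
  rw [hex]
  exact (hx.1.differentiableAt (by simp)).hasFDerivAt

end LocalInverse

/-! ### Smooth flows from the inverse function theorem -/

section Flow

open scoped unitInterval

variable {E : Type} [NormedAddCommGroup E] [NormedSpace ℝ E]

/-- Constant paths. -/
def constPath : E →L[ℝ] C(I, E) :=
  LinearMap.mkContinuous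
    { toFun := ContinuousMap.const I
      map_add' := fun _ _ => rfl
      map_smul' := fun _ _ => rfl } 1 (by
    intro x
    rw [one_mul]
    exact (ContinuousMap.norm_le _ (by positivity)).2 fun t => le_rfl)

@[simp] theorem constPath_apply (x : E) (t : I) : constPath x t = x := rfl

/-- The zeros of the last component of this map are the solutions `γ` of `γ' = s f(γ)`,
`γ(0) = x`. -/
def picardMap (f : C(E, E)) (z : ℝ × E × C(I, E)) : ℝ × E × C(I, E) :=
  (z.1, z.2.1, z.2.2 - constPath z.2.1 - z.1 • primitive (f.comp z.2.2))

theorem contDiff_picardMap (f : C(E, E)) (hf : ContDiff ℝ ∞ f) :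
    ContDiff ℝ ∞ (picardMap f) := by
  have h1 : ContDiff ℝ ∞ fun z : ℝ × E × C(I, E) => primitive (f.comp z.2.2) :=
    (primitive (E := E)).contDiff.comp
      ((contDiff_postcomp f hf).comp (contDiff_snd.comp contDiff_snd))
  have h2 : ContDiff ℝ ∞ fun z : ℝ × E × C(I, E) => constPath z.2.1 :=
    (constPath (E := E)).contDiff.comp (contDiff_fst.comp contDiff_snd)
  exact contDiff_fst.prodMk ((contDiff_fst.comp contDiff_snd).prodMk
    (((contDiff_snd.comp contDiff_snd).sub h2).sub (contDiff_fst.smul h1)))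

/-- At s = 0 the factor s kills the derivative of the nonlinear term. What remains is the triangular
map (σ, ξ, h) ↦ (σ, ξ, h - ξ - σ p), where p is the primitive of f ∘ γ. -/
theorem isInvertible_fderiv_picardMap (f : C(E, E)) (hf : ContDiff ℝ ∞ f) (x : E) (γ : C(I, E)) :
    (fderiv ℝ (picardMap f) (0, x, γ)).IsInvertible := by
  set p := primitive (f.comp γ) with hp
  have hN : DifferentiableAt ℝ (fun z : ℝ × E × C(I, E) => primitive (f.comp z.2.2)) (0, x, γ) :=
    ((primitive (E := E)).contDiff.comp
      ((contDiff_postcomp f hf).comp (contDiff_snd.comp contDiff_snd))).differentiable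
      (by simp) _
  have h1 : HasFDerivAt (fun z : ℝ × E × C(I, E) => z.1)
    (ContinuousLinearMap.fst ℝ ℝ (E × C(I, E))) (0, x, γ) := hasFDerivAt_fst
  have h2 : HasFDerivAt (fun z : ℝ × E × C(I, E) => z.2.1)
    ((ContinuousLinearMap.fst ℝ E C(I, E)).comp (ContinuousLinearMap.snd ℝ ℝ (E × C(I, E))))
    (0, x, γ) := ContinuousLinearMap.hasFDerivAt
      ((ContinuousLinearMap.fst ℝ E C(I, E)).comp (ContinuousLinearMap.snd ℝ ℝ (E × C(I, E))))
  have h3 : HasFDerivAt (fun z : ℝ × E × C(I, E) => z.2.2)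
    ((ContinuousLinearMap.snd ℝ E C(I, E)).comp (ContinuousLinearMap.snd ℝ ℝ (E × C(I, E))))
    (0, x, γ) := ContinuousLinearMap.hasFDerivAt
      ((ContinuousLinearMap.snd ℝ E C(I, E)).comp (ContinuousLinearMap.snd ℝ ℝ (E × C(I, E))))
  have h4 : HasFDerivAt (fun z : ℝ × E × C(I, E) => constPath z.2.1) _ (0, x, γ) :=
    (constPath (E := E)).hasFDerivAt.comp _ h2
  have key := h1.prodMk (h2.prodMk ((h3.sub h4).sub (h1.smul hN.hasFDerivAt)))
  have key' : fderiv ℝ (picardMap f) (0, x, γ) = _ := key.fderiv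
  rw [key']
  refine ContinuousLinearMap.IsInvertible.of_inverse
    (g := (ContinuousLinearMap.fst ℝ ℝ (E × C(I, E))).prod
      (((ContinuousLinearMap.fst ℝ E C(I, E)).comp
        (ContinuousLinearMap.snd ℝ ℝ (E × C(I, E)))).prod
      ((ContinuousLinearMap.snd ℝ E C(I, E)).comp (ContinuousLinearMap.snd ℝ ℝ (E × C(I, E))) +
        constPath.comp ((ContinuousLinearMap.fst ℝ E C(I, E)).comp
          (ContinuousLinearMap.snd ℝ ℝ (E × C(I, E)))) +
        (ContinuousLinearMap.fst ℝ ℝ (E × C(I, E))).smulRight p))) ?_ ?_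
  · refine ContinuousLinearMap.ext fun z => Prod.ext ?_ (Prod.ext ?_ ?_)
    · simp
    · simp
    · simp only [← hp]
      simp
      abel
  · refine ContinuousLinearMap.ext fun z => Prod.ext ?_ (Prod.ext ?_ ?_)
    · simp
    · simp
    · simp only [← hp]
      simp
      abel

/-- If γ solves γ' = s f(γ), then t ↦ γ(c t) solves the equation with speed c s. This links the
parameter s to the time along the path. -/
theorem picardMap_comp_scale (f : C(E, E)) {s : ℝ} {x : E} {γ : C(I, E)}
    (h : picardMap f (s, x, γ) = (s, x, 0)) (c : I) :
    picardMap f (c * s, x, γ.comp ⟨fun t => c * t, by fun_prop⟩) = (c * s, x, 0) := by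
  have h3 : γ - constPath x - s • primitive (f.comp γ) = 0 := congrArg (fun z => z.2.2) h
  refine Prod.ext rfl (Prod.ext rfl ?_)
  ext t
  have h4 := congrArg (fun δ : C(I, E) => δ (c * t)) h3
  simp only [ContinuousMap.sub_apply, constPath_apply, ContinuousMap.smul_apply,
    ContinuousMap.zero_apply] at h4
  simp only [picardMap, ContinuousMap.sub_apply, constPath_apply, ContinuousMap.smul_apply,
    ContinuousMap.zero_apply, ContinuousMap.comp_apply, ContinuousMap.coe_mk]
  rw [← h4, mul_comm (c : ℝ) s, mul_smul]
  congr 2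
  rw [primitive_apply, primitive_apply]
  have := intervalIntegral.smul_integral_comp_mul_left
    (f := IccExtend zero_le_one (f.comp γ)) (c : ℝ) (a := 0) (b := t)
  rw [mul_zero] at this
  rw [show ((c * t : I) : ℝ) = (c : ℝ) * t from rfl, ← this]
  congr 1
  refine intervalIntegral.integral_congr fun u hu => ?_
  rw [uIcc_of_le t.2.1] at hu
  have hu1 : u ∈ I := ⟨hu.1, hu.2.trans t.2.2⟩
  have hu2 : (c : ℝ) * u ∈ I := unitInterval.mul_mem c.2 hu1
  change IccExtend zero_le_one _ u = IccExtend zero_le_one _ ((c : ℝ) * u)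
  rw [IccExtend_of_mem _ _ hu1, IccExtend_of_mem _ _ hu2]
  rfl

/-- The local inverse of `picardMap` yields solutions γ depending smoothly on (s, x), and Ψ(s, x) =
γ(1) is the flow. By local uniqueness and rescaling, Ψ(c s, x) = γ(c). Differentiating at c = 1
gives s ∂ₛΨ = s f(Ψ). -/
theorem exists_smooth_flow_of_contDiff [CompleteSpace E] (f : C(E, E)) (hf : ContDiff ℝ ∞ f)
    (q : E) :
    ∃ Ψ : ℝ × E → E, SmoothNear Ψ (0, q) ∧ (∀ᶠ x in 𝓝 q, Ψ (0, x) = x) ∧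
      ∀ᶠ z in 𝓝 ((0 : ℝ), q), fderiv ℝ Ψ z (1, 0) = f (Ψ z) := by
  set a : ℝ × E × C(I, E) := (0, q, constPath q) with ha
  obtain ⟨e, he, hae, -, -, hsymm⟩ := ((contDiff_picardMap f hf).smoothNear a
    ).exists_openPartialHomeomorph (isInvertible_fderiv_picardMap f hf q (constPath q))
  have hea : e a = (0, q, 0) := by simp [he, ha, picardMap]
  let j : ℝ × E → ℝ × E × C(I, E) := fun z => (z.1, z.2, 0)
  have hj : ContDiff ℝ ∞ j := contDiff_fst.prodMk (contDiff_snd.prodMk contDiff_const)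
  let γ : ℝ × E → C(I, E) := fun z => (e.symm (j z)).2.2
  have hjt : ∀ᶠ z in 𝓝 ((0 : ℝ), q), j z ∈ e.target := by
    refine hj.continuous.continuousAt.eventually (e.open_target.mem_nhds ?_)
    change (0, q, 0) ∈ e.target
    rw [← hea]; exact e.map_source hae
  have hγs : SmoothNear γ (0, q) := by
    filter_upwards [hjt] with z hz
    exact (contDiff_snd.comp contDiff_snd).contDiffAt.comp z
      ((hsymm _ hz).comp z hj.contDiffAt)
  have hγ0 : γ (0, q) = constPath q := by
    have : e.symm (j (0, q)) = a := by
      rw [show j (0, q) = e a from hea.symm, e.left_inv hae]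
    simp [γ, this, ha]
  have hγ : ∀ z, j z ∈ e.target → picardMap f (z.1, z.2, γ z) = j z := by
    intro z hz
    have h1 := e.right_inv hz
    rw [he] at h1
    have h2 : (e.symm (j z)).1 = z.1 := congrArg (fun w => w.1) h1
    have h3 : (e.symm (j z)).2.1 = z.2 := congrArg (fun w => w.2.1) h1
    have : (z.1, z.2, γ z) = e.symm (j z) := by rw [← h2, ← h3]
    rw [this, h1]
  obtain ⟨r, hr, hball⟩ := Metric.isOpen_iff.1 e.open_source a hae
  have huniq : ∀ s x δ, (s, x, δ) ∈ Metric.ball a r → picardMap f (s, x, δ) = (s, x, 0) →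
      γ (s, x) = δ := by
    intro s x δ hδ h
    have := e.left_inv (hball hδ)
    rw [he, h] at this
    simp [γ, j, this]
  let Ψ : ℝ × E → E := fun z => γ z 1
  have hΨs : SmoothNear Ψ (0, q) := by
    filter_upwards [hγs] with z hz
    exact (ContinuousMap.evalCLM ℝ (1 : I)).contDiff.contDiffAt.comp z hz
  have hnear : ∀ᶠ z in 𝓝 ((0 : ℝ), q), (z.1, z.2, γ z) ∈ Metric.ball a r := by
    have hc : ContinuousAt (fun z : ℝ × E => (z.1, z.2, γ z)) (0, q) :=
      continuousAt_fst.prodMk (continuousAt_snd.prodMk hγs.continuousAt)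
    refine hc.eventually (Metric.isOpen_ball.mem_nhds ?_)
    simpa [ha, hγ0] using hr
  have hscale : ∀ᶠ z in 𝓝 ((0 : ℝ), q), ∀ c : I, Ψ (c * z.1, z.2) = γ z c := by
    filter_upwards [hjt, hnear] with z hz hz' c
    have h1 := picardMap_comp_scale f (hγ z hz) c
    have h2 := huniq _ _ _ ?_ h1
    · simp only [Ψ, h2, ContinuousMap.comp_apply, ContinuousMap.coe_mk, mul_one]
    · rw [Metric.mem_ball, dist_eq_norm] at hz' ⊢
      refine lt_of_le_of_lt ?_ hz'
      -- The rescaled triple is no farther from `a` than the original one, so it stays in the ball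
      -- where `e` is injective.
      simp only [ha, Prod.mk_sub_mk, Prod.norm_mk, sub_zero]
      refine max_le_max ?_ (max_le_max le_rfl ?_)
      · rw [norm_mul]
        refine mul_le_of_le_one_left (norm_nonneg _) ?_
        rw [Real.norm_of_nonneg c.2.1]; exact c.2.2
      · refine (ContinuousMap.norm_le _ (norm_nonneg _)).2 fun t => ?_
        exact ContinuousMap.norm_coe_le_norm (γ z - constPath q) (c * t)
  refine ⟨Ψ, hΨs, ?_, ?_⟩
  · have hi : ContinuousAt (fun x : E => ((0 : ℝ), x)) q := by fun_prop
    filter_upwards [hi.eventually hjt] with x hx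
    have h1 := hγ _ hx
    have h2 : γ (0, x) - constPath x - (0 : ℝ) • primitive (f.comp (γ (0, x))) = 0 :=
      congrArg (fun w => w.2.2) h1
    rw [zero_smul, sub_zero, sub_eq_zero] at h2
    simp [Ψ, h2]
  · have hne : ∀ᶠ z in 𝓝 ((0 : ℝ), q), z.1 ≠ 0 → fderiv ℝ Ψ z (1, 0) = f (Ψ z) := by
      filter_upwards [hjt, hscale, hΨs] with z hz hsc hsm hz0
      have h1 : γ z - constPath z.2 - z.1 • primitive (f.comp (γ z)) = 0 :=
        congrArg (fun w => w.2.2) (hγ z hz)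
      have hΨd : HasFDerivAt Ψ (fderiv ℝ Ψ z) z :=
        (hsm.differentiableAt (by simp)).hasFDerivAt
      have hl : HasDerivAt (fun c : ℝ => (c * z.1, z.2)) ((z.1, 0) : ℝ × E) 1 := by
        refine HasDerivAt.prodMk ?_ (hasDerivAt_const _ _)
        simpa using (hasDerivAt_id (1 : ℝ)).mul_const z.1
      have hA : HasDerivAt (fun c : ℝ => Ψ (c * z.1, z.2)) (fderiv ℝ Ψ z (z.1, 0)) 1 := by
        have hΨd' : HasFDerivAt Ψ (fderiv ℝ Ψ z) ((1 : ℝ) * z.1, z.2) := by simpa using hΨd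
        exact hΨd'.comp_hasDerivAt 1 hl
      have hcont : Continuous (IccExtend zero_le_one (f.comp (γ z))) :=
        (f.comp (γ z)).continuous.Icc_extend'
      have hB : HasDerivAt (fun c : ℝ => z.2 + z.1 • ∫ u in (0 : ℝ)..c,
          IccExtend zero_le_one (f.comp (γ z)) u)
          (z.1 • IccExtend zero_le_one (f.comp (γ z)) 1) 1 :=
        ((intervalIntegral.integral_hasDerivAt_right (hcont.intervalIntegrable _ _)
          (hcont.stronglyMeasurableAtFilter _ _) hcont.continuousAt).const_smul z.1).const_add z.2
      have hAB : ∀ c ∈ I, Ψ (c * z.1, z.2) = z.2 + z.1 • ∫ u in (0 : ℝ)..c,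
          IccExtend zero_le_one (f.comp (γ z)) u := by
        intro c hc
        have h2 := hsc ⟨c, hc⟩
        have h3 := congrArg (fun δ : C(I, E) => δ ⟨c, hc⟩) h1
        simp only [ContinuousMap.sub_apply, constPath_apply, ContinuousMap.smul_apply,
          ContinuousMap.zero_apply, primitive_apply] at h3
        rw [h2, sub_sub, sub_eq_zero] at *
        exact h3
      have h1m : (1 : ℝ) ∈ I := ⟨zero_le_one, le_rfl⟩
      -- The two expressions agree only for c in [0, 1], so their derivatives at the endpoint 1 are
      -- compared within that interval.
      have hA' := hA.hasDerivWithinAt (s := I)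
      have hB' := (hB.hasDerivWithinAt (s := I)).congr hAB (hAB 1 h1m)
      have huq := (uniqueDiffOn_Icc_zero_one 1 h1m).eq_deriv _ hA' hB'
      rw [IccExtend_of_mem _ _ h1m, show ((z.1, 0) : ℝ × E) = z.1 • (1, 0) by simp, map_smul] at huq
      have := smul_right_injective E hz0 huq
      exact this
    have hcl : ∀ᶠ z in 𝓝 ((0 : ℝ), q), ContinuousAt (fun z => fderiv ℝ Ψ z (1, 0)) z ∧
        ContinuousAt (fun z => f (Ψ z)) z := by
      filter_upwards [hΨs.eventually] with z hz
      refine ⟨?_, f.continuous.continuousAt.comp hz.continuousAt⟩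
      exact hz.fderiv.continuousAt.clm_apply continuousAt_const
    filter_upwards [hne.eventually_nhds, hcl] with z hz hz'
    -- The factor s cannot be cancelled at s = 0. There the equation follows by continuity from s ≠
    -- 0.
    by_cases hz0 : z.1 = 0
    · have hl : Tendsto (fun s : ℝ => (s, z.2)) (𝓝[≠] 0) (𝓝 z) := by
        have : ContinuousAt (fun s : ℝ => (s, z.2)) 0 := by fun_prop
        have h2 : Tendsto (fun s : ℝ => (s, z.2)) (𝓝[≠] 0) (𝓝 (0, z.2)) :=
          this.tendsto.mono_left nhdsWithin_le_nhds
        rwa [show ((0 : ℝ), z.2) = z from Prod.ext hz0.symm rfl] at h2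
      refine tendsto_nhds_unique_of_eventuallyEq (hz'.1.tendsto.comp hl) (hz'.2.tendsto.comp hl) ?_
      filter_upwards [hl.eventually hz, self_mem_nhdsWithin] with s hs hs0
      exact hs hs0
    · exact hz.self_of_nhds hz0

end Flow

/-! ### Straightening a nonvanishing vector field -/

section FlowBox

/-- Multiplying by a bump function supported where `f` is smooth gives the globally smooth field
that the flow construction requires. -/
protected theorem SmoothNear.exists_contDiff {E : Type*} [NormedAddCommGroup E] [NormedSpace ℝ E]
    [FiniteDimensional ℝ E] {F : Type*} [NormedAddCommGroup F] [NormedSpace ℝ F] {f : E → F}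
    {q : E} (hf : SmoothNear f q) : ∃ g : E → F, ContDiff ℝ ∞ g ∧ g =ᶠ[𝓝 q] f := by
  obtain ⟨R, hR, hball⟩ := Metric.eventually_nhds_iff_ball.1 hf
  let χ : ContDiffBump q := ⟨R / 4, R / 2, by positivity, by linarith⟩
  refine ⟨fun x => χ x • f x, contDiff_iff_contDiffAt.2 fun x => ?_, ?_⟩
  · by_cases hx : x ∈ Metric.closedBall q (R / 2)
    · exact χ.contDiffAt.smul (hball x (Metric.closedBall_subset_ball (by linarith) hx))
    · have : (fun x => χ x • f x) =ᶠ[𝓝 x] fun _ => 0 := by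
        filter_upwards [Metric.isClosed_closedBall.isOpen_compl.mem_nhds hx] with y hy
        have : χ y = 0 := by
          refine χ.zero_of_le_dist ?_
          simp only [mem_compl_iff, Metric.mem_closedBall, not_le] at hy
          exact hy.le
        simp [this]
      exact contDiffAt_const.congr_of_eventuallyEq this
  · filter_upwards [χ.eventuallyEq_one] with x hx
    simp at hx
    simp [hx]

protected theorem SmoothNear.exists_flow {E : Type} [NormedAddCommGroup E] [NormedSpace ℝ E]
    [FiniteDimensional ℝ E] {f : E → E} {q : E} (hf : SmoothNear f q) :
    ∃ Ψ : ℝ × E → E, SmoothNear Ψ (0, q) ∧ (∀ᶠ x in 𝓝 q, Ψ (0, x) = x) ∧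
      ∀ᶠ z in 𝓝 ((0 : ℝ), q), fderiv ℝ Ψ z (1, 0) = f (Ψ z) := by
  have := FiniteDimensional.complete ℝ E
  obtain ⟨g, hg, hgf⟩ := hf.exists_contDiff
  obtain ⟨Ψ, h1, h2, h3⟩ := exists_smooth_flow_of_contDiff ⟨g, hg.continuous⟩ hg q
  refine ⟨Ψ, h1, h2, ?_⟩
  have : Tendsto Ψ (𝓝 (0, q)) (𝓝 q) := by
    have := h1.continuousAt.tendsto
    rwa [h2.self_of_nhds] at this
  filter_upwards [h3, this.eventually hgf] with z hz hz'
  rw [hz]; exact hz'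

/-- Take G(y, t) = Ψ(t, q + y) with Ψ the flow and y in a complement of the line ℝ f(q). The
derivative at 0 is (y, t) ↦ y + t f(q), an isomorphism. -/
theorem exists_flowBox {E : Type} [NormedAddCommGroup E] [NormedSpace ℝ E]
    [FiniteDimensional ℝ E] {f : E → E} {q : E} (hf : SmoothNear f q) (hq : f q ≠ 0) :
    ∃ S : Submodule ℝ E, Module.finrank ℝ S + 1 = Module.finrank ℝ E ∧ ∃ G : S × ℝ → E,
      SmoothNear G 0 ∧ G 0 = q ∧ (fderiv ℝ G 0).IsInvertible ∧
      ∀ᶠ z in 𝓝 0, fderiv ℝ G z (0, 1) = f (G z) := by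
  obtain ⟨Ψ, h1, h2, h3⟩ := hf.exists_flow
  obtain ⟨S, hS⟩ := Submodule.exists_isCompl (ℝ ∙ f q)
  have hdim : Module.finrank ℝ S + 1 = Module.finrank ℝ E := by
    have := Submodule.finrank_add_eq_of_isCompl hS
    rw [finrank_span_singleton hq] at this
    omega
  let A : S × ℝ →L[ℝ] ℝ × E := (ContinuousLinearMap.snd ℝ S ℝ).prod
    (S.subtypeL.comp (ContinuousLinearMap.fst ℝ S ℝ))
  let j : S × ℝ → ℝ × E := fun z => A z + (0, q)
  have hj : ContDiff ℝ ∞ j := A.contDiff.add contDiff_const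
  have hj0 : j 0 = (0, q) := by simp [j]
  have hjt : Tendsto j (𝓝 0) (𝓝 (0, q)) := by
    rw [← hj0]; exact hj.continuous.continuousAt
  have hjd : ∀ z, HasFDerivAt j A z := fun z => A.hasFDerivAt.add_const _
  have hG0 : SmoothNear (fun z => Ψ (j z)) 0 := by
    refine SmoothNear.comp ?_ (hj.smoothNear 0)
    rwa [hj0]
  have hd : ∀ᶠ z in 𝓝 (0 : S × ℝ), HasFDerivAt (fun z => Ψ (j z))
      ((fderiv ℝ Ψ (j z)).comp A) z := by
    filter_upwards [hjt.eventually h1] with z hz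
    exact (hz.differentiableAt (by simp)).hasFDerivAt.comp z (hjd z)
  have hAt : A (0, 1) = (1, 0) := by simp [A]
  refine ⟨S, hdim, fun z => Ψ (j z), hG0, ?_, ?_, ?_⟩
  · change Ψ (j 0) = q
    rw [hj0]; exact h2.self_of_nhds
  · rw [hd.self_of_nhds.fderiv, hj0]
    have e1 : fderiv ℝ Ψ (0, q) (1, 0) = f q := by
      rw [h3.self_of_nhds, h2.self_of_nhds]
    have e2 : ∀ v, fderiv ℝ Ψ (0, q) (0, v) = v := by
      have h4 : HasFDerivAt (fun x : E => Ψ (0, x))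
          ((fderiv ℝ Ψ (0, q)).comp (ContinuousLinearMap.inr ℝ ℝ E)) q :=
        h1.differentiableAt.hasFDerivAt.comp q (hasFDerivAt_prodMk_right (𝕜 := ℝ) (0 : ℝ) q)
      have h5 : HasFDerivAt (fun x : E => Ψ (0, x)) (ContinuousLinearMap.id ℝ E) q :=
        (hasFDerivAt_id q).congr_of_eventuallyEq h2
      intro v
      exact DFunLike.congr_fun (h4.unique h5) v
    have hval : ∀ z : S × ℝ, ((fderiv ℝ Ψ (0, q)).comp A) z = z.2 • f q + z.1 := by
      intro z
      have : A z = z.2 • (1, 0) + (0, (z.1 : E)) := by simp [A]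
      rw [ContinuousLinearMap.comp_apply, this, map_add, map_smul, e1, e2]
    have hinj : Function.Injective ((fderiv ℝ Ψ (0, q)).comp A : S × ℝ →ₗ[ℝ] E) := by
      rw [← LinearMap.ker_eq_bot, LinearMap.ker_eq_bot']
      intro z hz
      have hz' : z.2 • f q + z.1 = 0 := by rw [← hval]; exact hz
      have hm : (z.1 : E) ∈ (ℝ ∙ f q) ⊓ S := by
        refine ⟨?_, z.1.2⟩
        rw [show (z.1 : E) = -z.2 • f q by rw [neg_smul]; exact (neg_eq_of_add_eq_zero_right hz').symm]
        exact Submodule.smul_mem _ _ (Submodule.mem_span_singleton_self _)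
      rw [hS.inf_eq_bot, Submodule.mem_bot] at hm
      rw [hm, add_zero, smul_eq_zero, or_iff_left hq] at hz'
      exact Prod.ext (Subtype.ext hm) hz'
    refine ⟨(LinearEquiv.ofInjectiveOfFinrankEq _ hinj ?_).toContinuousLinearEquiv, ?_⟩
    · simp [hdim]
    · ext z <;> rfl
  · filter_upwards [hd, hjt.eventually h3] with z hz hz'
    rw [hz.fderiv, ContinuousLinearMap.comp_apply, hAt, hz']

end FlowBox

theorem eventually_forall_lt {α : Type*} {l : Filter α} {p : ℕ → α → Prop} {j : ℕ}
    (h : ∀ a < j, ∀ᶠ x in l, p a x) : ∀ᶠ x in l, ∀ a < j, p a x := by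
  have := (eventually_all_finset (Finset.range j) (l := l) (p := p)).2
    (fun a ha => h a (Finset.mem_range.1 ha))
  filter_upwards [this] with x hx a ha using hx a (Finset.mem_range.2 ha)

/-! ### Local frames and brackets of their sections -/

section Frames

variable {E F : Type*} [NormedAddCommGroup E] [NormedSpace ℝ E]
  [NormedAddCommGroup F] [NormedSpace ℝ F] {ι : Type*} [Fintype ι]

/-- The linear map `c ↦ ∑ cᵢ vᵢ`. -/
def combMap (v : ι → F) : (ι → ℝ) →L[ℝ] F :=
  ∑ i, (ContinuousLinearMap.proj (R := ℝ) (φ := fun _ : ι => ℝ) i).smulRight (v i)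

theorem combMap_apply (v : ι → F) (c : ι → ℝ) : combMap v c = ∑ i, c i • v i := by
  simp [combMap]

protected theorem SmoothNear.combMap {S : ι → E → F} {q : E} (hS : ∀ i, SmoothNear (S i) q) :
    SmoothNear (fun x => combMap (fun i => S i x)) q := by
  refine SmoothNear.sum fun i _ => ?_
  exact ((ContinuousLinearMap.smulRightL ℝ (ι → ℝ) F
    (ContinuousLinearMap.proj (R := ℝ) (φ := fun _ : ι => ℝ) i)).contDiff.smoothNear _).comp (hS i)

theorem injective_combMap {v : ι → F} (h : LinearIndependent ℝ v) :
    Function.Injective (combMap v) := by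
  intro c d hcd
  rw [← sub_eq_zero, ← map_sub, combMap_apply] at hcd
  exact sub_eq_zero.1 (funext (Fintype.linearIndependent_iff.1 h _ hcd))

/-- A left inverse ℓ of the frame at q is corrected at nearby points: T = ℓ ∘ (frame at x) is close
to the identity, and T⁻¹ ∘ ℓ reads off the coefficients. -/
theorem exists_smooth_coordinates [FiniteDimensional ℝ F] {S : ι → E → F} {q : E}
    (hS : ∀ i, SmoothNear (S i) q) (hq : LinearIndependent ℝ fun i => S i q) :
    ∃ C : E → F →L[ℝ] (ι → ℝ), SmoothNear C q ∧
      ∀ᶠ x in 𝓝 q, ∀ c : ι → ℝ, C x (∑ i, c i • S i x) = c := by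
  have := FiniteDimensional.complete ℝ F
  obtain ⟨ℓ, hℓ⟩ := LinearMap.exists_leftInverse_of_injective
    (combMap (fun i => S i q) : (ι → ℝ) →ₗ[ℝ] F)
    (LinearMap.ker_eq_bot.2 (injective_combMap hq))
  let ℓ' : F →L[ℝ] (ι → ℝ) := LinearMap.toContinuousLinearMap ℓ
  let T : E → (ι → ℝ) →L[ℝ] (ι → ℝ) := fun x => ℓ'.comp (combMap fun i => S i x)
  have hT : SmoothNear T q :=
    ((ContinuousLinearMap.compL ℝ (ι → ℝ) F (ι → ℝ) ℓ').contDiff.smoothNear _).comp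
      (SmoothNear.combMap hS)
  have hTq : T q = ContinuousLinearMap.id ℝ _ := by
    ext1 c
    exact DFunLike.congr_fun hℓ c
  have hinv : ∀ᶠ x in 𝓝 q, (T x).IsInvertible := by
    refine hT.continuousAt.eventually (Goursat.eventually_isInvertible ?_)
    rw [hTq]
    exact ⟨ContinuousLinearEquiv.refl ℝ _, rfl⟩
  refine ⟨fun x => (T x).inverse.comp ℓ', ?_, ?_⟩
  · filter_upwards [hT, hinv] with x hx hx'
    exact ((hx'.contDiffAt_map_inverse).comp x hx).clm_comp contDiffAt_const
  · filter_upwards [hinv] with x hx c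
    rw [← combMap_apply, ContinuousLinearMap.comp_apply]
    exact hx.inverse_apply_self c

theorem eventually_linearIndependent [FiniteDimensional ℝ F] {S : ι → E → F} {q : E}
    (hS : ∀ i, SmoothNear (S i) q) (hq : LinearIndependent ℝ fun i => S i q) :
    ∀ᶠ x in 𝓝 q, LinearIndependent ℝ fun i => S i x := by
  obtain ⟨C, -, hC⟩ := exists_smooth_coordinates hS hq
  filter_upwards [hC] with x hx
  refine Fintype.linearIndependent_iff.2 fun c hc i => ?_
  have := hx c
  rw [hc, map_zero] at this
  exact (congrFun this i).symm

theorem exists_smooth_coeffs [FiniteDimensional ℝ F] {S : ι → E → F} {q : E}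
    (hS : ∀ i, SmoothNear (S i) q) (hq : LinearIndependent ℝ fun i => S i q) {V : E → F}
    (hV : SmoothNear V q) (hVS : ∀ᶠ x in 𝓝 q, V x ∈ Submodule.span ℝ (range fun i => S i x)) :
    ∃ c : ι → E → ℝ, (∀ i, SmoothNear (c i) q) ∧ ∀ᶠ x in 𝓝 q, V x = ∑ i, c i x • S i x := by
  obtain ⟨C, hCs, hC⟩ := exists_smooth_coordinates hS hq
  refine ⟨fun i x => C x (V x) i, fun i => ?_, ?_⟩
  · exact ((ContinuousLinearMap.proj (R := ℝ) (φ := fun _ : ι => ℝ) i).contDiff.smoothNear _).comp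
      (hCs.clm_apply hV)
  · filter_upwards [hC, hVS] with x hx hx'
    obtain ⟨c, hc⟩ := (Submodule.mem_span_range_iff_exists_fun ℝ).1 hx'
    rw [← hc, hx c]

theorem lieBracket_sum_smul {S : ι → E → E} {c d : ι → E → ℝ} {q : E}
    (hS : ∀ i, DifferentiableAt ℝ (S i) q) (hc : ∀ i, DifferentiableAt ℝ (c i) q)
    (hd : ∀ i, DifferentiableAt ℝ (d i) q) :
    lieBracket ℝ (fun x => ∑ i, c i x • S i x) (fun x => ∑ i, d i x • S i x) q =
      ∑ i, (fderiv ℝ (d i) q (∑ j, c j q • S j q)) • S i q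
      - ∑ i, (fderiv ℝ (c i) q (∑ j, d j q • S j q)) • S i q
      + ∑ i, ∑ j, (c i q * d j q) • lieBracket ℝ (S i) (S j) q := by
  have key : ∀ (b : ι → E → ℝ), (∀ i, DifferentiableAt ℝ (b i) q) → ∀ v,
      fderiv ℝ (fun x => ∑ i, b i x • S i x) q v =
        ∑ i, (b i q • fderiv ℝ (S i) q v + fderiv ℝ (b i) q v • S i q) := by
    intro b hb v
    have h : HasFDerivAt (fun x => ∑ i, b i x • S i x) _ q :=
      HasFDerivAt.fun_sum (u := Finset.univ) fun i _ =>
        (hb i).hasFDerivAt.smul (hS i).hasFDerivAt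
    rw [h.fderiv]
    simp
  rw [lieBracket, key d hd, key c hc]
  simp only [Finset.sum_add_distrib, lieBracket, smul_sub, Finset.sum_sub_distrib, map_sum,
    map_smul, Finset.smul_sum, smul_smul]
  rw [Finset.sum_comm (f := fun i j => (c i q * d j q) • fderiv ℝ (S j) q (S i q))]
  simp only [mul_comm]
  abel

/-- By the Leibniz rule, brackets of sections are governed by brackets of frame fields. The subspace
`G` is left free so that it can be the span itself or the next member of the flag. -/
theorem lieBracket_mem_of_mem_span [FiniteDimensional ℝ E] {S : ι → E → E} {q : E}
    (hS : ∀ i, SmoothNear (S i) q) (hq : LinearIndependent ℝ fun i => S i q) {V W : E → E}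
    (hV : SmoothNear V q) (hVS : ∀ᶠ x in 𝓝 q, V x ∈ Submodule.span ℝ (range fun i => S i x))
    (hW : SmoothNear W q) (hWS : ∀ᶠ x in 𝓝 q, W x ∈ Submodule.span ℝ (range fun i => S i x))
    {G : Submodule ℝ E} (hG : ∀ i, S i q ∈ G) (hG' : ∀ i j, lieBracket ℝ (S i) (S j) q ∈ G) :
    lieBracket ℝ V W q ∈ G := by
  obtain ⟨c, hc, hVc⟩ := exists_smooth_coeffs hS hq hV hVS
  obtain ⟨d, hd, hWd⟩ := exists_smooth_coeffs hS hq hW hWS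
  rw [Filter.EventuallyEq.lieBracket_vectorField_eq hVc hWd,
    lieBracket_sum_smul (fun i => (hS i).differentiableAt) (fun i => (hc i).differentiableAt)
      fun i => (hd i).differentiableAt]
  exact G.add_mem (G.sub_mem (G.sum_mem fun i _ => G.smul_mem _ (hG i))
    (G.sum_mem fun i _ => G.smul_mem _ (hG i)))
    (G.sum_mem fun i _ => G.sum_mem fun j _ => G.smul_mem _ (hG' i j))

end Frames

/-! ### Flags spanned by initial segments of a sequence of fields -/

section Flag

variable {M : Type*} {F : M → Type*} [∀ x, AddCommGroup (F x)] [∀ x, Module ℝ (F x)]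

/-- The span at `x` of the first `j` fields of the sequence `X`. -/
def flag (X : ℕ → (x : M) → F x) (j : ℕ) (x : M) : Submodule ℝ (F x) :=
  Submodule.span ℝ (range fun c : Fin j => X c x)

theorem mem_flag (X : ℕ → (x : M) → F x) {i j : ℕ} (h : i < j) (x : M) : X i x ∈ flag X j x :=
  Submodule.subset_span ⟨⟨i, h⟩, rfl⟩

theorem flag_le {X : ℕ → (x : M) → F x} {j : ℕ} {x : M} {G : Submodule ℝ (F x)} :
    flag X j x ≤ G ↔ ∀ i < j, X i x ∈ G := by
  rw [flag, Submodule.span_le]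
  refine ⟨fun h i hi => h ⟨⟨i, hi⟩, rfl⟩, ?_⟩
  rintro h _ ⟨i, rfl⟩
  exact h i i.2

theorem flag_mono (X : ℕ → (x : M) → F x) {i j : ℕ} (h : i ≤ j) (x : M) :
    flag X i x ≤ flag X j x :=
  flag_le.2 fun _ hc => mem_flag X (hc.trans_le h) x

theorem flag_congr {X Y : ℕ → (x : M) → F x} {j : ℕ} {x : M} (h : ∀ i < j, X i x = Y i x) :
    flag X j x = flag Y j x :=
  le_antisymm (flag_le.2 fun i hi => h i hi ▸ mem_flag Y hi x)
    (flag_le.2 fun i hi => h i hi ▸ mem_flag X hi x)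

theorem finrank_flag {X : ℕ → (x : M) → F x} {j : ℕ} {x : M}
    (h : LinearIndependent ℝ fun c : Fin j => X c x) : Module.finrank ℝ (flag X j x) = j := by
  rw [flag, finrank_span_eq_card h, Fintype.card_fin]

theorem linearIndependent_of_le {X : ℕ → (x : M) → F x} {i j : ℕ} {x : M} (hij : i ≤ j)
    (h : LinearIndependent ℝ fun c : Fin j => X c x) :
    LinearIndependent ℝ fun c : Fin i => X c x :=
  h.comp (Fin.castLE hij) (Fin.castLE_injective hij)

theorem linearIndependent_flag_succ {X : ℕ → (x : M) → F x} {j : ℕ} {x : M} :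
    (LinearIndependent ℝ fun c : Fin (j + 1) => X c x) ↔
      (LinearIndependent ℝ fun c : Fin j => X c x) ∧ X j x ∉ flag X j x := by
  have := linearIndependent_finSucc' (K := ℝ) (v := fun c : Fin (j + 1) => X c x)
  rw [this]
  rfl

theorem notMem_flag {X : ℕ → (x : M) → F x} {i j : ℕ} {x : M} (hij : i < j)
    (h : LinearIndependent ℝ fun c : Fin j => X c x) : X i x ∉ flag X i x :=
  (linearIndependent_flag_succ.1 (linearIndependent_of_le hij h)).2

end Flag

/-! ### Goursat frames and their pullbacks -/

section GoursatFrame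

variable {E : Type*} [NormedAddCommGroup E] [NormedSpace ℝ E]

theorem lieBracket_mem_of_mem_flag [FiniteDimensional ℝ E] {X : ℕ → E → E} {j : ℕ} {q : E}
    (hX : ∀ i < j, SmoothNear (X i) q) (hq : LinearIndependent ℝ fun c : Fin j => X c q)
    {V W : E → E} (hV : SmoothNear V q) (hVX : ∀ᶠ x in 𝓝 q, V x ∈ flag X j x)
    (hW : SmoothNear W q) (hWX : ∀ᶠ x in 𝓝 q, W x ∈ flag X j x)
    {G : Submodule ℝ E} (hG : ∀ i < j, X i q ∈ G)
    (hG' : ∀ a < j, ∀ b < j, lieBracket ℝ (X a) (X b) q ∈ G) :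
    lieBracket ℝ V W q ∈ G :=
  lieBracket_mem_of_mem_span (S := fun c : Fin j => X c) (fun i => hX i i.2) hq hV hVX hW hWX
    (fun i => hG i i.2) fun i j => hG' i i.2 j j.2

theorem eventually_linearIndependent_flag [FiniteDimensional ℝ E] {X : ℕ → E → E} {j : ℕ} {q : E}
    (hX : ∀ i < j, SmoothNear (X i) q) (hq : LinearIndependent ℝ fun c : Fin j => X c q) :
    ∀ᶠ x in 𝓝 q, LinearIndependent ℝ fun c : Fin j => X c x :=
  eventually_linearIndependent (S := fun c : Fin j => X c) (fun i => hX i i.2) hq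

theorem eventually_smoothNear {X : ℕ → E → E} {j : ℕ} {q : E}
    (hX : ∀ i < j, SmoothNear (X i) q) : ∀ᶠ x in 𝓝 q, ∀ i < j, SmoothNear (X i) x :=
  eventually_forall_lt fun i hi => (hX i hi).eventually

/-- The fields `X₀, …, Xₘ₋₁` are a frame near `q` of a flag whose members are the derived flag of
the rank two distribution spanned by `X₀` and `X₁`: each `Xⱼ` with `j ≥ 2` is a bracket of
earlier ones, and the brackets of the first `j` fields lie in the span of the first `j + 1`. -/
structure IsGoursatFrame (m : ℕ) (X : ℕ → E → E) (q : E) : Prop where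
  smooth : ∀ j < m, SmoothNear (X j) q
  indep : LinearIndependent ℝ fun c : Fin m => X c q
  bracket : ∀ j, 2 ≤ j → j < m → ∃ a < j, ∃ b < j, X j =ᶠ[𝓝 q] lieBracket ℝ (X a) (X b)
  closed : ∀ j, 2 ≤ j → j < m → ∀ a < j, ∀ b < j,
    ∀ᶠ x in 𝓝 q, lieBracket ℝ (X a) (X b) x ∈ flag X (j + 1) x

variable {E' : Type*} [NormedAddCommGroup E'] [NormedSpace ℝ E']

theorem pullback_mem_flag {G : E' → E} {X : ℕ → E → E} {j : ℕ} {x : E'} {V : E → E}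
    (h : V (G x) ∈ flag X j (G x)) :
    pullback ℝ G V x ∈ flag (fun i => pullback ℝ G (X i)) j x := by
  have h1 : (flag X j (G x)).map ((fderiv ℝ G x).inverse : E →ₗ[ℝ] E') =
      flag (fun i => pullback ℝ G (X i)) j x := by
    rw [flag, Submodule.map_span, ← range_comp]
    rfl
  rw [← h1]
  exact Submodule.mem_map_of_mem h

protected theorem SmoothNear.pullback [CompleteSpace E'] {G : E' → E} {p : E'} {V : E → E}
    (hG : SmoothNear G p) (hi : (fderiv ℝ G p).IsInvertible) (hV : SmoothNear V (G p)) :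
    SmoothNear (pullback ℝ G V) p := by
  have h1 := hV.comp hG
  filter_upwards [hG.fderiv, hG.eventually_isInvertible hi, h1] with x hx hx' hx1
  exact (hx'.contDiffAt_map_inverse.comp x hx).clm_apply hx1

theorem eventually_pullback_lieBracket [CompleteSpace E'] [CompleteSpace E] {G : E' → E} {p : E'}
    {V W : E → E} (hG : SmoothNear G p) (hV : SmoothNear V (G p)) (hW : SmoothNear W (G p)) :
    pullback ℝ G (lieBracket ℝ V W) =ᶠ[𝓝 p]
      lieBracket ℝ (pullback ℝ G V) (pullback ℝ G W) := by
  filter_upwards [hG, hG.continuousAt.eventually hV, hG.continuousAt.eventually hW]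
    with x hx hx1 hx2
  refine pullback_lieBracket (n := ∞) ?_ hx (hx1.differentiableAt (by simp))
    (hx2.differentiableAt (by simp))
  rw [minSmoothness_of_isRCLikeNormedField]
  exact WithTop.coe_le_coe.2 (le_top (a := (2 : ℕ∞)))

protected theorem IsGoursatFrame.pullback [CompleteSpace E'] [CompleteSpace E] {m : ℕ}
    {X : ℕ → E → E}
    {G : E' → E} {p : E'} (hX : IsGoursatFrame m X (G p)) (hG : SmoothNear G p)
    (hi : (fderiv ℝ G p).IsInvertible) :
    IsGoursatFrame m (fun i => pullback ℝ G (X i)) p where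
  smooth j hj := hG.pullback hi (hX.smooth j hj)
  indep := by
    have := hX.indep.map' ((fderiv ℝ G p).inverse : E →ₗ[ℝ] E')
      (LinearMap.ker_eq_bot.2 hi.inverse.injective)
    exact this
  bracket j h2 hj := by
    obtain ⟨a, ha, b, hb, h⟩ := hX.bracket j h2 hj
    refine ⟨a, ha, b, hb, ?_⟩
    refine Filter.EventuallyEq.trans ?_ (eventually_pullback_lieBracket hG
      (hX.smooth a (ha.trans hj)) (hX.smooth b (hb.trans hj)))
    filter_upwards [hG.continuousAt.eventually h] with x hx
    simp only [VectorField.pullback, hx]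
  closed j h2 hj a ha b hb := by
    filter_upwards [eventually_pullback_lieBracket hG (hX.smooth a (ha.trans hj))
      (hX.smooth b (hb.trans hj)), hG.continuousAt.eventually (hX.closed j h2 hj a ha b hb)]
      with x hx hx'
    rw [← hx]
    exact pullback_mem_flag hx'

end GoursatFrame

/-- Derivatives of the coefficients contribute only multiples of V(x) and W(x), so modulo `G` the
bracket with `U` is linear over functions. -/
theorem lieBracket_smul_add_smul_mem {E : Type*} [NormedAddCommGroup E] [NormedSpace ℝ E]
    {f g : E → ℝ} {V W U : E → E} {x : E} {G : Submodule ℝ E} (hf : DifferentiableAt ℝ f x)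
    (hg : DifferentiableAt ℝ g x) (hV : DifferentiableAt ℝ V x) (hW : DifferentiableAt ℝ W x)
    (hVG : V x ∈ G) (hWG : W x ∈ G)
    (h : f x • lieBracket ℝ V U x + g x • lieBracket ℝ W U x ∈ G) :
    lieBracket ℝ (fun y => f y • V y + g y • W y) U x ∈ G := by
  have := lieBracket_add_left (W := U) (hf.smul hV) (hg.smul hW)
  rw [show (fun y => f y • V y + g y • W y) = f • V + g • W from rfl, this,
    show f • V = fun y => f y • V y from rfl, show g • W = fun y => g y • W y from rfl,
    lieBracket_smul_left hf hV, lieBracket_smul_left hg hW]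
  rw [show ∀ a b c d : E, a + b + (c + d) = (a + c) + (b + d) from fun a b c d => by abel]
  exact G.add_mem (G.add_mem (G.smul_mem _ hVG) (G.smul_mem _ hWG)) h

/-! ### The characteristic line field of D⁽¹⁾ -/

section Characteristic

variable {E : Type*} [NormedAddCommGroup E] [NormedSpace ℝ E]

theorem flag_eq_top [FiniteDimensional ℝ E] {X : ℕ → E → E} {m : ℕ} {x : E}
    (hm : Module.finrank ℝ E = m)
    (h : LinearIndependent ℝ fun c : Fin m => X c x) : flag X m x = ⊤ :=
  Submodule.eq_top_of_finrank_eq (by rw [finrank_flag h, hm])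

theorem eventually_flag_eq [FiniteDimensional ℝ E] {X : ℕ → E → E} {m : ℕ} {q : E}
    (hm : Module.finrank ℝ E = m)
    (hX : IsGoursatFrame m X q) : ∀ᶠ x in 𝓝 q, flag X m x = ⊤ := by
  filter_upwards [eventually_linearIndependent_flag hX.smooth hX.indep] with x hx
  exact flag_eq_top hm hx

/-- The field `X 2` is a bracket of two fields among `X 0` and `X 1`, hence 0 or ±[X₀, X₁], and it
is independent of them. -/
protected theorem IsGoursatFrame.lieBracket_zero_one_notMem {X : ℕ → E → E} {m : ℕ} {q : E}
    (hX : IsGoursatFrame m X q) (hm : 3 ≤ m) : lieBracket ℝ (X 0) (X 1) q ∉ flag X 2 q := by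
  intro h
  obtain ⟨a, ha, b, hb, hab⟩ := hX.bracket 2 le_rfl hm
  refine notMem_flag hm hX.indep ?_
  rw [hab.self_of_nhds]
  interval_cases a <;> interval_cases b
  · rw [lieBracket_self]; exact Submodule.zero_mem _
  · exact h
  · rw [lieBracket_swap]; exact Submodule.neg_mem _ h
  · rw [lieBracket_self]; exact Submodule.zero_mem _

/-- The span of the first three fields of a Goursat frame has a characteristic field that is
tangent to the span of the first two. -/
protected theorem IsGoursatFrame.exists_characteristic [FiniteDimensional ℝ E] {X : ℕ → E → E}
    {m : ℕ} {q : E}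
    (hX : IsGoursatFrame m X q) (hm : 3 ≤ m) (hE : Module.finrank ℝ E = m) :
    ∃ c₀ c₁ : E → ℝ, SmoothNear c₀ q ∧ SmoothNear c₁ q ∧ ¬(c₀ q = 0 ∧ c₁ q = 0) ∧
      ∀ i < 3, ∀ᶠ x in 𝓝 q,
        lieBracket ℝ (fun y => c₀ y • X 0 y + c₁ y • X 1 y) (X i) x ∈ flag X 3 x := by
  rcases hm.eq_or_lt with rfl | hm4
  · refine ⟨fun _ => 1, fun _ => 0, contDiff_const.smoothNear _, contDiff_const.smoothNear _,
      by simp, fun i _ => ?_⟩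
    filter_upwards [eventually_flag_eq hE hX] with x hx
    rw [hx]; trivial
  · have hs : ∀ i < 4, SmoothNear (X i) q := fun i hi => hX.smooth i (by omega)
    have hi4 : LinearIndependent ℝ fun c : Fin 4 => X c q := linearIndependent_of_le hm4 hX.indep
    have H : ∀ a < 3, ∀ b < 3, ∃ c : E → ℝ, SmoothNear c q ∧
        ∀ᶠ x in 𝓝 q, lieBracket ℝ (X a) (X b) x - c x • X 3 x ∈ flag X 3 x := by
      intro a ha b hb
      obtain ⟨c, hc, hc'⟩ := exists_smooth_coeffs (S := fun i : Fin 4 => X i)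
        (fun i => hs i i.2) hi4 ((hs a (by omega)).lieBracket (hs b (by omega)))
        (hX.closed 3 (by norm_num) hm4 a ha b hb)
      refine ⟨c 3, hc 3, ?_⟩
      filter_upwards [hc'] with x hx
      rw [hx, Fin.sum_univ_castSucc]
      have : (Fin.last 3 : Fin 4) = 3 := rfl
      simp only [this, Fin.val_castSucc]
      rw [show ((3 : Fin 4) : ℕ) = 3 from rfl, add_sub_cancel_right]
      exact Submodule.sum_mem _ fun i _ => Submodule.smul_mem _ _ (mem_flag X i.2 x)
    obtain ⟨α, hα, hα'⟩ := H 0 (by norm_num) 2 (by norm_num)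
    obtain ⟨β, hβ, hβ'⟩ := H 1 (by norm_num) 2 (by norm_num)
    have h01 := hX.closed 2 le_rfl (by omega) 0 (by norm_num) 1 (by norm_num)
    -- With [X₀, X₂] ≡ α X₃ and [X₁, X₂] ≡ β X₃ modulo D⁽¹⁾, the field β X₀ - α X₁ has bracket βα -
    -- αβ = 0 with X₂. Its brackets with X₀ and X₁ lie in D⁽¹⁾ anyway.
    refine ⟨β, fun x => -α x, hβ, hα.neg, ?_, ?_⟩
    -- If α and β both vanished at q, all brackets of X₀, X₁, X₂ would lie in D⁽¹⁾ there, and one of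
    -- them is X₃.
    · rintro ⟨hb0, ha0⟩
      have ha0 : α q = 0 := neg_eq_zero.1 ha0
      have e1 := hα'.self_of_nhds
      have e2 := hβ'.self_of_nhds
      have e3 := h01.self_of_nhds
      rw [ha0, zero_smul, sub_zero] at e1
      rw [hb0, zero_smul, sub_zero] at e2
      obtain ⟨a, ha, b, hb, hab⟩ := hX.bracket 3 (by norm_num) hm4
      refine notMem_flag hm4 hX.indep ?_
      rw [hab.self_of_nhds]
      have hself : ∀ V : E → E, lieBracket ℝ V V q ∈ flag X 3 q := fun V => by
        rw [lieBracket_self]; exact Submodule.zero_mem _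
      have hswap : ∀ V W : E → E, lieBracket ℝ V W q ∈ flag X 3 q →
          lieBracket ℝ W V q ∈ flag X 3 q := fun V W h => by
        rw [lieBracket_swap]; exact Submodule.neg_mem _ h
      interval_cases a <;> interval_cases b
      · exact hself _
      · exact e3
      · exact e1
      · exact hswap _ _ e3
      · exact hself _
      · exact e2
      · exact hswap _ _ e1
      · exact hswap _ _ e2
      · exact hself _
    · intro i hi
      filter_upwards [hα', hβ', h01, eventually_smoothNear hs, hα, hβ] with x h1 h2 h3 hsx hαx hβx
      have hd : ∀ i < 4, DifferentiableAt ℝ (X i) x := fun i hi => (hsx i hi).differentiableAt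
      refine lieBracket_smul_add_smul_mem (g := fun x => -α x) (hβx.differentiableAt (by simp))
        (hαx.differentiableAt (by simp)).neg (hd 0 (by norm_num)) (hd 1 (by norm_num))
        (mem_flag X (by norm_num) x) (mem_flag X (by norm_num) x) ?_
      interval_cases i
      · rw [lieBracket_self, Pi.zero_apply, smul_zero, zero_add, lieBracket_swap]
        exact Submodule.smul_mem _ _ (Submodule.neg_mem _ h3)
      · rw [lieBracket_self, Pi.zero_apply, smul_zero, add_zero]
        exact Submodule.smul_mem _ _ h3
      · have := Submodule.sub_mem _ (Submodule.smul_mem _ (β x) h1)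
          (Submodule.smul_mem _ (α x) h2)
        convert this using 1
        module

end Characteristic

/-! ### Distributions invariant along the axis of a cylinder -/

section Invariant

variable {F : Type*} [NormedAddCommGroup F] [NormedSpace ℝ F] [FiniteDimensional ℝ F]

/-- Balls of the product norm are products, so they contain the axis-parallel segment from any of
their points to the slice through `p`. -/
theorem eventually_const_snd {S G : Type*} [NormedAddCommGroup S] [NormedSpace ℝ S]
    [NormedAddCommGroup G] [NormedSpace ℝ G] {y : S × ℝ → G} {p : S × ℝ} (hy : SmoothNear y p)
    (h : ∀ᶠ z in 𝓝 p, fderiv ℝ y z (0, 1) = 0) :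
    ∀ᶠ z in 𝓝 p, y z = y (z.1, p.2) := by
  obtain ⟨r, hr, hball⟩ := Metric.eventually_nhds_iff_ball.1 (Filter.Eventually.and hy h)
  filter_upwards [Metric.ball_mem_nhds p hr] with z hz
  rw [← ball_prod_same] at hball
  have hz' : z.1 ∈ Metric.ball p.1 r ∧ z.2 ∈ Metric.ball p.2 r := by
    rw [← mem_prod, ball_prod_same]; exact hz
  have hd : ∀ t ∈ Metric.ball p.2 r, HasDerivAt (fun t => y (z.1, t)) 0 t := by
    intro t ht
    have h1 := hball (z.1, t) ⟨hz'.1, ht⟩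
    have h2 : HasDerivAt (fun t : ℝ => (z.1, t)) ((0 : S), (1 : ℝ)) t :=
      (hasDerivAt_const t z.1).prodMk (hasDerivAt_id t)
    rw [← h1.2]
    exact (h1.1.differentiableAt (by simp)).hasFDerivAt.comp_hasDerivAt t h2
  have := Metric.isOpen_ball.is_const_of_deriv_eq_zero (convex_ball p.2 r).isPreconnected
    (fun t ht => (hd t ht).differentiableAt.differentiableWithinAt)
    (fun t ht => (hd t ht).deriv) hz'.2 (Metric.mem_ball_self hr)
  exact this

/-- A distribution on a cylinder that is invariant under the translations along the axis is
pulled back from the base. -/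
theorem exists_invariant_frame {S : Type*} [NormedAddCommGroup S] [NormedSpace ℝ S] {ι : Type*}
    [Fintype ι] {w : ι → S × ℝ → F} {p : S × ℝ}
    (hw : ∀ i, SmoothNear (w i) p) (hp : LinearIndependent ℝ fun i => w i p)
    (hinv : ∀ i, ∀ᶠ z in 𝓝 p, fderiv ℝ (w i) z (0, 1) ∈
      Submodule.span ℝ (range fun i => w i z)) :
    ∃ Y : ι → S → F, (∀ i, SmoothNear (Y i) p.1) ∧ ∀ᶠ z in 𝓝 p,
      Submodule.span ℝ (range fun i => Y i z.1) = Submodule.span ℝ (range fun i => w i z) := by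
  classical
  have := FiniteDimensional.complete ℝ F
  obtain ⟨ℓ, hℓ⟩ := LinearMap.exists_leftInverse_of_injective
    (combMap (fun i => w i p) : (ι → ℝ) →ₗ[ℝ] F)
    (LinearMap.ker_eq_bot.2 (injective_combMap hp))
  let ℓ' : F →L[ℝ] (ι → ℝ) := LinearMap.toContinuousLinearMap ℓ
  let N : S × ℝ → (ι → ℝ) →L[ℝ] F := fun z => combMap fun i => w i z
  let T : S × ℝ → (ι → ℝ) →L[ℝ] (ι → ℝ) := fun z => ℓ'.comp (N z)
  have hN : SmoothNear N p := SmoothNear.combMap hw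
  have hT : SmoothNear T p :=
    ((ContinuousLinearMap.compL ℝ (ι → ℝ) F (ι → ℝ) ℓ').contDiff.smoothNear _).comp hN
  have hTq : T p = ContinuousLinearMap.id ℝ _ := by
    ext1 c
    exact DFunLike.congr_fun hℓ c
  have hTi : ∀ᶠ z in 𝓝 p, (T z).IsInvertible := by
    refine hT.continuousAt.eventually (Goursat.eventually_isInvertible ?_)
    rw [hTq]
    exact ⟨ContinuousLinearEquiv.refl ℝ _, rfl⟩
  -- The frame is normalised so that the fixed functional ℓ takes constant values on it.
  let c : ι → S × ℝ → ι → ℝ := fun i z => (T z).inverse (Pi.single i 1)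
  have hc : ∀ i, SmoothNear (c i) p := by
    intro i
    filter_upwards [hT, hTi] with z hz hz'
    exact ((hz'.contDiffAt_map_inverse).comp z hz).clm_apply contDiffAt_const
  let y : ι → S × ℝ → F := fun i z => N z (c i z)
  have hy : ∀ i, SmoothNear (y i) p := fun i => hN.clm_apply (hc i)
  have hspan : ∀ z v, v ∈ Submodule.span ℝ (range fun i => w i z) ↔ ∃ a, N z a = v := by
    intro z v
    rw [Submodule.mem_span_range_iff_exists_fun]
    simp only [N, combMap_apply]
  have hyspan : ∀ᶠ z in 𝓝 p, Submodule.span ℝ (range fun i => y i z) =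
      Submodule.span ℝ (range fun i => w i z) := by
    filter_upwards [hTi] with z hz
    refine le_antisymm ?_ fun v hv => ?_
    · rw [Submodule.span_le]
      rintro _ ⟨i, rfl⟩
      exact (hspan _ _).2 ⟨_, rfl⟩
    · obtain ⟨a, rfl⟩ := (hspan _ _).1 hv
      have ha : a = ∑ i, T z a i • c i z := by
        simp only [c]
        rw [← hz.inverse_apply_self a]
        simp only [hz.self_apply_inverse]
        conv_lhs => rw [pi_eq_sum_univ' (T z a)]
        rw [map_sum]
        simp only [map_smul]
      rw [ha, map_sum]
      refine Submodule.sum_mem _ fun i _ => ?_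
      rw [map_smul]
      exact Submodule.smul_mem _ _ (Submodule.subset_span ⟨i, rfl⟩)
  have hℓy : ∀ i, ∀ᶠ z in 𝓝 p, ℓ' (y i z) = Pi.single i 1 := by
    intro i
    filter_upwards [hTi] with z hz
    exact hz.self_apply_inverse _
  -- The axis derivative of yᵢ lies in the span by invariance and in the kernel of ℓ by
  -- normalisation. As ℓ is injective on the span, it vanishes.
  have hyd : ∀ i, ∀ᶠ z in 𝓝 p, fderiv ℝ (y i) z (0, 1) = 0 := by
    intro i
    filter_upwards [hy i, (hℓy i).eventually_nhds, eventually_all.2 hw, eventually_all.2 hinv,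
      hc i, hTi] with z hyz hℓz hwz hiz hcz hTz
    have hdc : ∀ j, DifferentiableAt ℝ (fun z => c i z j) z := fun j =>
      differentiableAt_pi.1 (hcz.differentiableAt (by simp)) j
    have h1 : fderiv ℝ (y i) z (0, 1) ∈ Submodule.span ℝ (range fun i => w i z) := by
      have e : y i = fun z => ∑ j, c i z j • w j z := by
        funext z; simp only [y, N, combMap_apply]
      have h : HasFDerivAt (fun z => ∑ j, c i z j • w j z) _ z :=
        HasFDerivAt.fun_sum (u := Finset.univ) fun j _ =>
          (hdc j).hasFDerivAt.smul ((hwz j).differentiableAt (by simp)).hasFDerivAt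
      rw [e, h.fderiv]
      simp only [sum_apply, add_apply, smul_apply, ContinuousLinearMap.smulRight_apply]
      refine Submodule.sum_mem _ fun j _ => Submodule.add_mem _ (Submodule.smul_mem _ _ (hiz j)) ?_
      exact Submodule.smul_mem _ _ (Submodule.subset_span ⟨j, rfl⟩)
    have h2 : ℓ' (fderiv ℝ (y i) z (0, 1)) = 0 := by
      have h3 : HasFDerivAt (fun z => ℓ' (y i z)) (ℓ'.comp (fderiv ℝ (y i) z)) z :=
        ℓ'.hasFDerivAt.comp z (hyz.differentiableAt (by simp)).hasFDerivAt
      have h4 : HasFDerivAt (fun z => ℓ' (y i z)) (0 : S × ℝ →L[ℝ] (ι → ℝ)) z :=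
        (hasFDerivAt_const (Pi.single i 1 : ι → ℝ) z).congr_of_eventuallyEq hℓz
      exact DFunLike.congr_fun (h3.unique h4) (0, 1)
    obtain ⟨a, ha⟩ := (hspan _ _).1 h1
    have h5 : T z a = 0 := by rw [← h2, ← ha]; rfl
    have h6 : a = 0 := hTz.injective (by rw [h5, map_zero])
    rw [← ha, h6, map_zero]
  refine ⟨fun i x => y i (x, p.2), fun i => ?_, ?_⟩
  · have hj : ContDiff ℝ ∞ fun x : S => (x, p.2) := contDiff_id.prodMk contDiff_const
    exact SmoothNear.comp (g := y i) (f := fun x : S => (x, p.2)) (hy i) (hj.smoothNear _)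
  · filter_upwards [eventually_all.2 fun i => eventually_const_snd (hy i) (hyd i), hyspan]
      with z hz hz'
    rw [← hz']
    simp only [hz]

end Invariant

/-! ### Descent of the derived flag to the base of a cylinder -/

section Cylinder

variable {S : Type*} [NormedAddCommGroup S] [NormedSpace ℝ S]

/-- The vector field along the axis of the cylinder `S × ℝ` followed by the horizontal fields
`w`. -/
def axisLift (w : ℕ → S × ℝ → S) : ℕ → S × ℝ → S × ℝ
  | 0 => fun _ => (0, 1)
  | i + 1 => fun z => (w i z, 0)

/-- The axis field absorbs the last component, so only the horizontal part counts. The axis takes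
index 0, which shifts all the lifted fields by one. -/
theorem mem_flag_axisLift {w : ℕ → S × ℝ → S} {j : ℕ} {z v : S × ℝ} :
    v ∈ flag (axisLift w) (j + 1) z ↔ v.1 ∈ flag w j z := by
  constructor
  · have : flag (axisLift w) (j + 1) z ≤ (flag w j z).comap (LinearMap.fst ℝ S ℝ) := by
      refine flag_le.2 fun i hi => ?_
      cases i with
      | zero => exact (flag w j z).zero_mem
      | succ i => exact mem_flag w (by omega) z
    exact fun hv => this hv
  · have : flag w j z ≤ (flag (axisLift w) (j + 1) z).comap (LinearMap.inl ℝ S ℝ) :=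
      flag_le.2 fun i hi => mem_flag (axisLift w) (Nat.succ_lt_succ hi) z
    intro hv
    have h1 : ((v.1, 0) : S × ℝ) ∈ flag (axisLift w) (j + 1) z := this hv
    have h2 := Submodule.add_mem _ h1
      (Submodule.smul_mem _ v.2 (mem_flag (axisLift w) (Nat.succ_pos j) z))
    simpa [axisLift] using h2

theorem linearIndependent_axisLift {w : ℕ → S × ℝ → S} {j : ℕ} {z : S × ℝ} :
    (LinearIndependent ℝ fun c : Fin (j + 1) => axisLift w c z) ↔
      LinearIndependent ℝ fun c : Fin j => w c z := by
  induction j with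
  | zero =>
    rw [linearIndependent_flag_succ]
    refine iff_of_true ⟨linearIndependent_empty_type, ?_⟩ linearIndependent_empty_type
    simp [flag, axisLift]
  | succ j ih =>
    rw [linearIndependent_flag_succ, ih, mem_flag_axisLift, linearIndependent_flag_succ]
    rfl

theorem smoothNear_axisLift {w : ℕ → S × ℝ → S} {j : ℕ} {p : S × ℝ}
    (hw : ∀ i < j, SmoothNear (w i) p) : ∀ i < j + 1, SmoothNear (axisLift w i) p := by
  intro i hi
  cases i with
  | zero => exact contDiff_const.smoothNear _
  | succ i => exact (hw i (by omega)).prodMk (contDiff_const.smoothNear _)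

/-- The vector field along the axis of the cylinder `S × ℝ` followed by the lifts of the fields
`Y`. -/
def cylinder (Y : ℕ → S → S) : ℕ → S × ℝ → S × ℝ := axisLift fun i z => Y i z.1

theorem mem_flag_cylinder {Y : ℕ → S → S} {j : ℕ} {z v : S × ℝ} :
    v ∈ flag (cylinder Y) (j + 1) z ↔ v.1 ∈ flag Y j z.1 := mem_flag_axisLift

theorem linearIndependent_cylinder {Y : ℕ → S → S} {j : ℕ} {z : S × ℝ} :
    (LinearIndependent ℝ fun c : Fin (j + 1) => cylinder Y c z) ↔
      LinearIndependent ℝ fun c : Fin j => Y c z.1 :=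
  linearIndependent_axisLift (w := fun i z => Y i z.1)

theorem smoothNear_cylinder {Y : ℕ → S → S} {j : ℕ} {p : S × ℝ}
    (hY : ∀ i < j, SmoothNear (Y i) p.1) : ∀ i < j + 1, SmoothNear (cylinder Y i) p :=
  smoothNear_axisLift fun i hi => (hY i hi).comp (contDiff_fst.smoothNear p)

theorem lieBracket_axis {V : S × ℝ → S × ℝ} {z : S × ℝ} :
    lieBracket ℝ (fun _ => ((0 : S), (1 : ℝ))) V z = fderiv ℝ V z (0, 1) := by
  simp [lieBracket]

theorem hasFDerivAt_lift {V : S → S} {z : S × ℝ} (hV : DifferentiableAt ℝ V z.1) :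
    HasFDerivAt (fun z : S × ℝ => (V z.1, (0 : ℝ)))
      (((fderiv ℝ V z.1).comp (ContinuousLinearMap.fst ℝ S ℝ)).prod 0) z :=
  (hV.hasFDerivAt.comp z hasFDerivAt_fst).prodMk (hasFDerivAt_const _ _)

theorem lieBracket_axis_lift {V : S → S} {z : S × ℝ} (hV : DifferentiableAt ℝ V z.1) :
    lieBracket ℝ (fun _ => ((0 : S), (1 : ℝ))) (fun z => (V z.1, 0)) z = 0 := by
  rw [lieBracket_axis, (hasFDerivAt_lift hV).fderiv]
  simp

theorem lieBracket_lift {V W : S → S} {z : S × ℝ} (hV : DifferentiableAt ℝ V z.1)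
    (hW : DifferentiableAt ℝ W z.1) :
    lieBracket ℝ (fun z : S × ℝ => (V z.1, (0 : ℝ))) (fun z => (W z.1, 0)) z =
      (lieBracket ℝ V W z.1, 0) := by
  rw [lieBracket, (hasFDerivAt_lift hV).fderiv, (hasFDerivAt_lift hW).fderiv]
  simp [lieBracket]

theorem eventually_of_eventually_cylinder {S : Type*} [TopologicalSpace S] {P : S → Prop}
    {p : S × ℝ}
    (h : ∀ᶠ z in 𝓝 p, P z.1) : ∀ᶠ x in 𝓝 p.1, P x := by
  have hc : ContinuousAt (fun x : S => (x, p.2)) p.1 := by fun_prop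
  exact hc.eventually h

variable [FiniteDimensional ℝ S]

/-- Some bracket of the `Y`s must leave their span, or the flag upstairs would stop growing at `p`.
Its lift lies in the next member of the flag of `X`, and a dimension count shows that this member is
filled. -/
protected theorem IsGoursatFrame.exists_quotient_frame_succ {m j : ℕ} {X : ℕ → S × ℝ → S × ℝ}
    {p : S × ℝ}
    (hX : IsGoursatFrame m X p) (hj : 2 ≤ j) (hjm : j + 1 < m) {Y : ℕ → S → S}
    (hY : IsGoursatFrame j Y p.1)
    (hXY : ∀ᶠ z in 𝓝 p, flag (cylinder Y) (j + 1) z = flag X (j + 1) z) :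
    ∃ Y' : ℕ → S → S, (∀ i < j, Y' i = Y i) ∧ IsGoursatFrame (j + 1) Y' p.1 ∧
      ∀ᶠ z in 𝓝 p, flag (cylinder Y') (j + 2) z = flag X (j + 2) z := by
  have hXs : ∀ i < j + 1, SmoothNear (X i) p := fun i hi => hX.smooth i (by omega)
  have hXi : LinearIndependent ℝ fun c : Fin (j + 1) => X c p :=
    linearIndependent_of_le hjm.le hX.indep
  have hCs := smoothNear_cylinder hY.smooth
  have hCi : LinearIndependent ℝ fun c : Fin (j + 1) => cylinder Y c p :=
    linearIndependent_cylinder.2 hY.indep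
  have hXC : ∀ i < j + 1, ∀ᶠ z in 𝓝 p, X i z ∈ flag (cylinder Y) (j + 1) z := by
    intro i hi
    filter_upwards [hXY] with z hz
    rw [hz]; exact mem_flag X hi z
  have hCX : ∀ i < j + 1, ∀ᶠ z in 𝓝 p, cylinder Y i z ∈ flag X (j + 1) z := by
    intro i hi
    filter_upwards [hXY] with z hz
    rw [← hz]; exact mem_flag _ hi z
  have hd : ∀ i < j, DifferentiableAt ℝ (Y i) p.1 := fun i hi => (hY.smooth i hi).differentiableAt
  obtain ⟨a, ha, b, hb, hab⟩ : ∃ a < j, ∃ b < j, lieBracket ℝ (Y a) (Y b) p.1 ∉ flag Y j p.1 := by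
    -- The axis commutes with lifted fields. If all brackets of the `Y`s stayed in their span, those
    -- of X₀, …, Xⱼ would stay in theirs, and so would Xⱼ₊₁.
    by_contra! hcon
    obtain ⟨a, ha, b, hb, hab⟩ := hX.bracket (j + 1) (by omega) hjm
    refine notMem_flag hjm hX.indep ?_
    rw [hab.self_of_nhds]
    refine lieBracket_mem_of_mem_flag hCs hCi (hXs a ha) (hXC a ha) (hXs b hb) (hXC b hb) ?_ ?_
    · intro i hi
      rw [← hXY.self_of_nhds]; exact mem_flag _ hi p
    · intro a ha b hb
      rw [← hXY.self_of_nhds, mem_flag_cylinder]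
      rcases a with _ | a <;> rcases b with _ | b
      · simp only [cylinder, axisLift]
        rw [lieBracket_self]; exact Submodule.zero_mem _
      · simp only [cylinder, axisLift]
        rw [lieBracket_axis_lift (hd b (by omega))]; exact Submodule.zero_mem _
      · simp only [cylinder, axisLift]
        rw [lieBracket_swap, lieBracket_axis_lift (hd a (by omega)), neg_zero]
        exact Submodule.zero_mem _
      · simp only [cylinder, axisLift]
        rw [lieBracket_lift (hd a (by omega)) (hd b (by omega))]
        exact hcon a (by omega) b (by omega)
  let Y' : ℕ → S → S := Function.update Y j (lieBracket ℝ (Y a) (Y b))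
  have hY' : ∀ i < j, Y' i = Y i := fun i hi => Function.update_of_ne hi.ne _ _
  have hYj : Y' j = lieBracket ℝ (Y a) (Y b) := Function.update_self _ _ _
  have hs' : ∀ i < j + 1, SmoothNear (Y' i) p.1 := by
    intro i hi
    rcases (Nat.lt_succ_iff.1 hi).eq_or_lt with rfl | hi
    · rw [hYj]; exact (hY.smooth a ha).lieBracket (hY.smooth b hb)
    · rw [hY' i hi]; exact hY.smooth i hi
  have hi' : LinearIndependent ℝ fun c : Fin (j + 1) => Y' c p.1 := by
    refine linearIndependent_flag_succ.2 ⟨?_, ?_⟩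
    · have : (fun c : Fin j => Y' c p.1) = fun c : Fin j => Y c p.1 := by
        funext c; rw [hY' c c.2]
      rw [this]; exact hY.indep
    · rw [hYj, flag_congr (Y := Y) fun i hi => by rw [hY' i hi]]
      exact hab
  have hlift : ∀ a < j, ∀ b < j, ∀ᶠ z in 𝓝 p,
      ((lieBracket ℝ (Y a) (Y b) z.1, 0) : S × ℝ) ∈ flag X (j + 2) z := by
    intro a ha b hb
    filter_upwards [eventually_smoothNear hXs, eventually_linearIndependent_flag hXs hXi,
      (hCs (a + 1) (by omega)).eventually, (hCX (a + 1) (by omega)).eventually_nhds,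
      (hCs (b + 1) (by omega)).eventually, (hCX (b + 1) (by omega)).eventually_nhds,
      eventually_forall_lt fun a ha => eventually_forall_lt fun b hb =>
        hX.closed (j + 1) (by omega) hjm a ha b hb,
      (continuous_fst.tendsto p).eventually (hY.smooth a ha),
      (continuous_fst.tendsto p).eventually (hY.smooth b hb)]
      with z h1 h2 h3 h4 h5 h6 h7 h8 h9
    have := lieBracket_mem_of_mem_flag h1 h2 h3 h4 h5 h6
      (fun i hi => mem_flag X (j := j + 2) (by omega) z) h7
    simp only [cylinder, axisLift] at this
    rwa [lieBracket_lift (h8.differentiableAt (by simp)) (h9.differentiableAt (by simp))] at this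
  have hflag : ∀ᶠ z in 𝓝 p, flag (cylinder Y') (j + 2) z = flag X (j + 2) z := by
    have hCi' : LinearIndependent ℝ fun c : Fin (j + 2) => cylinder Y' c p :=
      linearIndependent_cylinder.2 hi'
    filter_upwards [hXY, hlift a ha b hb,
      eventually_linearIndependent_flag (smoothNear_cylinder hs') hCi',
      eventually_linearIndependent_flag (fun i hi => hX.smooth i (by omega : i < m))
        (linearIndependent_of_le hjm hX.indep)] with z h1 h2 h3 h4
    refine Submodule.eq_of_le_of_finrank_eq (flag_le.2 fun i hi => ?_) ?_
    · rcases (Nat.lt_succ_iff.1 hi).eq_or_lt with rfl | hi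
      · simp only [cylinder, axisLift, hYj]; exact h2
      · refine flag_mono X (Nat.le_succ _) z ?_
        rw [← h1]
        have : cylinder Y' i z = cylinder Y i z := by
          cases i with
          | zero => rfl
          | succ i => simp only [cylinder, axisLift]; rw [hY' i (by omega)]
        rw [this]
        exact mem_flag _ hi z
    · rw [finrank_flag h3, finrank_flag h4]
  refine ⟨Y', hY', ⟨hs', hi', ?_, ?_⟩, hflag⟩
  · intro i h2 hi
    rcases (Nat.lt_succ_iff.1 hi).eq_or_lt with rfl | hi
    · refine ⟨a, ha, b, hb, ?_⟩
      rw [hYj, hY' a ha, hY' b hb]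
    · obtain ⟨a, ha, b, hb, h⟩ := hY.bracket i h2 hi
      refine ⟨a, ha, b, hb, ?_⟩
      rwa [hY' i hi, hY' a (ha.trans hi), hY' b (hb.trans hi)]
  · intro i h2 hi c hc d hd'
    rw [hY' c (by omega), hY' d (by omega)]
    rcases (Nat.lt_succ_iff.1 hi).eq_or_lt with rfl | hi
    -- The bracket relation on the base is read off on the slice through `p`.
    · refine eventually_of_eventually_cylinder
        (P := fun x => lieBracket ℝ (Y c) (Y d) x ∈ flag Y' (i + 1) x) ?_
      filter_upwards [hlift c hc d hd', hflag] with z hz hz'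
      rw [← hz', mem_flag_cylinder] at hz
      exact hz
    · filter_upwards [hY.closed i h2 hi c hc d hd'] with x hx
      rwa [flag_congr (Y := Y) fun e he => by rw [hY' e (by omega)]]

protected theorem IsGoursatFrame.exists_quotient_frame {m : ℕ} {X : ℕ → S × ℝ → S × ℝ} {p : S × ℝ}
    (hX : IsGoursatFrame (m + 1) X p) (hm : 2 ≤ m) {Y : ℕ → S → S}
    (hY : IsGoursatFrame 2 Y p.1)
    (hXY : ∀ᶠ z in 𝓝 p, flag (cylinder Y) 3 z = flag X 3 z) :
    ∃ Y' : ℕ → S → S, (∀ i < 2, Y' i = Y i) ∧ IsGoursatFrame m Y' p.1 := by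
  suffices H : ∀ j, 2 ≤ j → j ≤ m → ∃ Y' : ℕ → S → S, (∀ i < 2, Y' i = Y i) ∧
      IsGoursatFrame j Y' p.1 ∧ ∀ᶠ z in 𝓝 p, flag (cylinder Y') (j + 1) z = flag X (j + 1) z by
    obtain ⟨Y', h1, h2, -⟩ := H m hm le_rfl
    exact ⟨Y', h1, h2⟩
  intro j hj
  induction j, hj using Nat.le_induction with
  | base => exact fun _ => ⟨Y, fun _ _ => rfl, hY, hXY⟩
  | succ j hj ih =>
    intro hjm
    obtain ⟨Y₁, h1, h2, h3⟩ := ih (by omega)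
    obtain ⟨Y₂, h4, h5, h6⟩ := hX.exists_quotient_frame_succ hj (by omega) h2 h3
    exact ⟨Y₂, fun i hi => (h4 i (by omega)).trans (h1 i hi), h5, h6⟩

end Cylinder

theorem linearIndependent_iff_finrank_flag {M : Type*} {F : M → Type*} [∀ x, AddCommGroup (F x)]
    [∀ x, Module ℝ (F x)] {X : ℕ → (x : M) → F x} {j : ℕ} {x : M} :
    (LinearIndependent ℝ fun c : Fin j => X c x) ↔ Module.finrank ℝ (flag X j x) = j := by
  rw [linearIndependent_iff_card_eq_finrank_span, Fintype.card_fin, eq_comm]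
  rfl

theorem flag_two {M : Type*} {F : M → Type*} [∀ x, AddCommGroup (F x)]
    [∀ x, Module ℝ (F x)] {X : ℕ → (x : M) → F x} {x : M} :
    flag X 2 x = Submodule.span ℝ {X 0 x, X 1 x} := by
  refine le_antisymm (flag_le.2 fun i hi => ?_) (Submodule.span_le.2 ?_)
  · interval_cases i <;> exact Submodule.subset_span (by simp)
  · rintro _ (rfl | rfl)
    · exact mem_flag X (by norm_num) x
    · exact mem_flag X (by norm_num) x

/-! ### Deprolongation -/

section Deprolongation

variable {S : Type*} [NormedAddCommGroup S] [NormedSpace ℝ S] [FiniteDimensional ℝ S]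

/-- The horizontal parts of a field `V` and of `X 2`. -/
def horizontalPair (V W : S × ℝ → S × ℝ) : ℕ → S × ℝ → S
  | 0 => fun z => (V z).1
  | _ + 1 => fun z => (W z).1

/-- The field V is the quarter turn of the axis field in the frame X₀, X₁. The two therefore have
determinant a² + b² ≠ 0 in that frame and span the same plane. -/
theorem flag_axisLift_horizontalPair {S : Type*} [NormedAddCommGroup S] [NormedSpace ℝ S]
    {X : ℕ → S × ℝ → S × ℝ} {V : S × ℝ → S × ℝ} {z : S × ℝ}
    {a b : ℝ} (hz : ((0 : S), (1 : ℝ)) = a • X 0 z + b • X 1 z)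
    (hV : V z = -b • X 0 z + a • X 1 z) :
    flag (axisLift (horizontalPair V (X 2))) 2 z = flag X 2 z ∧
      flag (axisLift (horizontalPair V (X 2))) 3 z = flag X 3 z := by
  set w := horizontalPair V (X 2) with hw
  have hw0 : (V z).1 ∈ flag w 1 z := mem_flag w (i := 0) (by norm_num) z
  have hw1 : (X 2 z).1 ∈ flag w 2 z := mem_flag w (i := 1) (by norm_num) z
  have hVm : V z ∈ flag X 2 z := by
    rw [hV]
    exact Submodule.add_mem _ (Submodule.smul_mem _ _ (mem_flag X (by norm_num) z))
      (Submodule.smul_mem _ _ (mem_flag X (by norm_num) z))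
  have hzm : ((0 : S), (1 : ℝ)) ∈ flag X 2 z := by
    rw [hz]
    exact Submodule.add_mem _ (Submodule.smul_mem _ _ (mem_flag X (by norm_num) z))
      (Submodule.smul_mem _ _ (mem_flag X (by norm_num) z))
  have hhor : ∀ G : Submodule ℝ (S × ℝ), ((0 : S), (1 : ℝ)) ∈ G → ∀ u ∈ G, (u.1, 0) ∈ G := by
    intro G hG u hu
    have := G.sub_mem hu (G.smul_mem u.2 hG)
    rwa [show u - u.2 • ((0 : S), (1 : ℝ)) = (u.1, 0) from Prod.ext (by simp) (by simp)] at this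
  have h2 : flag (axisLift w) 2 z = flag X 2 z := by
    refine le_antisymm (flag_le.2 fun i hi => ?_) (flag_le.2 fun i hi => ?_)
    · interval_cases i
      · exact hzm
      · exact hhor _ hzm _ hVm
    · rw [mem_flag_axisLift]
      have e0 : (0 : S) = a • (X 0 z).1 + b • (X 1 z).1 := congrArg Prod.fst hz
      have e1 : (1 : ℝ) = a * (X 0 z).2 + b * (X 1 z).2 := congrArg Prod.snd hz
      have hVz : (V z).1 = -b • (X 0 z).1 + a • (X 1 z).1 := congrArg Prod.fst hV
      have hr : a ^ 2 + b ^ 2 ≠ 0 := by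
        intro h
        have h0 : a = 0 := by nlinarith [sq_nonneg a, sq_nonneg b]
        have h1 : b = 0 := by nlinarith [sq_nonneg a, sq_nonneg b]
        rw [h0, h1] at e1
        norm_num at e1
      interval_cases i
      · have : (a ^ 2 + b ^ 2) • (X 0 z).1 = -b • (V z).1 := by
          have h := congrArg (fun u => a • u) e0
          simp only [smul_zero] at h
          rw [hVz, ← sub_eq_zero, h]
          module
        rw [← inv_smul_smul₀ hr (X 0 z).1, this]
        exact Submodule.smul_mem _ _ (Submodule.smul_mem _ _ hw0)
      · have : (a ^ 2 + b ^ 2) • (X 1 z).1 = a • (V z).1 := by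
          have h := congrArg (fun u => b • u) e0
          simp only [smul_zero] at h
          rw [hVz, ← sub_eq_zero, h]
          module
        rw [← inv_smul_smul₀ hr (X 1 z).1, this]
        exact Submodule.smul_mem _ _ (Submodule.smul_mem _ _ hw0)
  have hzm3 := flag_mono X (Nat.le_succ 2) z hzm
  refine ⟨h2, le_antisymm (flag_le.2 fun i hi => ?_) (flag_le.2 fun i hi => ?_)⟩
  · interval_cases i
    · exact hzm3
    · exact hhor _ hzm3 _ (flag_mono X (Nat.le_succ 2) z hVm)
    · exact hhor _ hzm3 _ (mem_flag X (by norm_num) z)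
  · rcases (Nat.lt_succ_iff.1 hi).eq_or_lt with rfl | hi
    · exact mem_flag_axisLift.2 hw1
    · refine flag_mono _ (Nat.le_succ 2) z ?_
      rw [h2]; exact mem_flag X hi z

/-- Once the characteristic field is ∂/∂t, the horizontal part of D⁽¹⁾ is independent of t and
defines the rank two distribution on the base. The horizontal part of D itself is the line through
`v`. -/
protected theorem IsGoursatFrame.exists_base {m : ℕ} (hm : 2 ≤ m) {X : ℕ → S × ℝ → S × ℝ}
    {p : S × ℝ}
    (hX : IsGoursatFrame (m + 1) X p) {c₀ c₁ : S × ℝ → ℝ} (hc₀ : SmoothNear c₀ p)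
    (hc₁ : SmoothNear c₁ p)
    (hdt : ∀ᶠ z in 𝓝 p, ((0 : S), (1 : ℝ)) = c₀ z • X 0 z + c₁ z • X 1 z)
    (hinv : ∀ i < 3, ∀ᶠ z in 𝓝 p, fderiv ℝ (X i) z (0, 1) ∈ flag X 3 z) :
    ∃ Y : ℕ → S → S, IsGoursatFrame m Y p.1 ∧ ∃ v : S × ℝ → S, SmoothNear v p ∧
      v p ≠ 0 ∧ (∀ᶠ z in 𝓝 p, v z ∈ flag Y 2 z.1) ∧
      (∀ᶠ z in 𝓝 p, flag X 2 z = Submodule.span ℝ {(0, 1), (v z, 0)}) ∧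
      fderiv ℝ v p (0, 1) ∉ Submodule.span ℝ {v p} := by
  have hXs : ∀ i < 3, SmoothNear (X i) p := fun i hi => hX.smooth i (by omega)
  have hX3 : LinearIndependent ℝ fun c : Fin 3 => X c p :=
    linearIndependent_of_le (by omega) hX.indep
  have hX2 : LinearIndependent ℝ fun c : Fin 2 => X c p :=
    linearIndependent_of_le (by omega) hX3
  let V : S × ℝ → S × ℝ := fun z => -c₁ z • X 0 z + c₀ z • X 1 z
  have hV : SmoothNear V p :=
    ((hc₁.neg).smul (hXs 0 (by norm_num))).add (hc₀.smul (hXs 1 (by norm_num)))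
  let w : ℕ → S × ℝ → S := horizontalPair V (X 2)
  have hw : ∀ i < 2, SmoothNear (w i) p := by
    intro i hi
    interval_cases i
    · exact (contDiff_fst.smoothNear _).comp hV
    · exact (contDiff_fst.smoothNear _).comp (hXs 2 (by norm_num))
  have h23 : ∀ᶠ z in 𝓝 p, flag (axisLift w) 2 z = flag X 2 z ∧
      flag (axisLift w) 3 z = flag X 3 z := by
    filter_upwards [hdt] with z hz using flag_axisLift_horizontalPair hz rfl
  have h2 := h23.mono fun _ h => h.1
  have h3 := h23.mono fun _ h => h.2
  have hw2 : LinearIndependent ℝ fun c : Fin 2 => w c p := by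
    have e : Module.finrank ℝ (flag (axisLift w) 3 p) = 3 := by
      rw [h3.self_of_nhds, finrank_flag hX3]
    exact linearIndependent_axisLift.1 (linearIndependent_iff_finrank_flag.2 e)
  have hw1 : LinearIndependent ℝ fun c : Fin 1 => w c p := linearIndependent_of_le (by norm_num) hw2
  have hwinv : ∀ i : Fin 2, ∀ᶠ z in 𝓝 p, fderiv ℝ (w i) z (0, 1) ∈
      Submodule.span ℝ (range fun i : Fin 2 => w i z) := by
    have key : ∀ U : S × ℝ → S × ℝ, SmoothNear U p →
        (∀ᶠ z in 𝓝 p, fderiv ℝ U z (0, 1) ∈ flag X 3 z) →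
        ∀ᶠ z in 𝓝 p, fderiv ℝ (fun z => (U z).1) z (0, 1) ∈ flag w 2 z := by
      intro U hU hUm
      filter_upwards [hU, hUm, h3] with z hz hz' hz3
      rw [← hz3, mem_flag_axisLift] at hz'
      have : HasFDerivAt (fun z => (U z).1)
          ((ContinuousLinearMap.fst ℝ S ℝ).comp (fderiv ℝ U z)) z :=
        (ContinuousLinearMap.fst ℝ S ℝ).hasFDerivAt.comp z
          (hz.differentiableAt (by simp)).hasFDerivAt
      rw [this.fderiv]
      exact hz'
    rw [Fin.forall_fin_two]
    refine ⟨key V hV ?_, key (X 2) (hXs 2 (by norm_num)) (hinv 2 (by norm_num))⟩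
    filter_upwards [eventually_smoothNear hXs, hc₀, hc₁, hinv 0 (by norm_num),
      hinv 1 (by norm_num)] with z hz h0 h1 hi0 hi1
    rw [← lieBracket_axis, lieBracket_swap]
    refine Submodule.neg_mem _ (lieBracket_smul_add_smul_mem (f := fun z => -c₁ z)
      (h1.differentiableAt (by simp)).neg (h0.differentiableAt (by simp))
      (hz 0 (by norm_num)).differentiableAt (hz 1 (by norm_num)).differentiableAt
      (mem_flag X (by norm_num) z) (mem_flag X (by norm_num) z) ?_)
    rw [lieBracket_swap, lieBracket_swap (V := X 1), lieBracket_axis, lieBracket_axis]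
    exact Submodule.add_mem _ (Submodule.smul_mem _ _ (Submodule.neg_mem _ hi0))
      (Submodule.smul_mem _ _ (Submodule.neg_mem _ hi1))
  obtain ⟨Y₀, hY₀s, hY₀⟩ := exists_invariant_frame (w := fun i : Fin 2 => w i)
    (fun i => hw i i.2) hw2 hwinv
  -- Only indices 0 and 1 matter. The later fields are supplied by `exists_quotient_frame`.
  let Y₁ : ℕ → S → S := fun i => if h : i < 2 then Y₀ ⟨i, h⟩ else 0
  have hY₁e : ∀ x, flag Y₁ 2 x = Submodule.span ℝ (range fun i => Y₀ i x) := by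
    intro x
    have : (fun c : Fin 2 => Y₁ c x) = fun i => Y₀ i x := by
      funext c; simp only [Y₁, c.2, dif_pos]
    rw [flag, this]
  have hY₁w : ∀ᶠ z in 𝓝 p, flag Y₁ 2 z.1 = flag w 2 z := by
    filter_upwards [hY₀] with z hz
    rw [hY₁e, hz]; rfl
  have hY₁ : IsGoursatFrame 2 Y₁ p.1 := by
    refine ⟨fun i hi => ?_, ?_, fun j h2 hj => by omega, fun j h2 hj => by omega⟩
    · simp only [Y₁, hi, dif_pos]; exact hY₀s _
    · rw [linearIndependent_iff_finrank_flag, hY₁w.self_of_nhds]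
      exact finrank_flag hw2
  obtain ⟨Y, hYY, hY⟩ := hX.exists_quotient_frame hm hY₁ (by
    filter_upwards [hY₁w, h3] with z hz hz3
    rw [← hz3]
    ext u
    rw [mem_flag_cylinder, mem_flag_axisLift, hz])
  refine ⟨Y, hY, w 0, hw 0 (by norm_num), hw1.ne_zero 0, ?_, ?_, ?_⟩
  · filter_upwards [hY₁w] with z hz
    rw [flag_congr (Y := Y₁) fun i hi => by rw [hYY i hi], hz]
    exact mem_flag w (by norm_num) z
  · filter_upwards [h2] with z hz
    rw [← hz, flag_two]; rfl
  -- If the line through `v` did not turn to first order at `p`, then [∂/∂t, v] would lie in D(p),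
  -- and with it [X₀, X₁].
  · intro hcon
    refine hX.lieBracket_zero_one_notMem (by omega) ?_
    have hU := smoothNear_axisLift (w := w) (j := 1) (p := p) fun i hi => hw i (by omega)
    have hd := (hw 0 (by norm_num)).differentiableAt
    have hb : lieBracket ℝ (axisLift w 0) (axisLift w 1) p ∈ flag X 2 p := by
      have e : HasFDerivAt (axisLift w 1) ((fderiv ℝ (w 0) p).prod (0 : S × ℝ →L[ℝ] ℝ)) p :=
        hd.hasFDerivAt.prodMk (hasFDerivAt_const _ _)
      rw [show axisLift w 0 = fun _ => (0, 1) from rfl, lieBracket_axis, e.fderiv,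
        ← h2.self_of_nhds, mem_flag_axisLift]
      refine (Submodule.span_le.2 ?_ : Submodule.span ℝ {w 0 p} ≤ flag w 1 p) hcon
      rintro _ rfl
      exact mem_flag w (by norm_num) p
    refine lieBracket_mem_of_mem_flag hU (linearIndependent_axisLift.2 hw1)
      (hXs 0 (by norm_num)) ?_ (hXs 1 (by norm_num)) ?_ ?_ ?_
    · filter_upwards [h2] with z hz
      rw [hz]; exact mem_flag X (by norm_num) z
    · filter_upwards [h2] with z hz
      rw [hz]; exact mem_flag X (by norm_num) z
    · intro i hi
      rw [← h2.self_of_nhds]; exact mem_flag _ hi p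
    · intro a ha b hb'
      interval_cases a <;> interval_cases b
      · rw [lieBracket_self]; exact Submodule.zero_mem _
      · exact hb
      · rw [lieBracket_swap]; exact Submodule.neg_mem _ hb
      · rw [lieBracket_self]; exact Submodule.zero_mem _

end Deprolongation

/-- A flow box of the characteristic field reduces this to `exists_base`; the plane field is then
pushed forward again by the derivative of `G`. -/
protected theorem IsGoursatFrame.exists_deprolongation {E : Type} [NormedAddCommGroup E]
    [NormedSpace ℝ E]
    [FiniteDimensional ℝ E] {m : ℕ} {X : ℕ → E → E} {q : E} (hX : IsGoursatFrame (m + 1) X q)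
    (hm : 2 ≤ m) (hE : Module.finrank ℝ E = m + 1) :
    ∃ S : Submodule ℝ E, Module.finrank ℝ S = m ∧ ∃ G : S × ℝ → E,
      SmoothNear G 0 ∧ G 0 = q ∧ (fderiv ℝ G 0).IsInvertible ∧
      ∃ Y : ℕ → S → S, IsGoursatFrame m Y 0 ∧ ∃ v : S × ℝ → S, SmoothNear v 0 ∧
        v 0 ≠ 0 ∧ (∀ᶠ z in 𝓝 0, v z ∈ flag Y 2 z.1) ∧
        (∀ᶠ z in 𝓝 0, flag X 2 (G z) =
          (Submodule.span ℝ {(0, 1), (v z, 0)}).map (fderiv ℝ G z : S × ℝ →ₗ[ℝ] E)) ∧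
        fderiv ℝ v 0 (0, 1) ∉ Submodule.span ℝ {v 0} := by
  have := FiniteDimensional.complete ℝ E
  obtain ⟨c₀, c₁, hc₀, hc₁, hne, hchar⟩ := hX.exists_characteristic (by omega) hE
  have hs : ∀ i < 3, SmoothNear (X i) q := fun i hi => hX.smooth i (by omega)
  let L : E → E := fun y => c₀ y • X 0 y + c₁ y • X 1 y
  have hL : SmoothNear L q := (hc₀.smul (hs 0 (by norm_num))).add (hc₁.smul (hs 1 (by norm_num)))
  have hLq : L q ≠ 0 := by
    intro h
    have h2 := linearIndependent_of_le (X := X) (x := q) (by omega : 2 ≤ m + 1) hX.indep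
    rw [Fintype.linearIndependent_iff] at h2
    have h3 := h2 ![c₀ q, c₁ q] (by simpa using h)
    exact hne ⟨h3 0, h3 1⟩
  obtain ⟨S, hS, G, hG, hG0, hGi, hGL⟩ := exists_flowBox hL hLq
  subst hG0
  have hXp : IsGoursatFrame (m + 1) (fun i => pullback ℝ G (X i)) 0 := hX.pullback hG hGi
  have hLp : ∀ᶠ z in 𝓝 0, pullback ℝ G L z = (0, 1) := by
    filter_upwards [hGL, hG.eventually_isInvertible hGi] with z hz hi
    rw [VectorField.pullback, ← hz, hi.inverse_apply_self]
  obtain ⟨Y, hY, v, hv, hv0, h1, h2, h3⟩ := hXp.exists_base hm (hc₀.comp hG) (hc₁.comp hG) (by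
      filter_upwards [hLp] with z hz
      rw [← hz]
      simp [VectorField.pullback, L]) (by
      intro i hi
      filter_upwards [hLp.eventually_nhds, hG.continuousAt.eventually (hchar i hi),
        eventually_pullback_lieBracket hG hL (hs i hi)] with z hz hz' hz''
      have e : lieBracket ℝ (pullback ℝ G L) (pullback ℝ G (X i)) z =
          lieBracket ℝ (fun _ => (0, 1)) (pullback ℝ G (X i)) z :=
        Filter.EventuallyEq.lieBracket_vectorField_eq hz (EventuallyEq.refl _ _)
      rw [← lieBracket_axis, ← e, ← hz'']
      exact pullback_mem_flag hz')
  refine ⟨S, by omega, G, hG, rfl, hGi, Y, hY, v, hv, hv0, h1, ?_, h3⟩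
  filter_upwards [h2, hG.eventually_isInvertible hGi] with z hz hi
  rw [← hz, flag, flag, Submodule.map_span, ← range_comp]
  congr 2
  funext i
  exact (hi.self_apply_inverse _).symm

/-! ### Local angle functions -/

section Angle

/-- A smooth nowhere zero complex function has locally a smooth angle. -/
protected theorem SmoothNear.exists_angle {E : Type*} [NormedAddCommGroup E] [NormedSpace ℝ E]
    {ζ : E → ℂ}
    {p : E} (hζ : SmoothNear ζ p) (h0 : ζ p ≠ 0) :
    ∃ ψ : E → ℝ, SmoothNear ψ p ∧
      (∀ᶠ z in 𝓝 p, ∃ r : ℝ, r ≠ 0 ∧ ζ z = ⟨r * Real.cos (ψ z), r * Real.sin (ψ z)⟩) ∧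
      ∀ u, fderiv ℝ ψ p u = (fderiv ℝ ζ p u / ζ p).im := by
  -- Division by ζ(p) moves the value at p to 1, away from the branch cut of the logarithm.
  have hdiv : SmoothNear (fun z => ζ z / ζ p) p := by
    filter_upwards [hζ] with z hz
    exact hz.div_const _
  have hslit : ∀ᶠ z in 𝓝 p, ζ z / ζ p ∈ Complex.slitPlane := by
    refine hdiv.continuousAt.eventually (Complex.isOpen_slitPlane.mem_nhds ?_)
    change ζ p / ζ p ∈ _
    rw [div_self h0]; exact Complex.one_mem_slitPlane
  have hlog : SmoothNear (fun z => Complex.log (ζ z / ζ p)) p := by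
    filter_upwards [hdiv, hslit] with z hz hz'
    exact ((Complex.contDiffAt_log hz').restrict_scalars ℝ).comp z hz
  refine ⟨fun z => (ζ p).arg + (Complex.log (ζ z / ζ p)).im, ?_, ?_, ?_⟩
  · exact (contDiff_const.smoothNear _).add ((Complex.imCLM.contDiff.smoothNear _).comp hlog)
  · filter_upwards [hslit] with z hz
    have hz0 : ζ z / ζ p ≠ 0 := Complex.slitPlane_ne_zero hz
    set l := Complex.log (ζ z / ζ p) with hl
    refine ⟨‖ζ p‖ * Real.exp l.re, mul_ne_zero (norm_ne_zero_iff.2 h0) (Real.exp_ne_zero _), ?_⟩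
    have e1 : ζ z = ζ p * Complex.exp l := by
      rw [hl, Complex.exp_log hz0, mul_div_cancel₀ _ h0]
    rw [e1]
    conv_lhs => rw [← Complex.norm_mul_exp_arg_mul_I (ζ p)]
    rw [mul_assoc, ← Complex.exp_add]
    apply Complex.ext
    · rw [Complex.re_ofReal_mul, Complex.exp_re]; simp; ring
    · rw [Complex.im_ofReal_mul, Complex.exp_im]; simp; ring
  · intro u
    have h1 : HasFDerivAt ζ (fderiv ℝ ζ p) p := hζ.differentiableAt.hasFDerivAt
    have h2 : HasDerivAt (fun w : ℂ => Complex.log (w / ζ p)) (1 / ζ p) (ζ p) := by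
      have := (hasDerivAt_id (ζ p)).div_const (ζ p)
      have h3 := this.clog (by simp [div_self h0])
      simpa [div_self h0] using h3
    have h4 : HasFDerivAt (fun z => Complex.log (ζ z / ζ p)) _ p :=
      (h2.hasFDerivAt.restrictScalars ℝ).comp p h1
    have h5 : HasFDerivAt (fun z => (ζ p).arg + (Complex.log (ζ z / ζ p)).im) _ p :=
      (Complex.imCLM.hasFDerivAt.comp p h4).const_add _
    rw [h5.fderiv]
    simp [div_eq_mul_inv]

end Angle

theorem span_pair_triangular {W : Type*} [AddCommGroup W] [Module ℝ W] {C V : W} {s t r : ℝ}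
    (hs : s ≠ 0) (hr : r ≠ 0) (hV : V = r • C) :
    Submodule.span ℝ {((0 : W), s), (V, t)} = Submodule.span ℝ {((0 : W), (1 : ℝ)), (C, 0)} := by
  subst hV
  refine le_antisymm (Submodule.span_le.2 ?_) (Submodule.span_le.2 ?_)
  · rintro _ (rfl | rfl)
    · exact Submodule.mem_span_pair.2 ⟨s, 0, by simp⟩
    · exact Submodule.mem_span_pair.2 ⟨t, r, by simp⟩
  · rintro _ (rfl | rfl)
    · exact Submodule.mem_span_pair.2 ⟨s⁻¹, 0, by simp [hs]⟩
    · refine Submodule.mem_span_pair.2 ⟨-(r⁻¹ * t * s⁻¹), r⁻¹, ?_⟩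
      refine Prod.ext ?_ ?_
      · simp [smul_smul, hr]
      · simp; field_simp; ring

/-! ### Cartan prolongation of an equivalence -/

section Prolongation

variable {S W : Type*} [NormedAddCommGroup S] [NormedSpace ℝ S]
  [NormedAddCommGroup W] [NormedSpace ℝ W] [FiniteDimensional ℝ W]

/-- The Cartan prolongation of a map `Φ` that transports a rank two distribution to the
distribution spanned by `A` and `B`: the new coordinate is the angle of the direction `v`. -/
theorem exists_prolongation {Φ : S → W} {v : S × ℝ → S} {p : S × ℝ} {A : W} {B : W → W}
    {ϑ : W → ℝ} (hΦ : SmoothNear Φ p.1) (hinj : Function.Injective (fderiv ℝ Φ p.1))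
    (hv : SmoothNear v p) (hB : ContDiff ℝ ∞ B) (hϑ : ContDiff ℝ ∞ ϑ)
    (hAB : ∀ w, LinearIndependent ℝ ![A, B w]) (hv0 : v p ≠ 0)
    (hvt : fderiv ℝ v p (0, 1) ∉ Submodule.span ℝ {v p})
    (hmem : ∀ᶠ z in 𝓝 p, fderiv ℝ Φ z.1 (v z) ∈ Submodule.span ℝ {A, B (Φ z.1)}) :
    ∃ Φ' : S × ℝ → W × ℝ, SmoothNear Φ' p ∧ Function.Injective (fderiv ℝ Φ' p) ∧
      ∀ᶠ z in 𝓝 p, (Submodule.span ℝ {((0 : S), (1 : ℝ)), (v z, 0)}).map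
          (fderiv ℝ Φ' z : S × ℝ →ₗ[ℝ] W × ℝ) =
        Submodule.span ℝ {(0, 1), (Real.cos ((Φ' z).2 - ϑ (Φ' z).1) • B (Φ' z).1 +
          Real.sin ((Φ' z).2 - ϑ (Φ' z).1) • A, 0)} := by
  have hfst : SmoothNear (fun z : S × ℝ => z.1) p := contDiff_fst.smoothNear p
  have hΦ1 : SmoothNear (fun z : S × ℝ => Φ z.1) p := hΦ.comp hfst
  let V : S × ℝ → W := fun z => fderiv ℝ Φ z.1 (v z)
  have hV : SmoothNear V p := (hΦ.fderiv.comp hfst).clm_apply hv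
  let F : Fin 2 → S × ℝ → W := ![fun _ => A, fun z => B (Φ z.1)]
  have hFz : ∀ z, (fun i => F i z) = ![A, B (Φ z.1)] := fun z => by
    funext i; fin_cases i <;> rfl
  have hF : ∀ i, SmoothNear (F i) p := by
    rw [Fin.forall_fin_two]
    exact ⟨contDiff_const.smoothNear _, (hB.smoothNear _).comp hΦ1⟩
  obtain ⟨c, hc, hVc⟩ := exists_smooth_coeffs hF (by rw [hFz]; exact hAB _) hV (by
    filter_upwards [hmem] with z hz
    rw [hFz]
    simpa [Matrix.range_cons, Matrix.range_empty, pair_comm] using hz)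
  have hVc' : ∀ᶠ z in 𝓝 p, V z = c 0 z • A + c 1 z • B (Φ z.1) := by
    filter_upwards [hVc] with z hz
    rw [hz, Fin.sum_univ_two]; rfl
  -- The angle is measured from B towards A, to match cos · B + sin · A.
  let ζ : S × ℝ → ℂ := fun z => ⟨c 1 z, c 0 z⟩
  have hζ : SmoothNear ζ p :=
    (Complex.equivRealProdCLM.symm.contDiff.smoothNear _).comp ((hc 1).prodMk (hc 0))
  have hVp : V p ≠ 0 := fun h => hv0 (hinj (by rw [map_zero]; exact h))
  have hζ0 : ζ p ≠ 0 := by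
    intro h
    have h1 : c 1 p = 0 := congrArg Complex.re h
    have h2 : c 0 p = 0 := congrArg Complex.im h
    apply hVp
    rw [hVc'.self_of_nhds, h1, h2]; simp
  obtain ⟨ψ, hψ, hpolar, hψd⟩ := hζ.exists_angle hζ0
  -- The angular speed is Im(ζ'/ζ). If it vanished, then ζ' = ρ ζ with ρ real. As A and B ∘ Φ are
  -- constant along the axis, this gives dΦ(v') = ρ dΦ(v), hence v' = ρ v, against `hvt`.
  have hσ : fderiv ℝ ψ p (0, 1) ≠ 0 := by
    intro h
    rw [hψd] at h
    set ρ := (fderiv ℝ ζ p (0, 1) / ζ p).re with hρ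
    have hζ' : fderiv ℝ ζ p (0, 1) = ρ • ζ p := by
      have : fderiv ℝ ζ p (0, 1) / ζ p = (ρ : ℂ) := Complex.ext rfl (by simpa using h)
      rw [div_eq_iff hζ0] at this
      rw [this, Complex.real_smul]
    have hl : HasDerivAt (fun t : ℝ => (p.1, t)) ((0 : S), (1 : ℝ)) p.2 :=
      (hasDerivAt_const _ p.1).prodMk (hasDerivAt_id p.2)
    have hl' : Tendsto (fun t : ℝ => (p.1, t)) (𝓝 p.2) (𝓝 p) := hl.continuousAt
    have hζl : HasDerivAt (fun t : ℝ => ζ (p.1, t)) (ρ • ζ p) p.2 := by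
      rw [← hζ']
      exact hζ.differentiableAt.hasFDerivAt.comp_hasDerivAt p.2 hl
    have h0 : HasDerivAt (fun t : ℝ => c 0 (p.1, t)) (ρ * c 0 p) p.2 := by
      have h1 := Complex.imCLM.hasFDerivAt.comp_hasDerivAt p.2 hζl
      have h2 : Complex.imCLM (ρ • ζ p) = ρ * c 0 p := by simp [ζ]
      rw [h2] at h1; exact h1
    have h1 : HasDerivAt (fun t : ℝ => c 1 (p.1, t)) (ρ * c 1 p) p.2 := by
      have h1 := Complex.reCLM.hasFDerivAt.comp_hasDerivAt p.2 hζl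
      have h2 : Complex.reCLM (ρ • ζ p) = ρ * c 1 p := by simp [ζ]
      rw [h2] at h1; exact h1
    have hvl : HasDerivAt (fun t : ℝ => v (p.1, t)) (fderiv ℝ v p (0, 1)) p.2 :=
      hv.differentiableAt.hasFDerivAt.comp_hasDerivAt p.2 hl
    have hV1 : HasDerivAt (fun t : ℝ => V (p.1, t))
        (fderiv ℝ Φ p.1 (fderiv ℝ v p (0, 1))) p.2 :=
      (fderiv ℝ Φ p.1).hasFDerivAt.comp_hasDerivAt p.2 hvl
    have hV2 : HasDerivAt (fun t : ℝ => V (p.1, t))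
        ((ρ * c 0 p) • A + (ρ * c 1 p) • B (Φ p.1)) p.2 :=
      ((h0.smul_const A).add (h1.smul_const (B (Φ p.1)))).congr_of_eventuallyEq
        (hl'.eventually hVc')
    refine hvt (Submodule.mem_span_singleton.2 ⟨ρ, (hinj ?_).symm⟩)
    rw [hV1.unique hV2, map_smul]
    change _ = ρ • V p
    rw [hVc'.self_of_nhds, smul_add, smul_smul, smul_smul]
  let Φ' : S × ℝ → W × ℝ := fun z => (Φ z.1, ϑ (Φ z.1) + ψ z)
  have hΦ' : SmoothNear Φ' p := hΦ1.prodMk (((hϑ.smoothNear _).comp hΦ1).add hψ)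
  have hd : ∀ᶠ z in 𝓝 p, ∀ u : S × ℝ, fderiv ℝ Φ' z u =
      (fderiv ℝ Φ z.1 u.1, fderiv ℝ ϑ (Φ z.1) (fderiv ℝ Φ z.1 u.1) + fderiv ℝ ψ z u) := by
    filter_upwards [hψ, (continuous_fst.tendsto p).eventually hΦ] with z h1 h2 u
    have h3 : HasFDerivAt (fun z : S × ℝ => Φ z.1)
        ((fderiv ℝ Φ z.1).comp (ContinuousLinearMap.fst ℝ S ℝ)) z :=
      (h2.differentiableAt (by simp)).hasFDerivAt.comp z hasFDerivAt_fst
    have h4 : HasFDerivAt (fun z : S × ℝ => ϑ (Φ z.1))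
        ((fderiv ℝ ϑ (Φ z.1)).comp ((fderiv ℝ Φ z.1).comp (ContinuousLinearMap.fst ℝ S ℝ))) z :=
      ((hϑ.differentiable (by simp)) _).hasFDerivAt.comp z h3
    have h5 : HasFDerivAt Φ' _ z :=
      h3.prodMk (h4.add (h1.differentiableAt (by simp)).hasFDerivAt)
    rw [h5.fderiv]; rfl
  refine ⟨Φ', hΦ', ?_, ?_⟩
  · rw [injective_iff_map_eq_zero]
    intro u hu
    rw [hd.self_of_nhds u] at hu
    have e1 : fderiv ℝ Φ p.1 u.1 = 0 := congrArg Prod.fst hu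
    have e2 : fderiv ℝ ϑ (Φ p.1) (fderiv ℝ Φ p.1 u.1) + fderiv ℝ ψ p u = 0 :=
      congrArg Prod.snd hu
    have e3 : u.1 = 0 := hinj (by rw [e1, map_zero])
    rw [e1, map_zero, zero_add, show u = u.2 • ((0 : S), (1 : ℝ)) from
      Prod.ext (by simp [e3]) (by simp), map_smul, smul_eq_mul] at e2
    exact Prod.ext e3 ((mul_eq_zero.1 e2).resolve_right hσ)
  · have hσ' : ∀ᶠ z in 𝓝 p, fderiv ℝ ψ z (0, 1) ≠ 0 :=
      (hψ.fderiv.clm_apply (contDiff_const.smoothNear p)).continuousAt.eventually_ne hσ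
    filter_upwards [hd, hσ', hpolar, hVc'] with z hdz hσz hz hVz
    obtain ⟨r, hr, hrz⟩ := hz
    have e1 : c 1 z = r * Real.cos (ψ z) := congrArg Complex.re hrz
    have e0 : c 0 z = r * Real.sin (ψ z) := congrArg Complex.im hrz
    rw [Submodule.map_span, image_pair]
    have h1 : (fderiv ℝ Φ' z : S × ℝ →ₗ[ℝ] W × ℝ) (0, 1) = (0, fderiv ℝ ψ z (0, 1)) := by
      change fderiv ℝ Φ' z (0, 1) = _
      rw [hdz]; simp
    have h2 : (fderiv ℝ Φ' z : S × ℝ →ₗ[ℝ] W × ℝ) (v z, 0) =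
        (V z, fderiv ℝ ϑ (Φ z.1) (V z) + fderiv ℝ ψ z (v z, 0)) := hdz (v z, 0)
    rw [h1, h2]
    have h3 : (Φ' z).2 - ϑ (Φ' z).1 = ψ z := by simp [Φ']
    rw [h3]
    -- The axis goes to a nonzero multiple of the new angular direction. That direction absorbs the
    -- last component of the image of `v`, whose first component is r(cos ψ · B + sin ψ · A).
    refine span_pair_triangular hσz hr ?_
    rw [hVz, e0, e1]
    change _ = r • (Real.cos (ψ z) • B (Φ z.1) + _)
    module

end Prolongation

/-! ### The trailer system in angle coordinates, built recursively -/

section AngleCoordinates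

/-- The space of the coordinates `(ξ₁, ξ₂, θ₀, …, θₖ₋₁)`. -/
abbrev AngleSpace (k : ℕ) : Type := (ℝ × ℝ) × (Fin k → ℝ)

/-- Adding a last angle. -/
def addAngle (k : ℕ) : (AngleSpace k × ℝ) ≃L[ℝ] AngleSpace (k + 1) :=
  LinearEquiv.toContinuousLinearEquiv
    { toFun := fun z => (z.1.1, Fin.snoc (α := fun _ => ℝ) z.1.2 z.2)
      invFun := fun w => ((w.1, fun i => w.2 i.castSucc), w.2 (Fin.last k))
      map_add' := by
        intro z z'
        refine Prod.ext rfl (funext fun i => ?_)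
        induction i using Fin.lastCases <;> simp
      map_smul' := by
        intro c z
        refine Prod.ext rfl (funext fun i => ?_)
        induction i using Fin.lastCases <;> simp
      left_inv := by
        intro z
        simp
      right_inv := by
        intro w
        refine Prod.ext rfl (funext fun i => ?_)
        induction i using Fin.lastCases <;> simp }

theorem addAngle_apply (k : ℕ) (z : AngleSpace k × ℝ) :
    addAngle k z = (z.1.1, Fin.snoc (α := fun _ => ℝ) z.1.2 z.2) := rfl

theorem addAngle_symm_apply (k : ℕ) (w : AngleSpace (k + 1)) :
    (addAngle k).symm w = ((w.1, fun i => w.2 i.castSucc), w.2 (Fin.last k)) := rfl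

/-- The direction of the last trailer. -/
def lastAngle : (k : ℕ) → AngleSpace k → ℝ
  -- Without angles the reference direction is ∂/∂ξ₁, so the first difference of angles is θ₀
  -- itself.
  | 0, _ => 0
  | k + 1, w => w.2 (Fin.last k)

/-- The vector field `∂/∂θ` of the last angle, or `∂/∂ξ₂` if there are no angles. -/
def turnField : (k : ℕ) → AngleSpace k
  | 0 => ((0, 1), 0)
  | k + 1 => addAngle k (0, 1)

/-- The vector field of the translation in the direction of the last angle. -/
def driveField : (k : ℕ) → AngleSpace k → AngleSpace k
  | 0, _ => ((1, 0), 0)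
  | k + 1, w => addAngle k
      (Real.cos (((addAngle k).symm w).2 - lastAngle k ((addAngle k).symm w).1) •
          driveField k ((addAngle k).symm w).1 +
        Real.sin (((addAngle k).symm w).2 - lastAngle k ((addAngle k).symm w).1) • turnField k, 0)

theorem turnField_succ (k : ℕ) : turnField (k + 1) = addAngle k (0, 1) := rfl

theorem driveField_succ (k : ℕ) (w : AngleSpace (k + 1)) :
    driveField (k + 1) w = addAngle k
      (Real.cos (((addAngle k).symm w).2 - lastAngle k ((addAngle k).symm w).1) •
          driveField k ((addAngle k).symm w).1 +
        Real.sin (((addAngle k).symm w).2 - lastAngle k ((addAngle k).symm w).1) • turnField k, 0) :=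
  rfl

theorem contDiff_lastAngle (k : ℕ) : ContDiff ℝ ∞ (lastAngle k) := by
  cases k with
  | zero => exact contDiff_const
  | succ k => exact (contDiff_apply ℝ ℝ (Fin.last k)).comp contDiff_snd

theorem contDiff_driveField (k : ℕ) : ContDiff ℝ ∞ (driveField k) := by
  induction k with
  | zero => exact contDiff_const
  | succ k ih =>
    have h1 : ContDiff ℝ ∞ fun w : AngleSpace (k + 1) => ((addAngle k).symm w).1 :=
      contDiff_fst.comp (addAngle k).symm.contDiff
    have h2 : ContDiff ℝ ∞ fun w : AngleSpace (k + 1) =>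
        ((addAngle k).symm w).2 - lastAngle k ((addAngle k).symm w).1 :=
      (contDiff_snd.comp (addAngle k).symm.contDiff).sub ((contDiff_lastAngle k).comp h1)
    exact (addAngle k).contDiff.comp (((h2.cos.smul (ih.comp h1)).add
      (h2.sin.smul contDiff_const)).prodMk contDiff_const)

theorem linearIndependent_turn_drive (k : ℕ) (w : AngleSpace k) :
    LinearIndependent ℝ ![turnField k, driveField k w] := by
  rw [LinearIndependent.pair_iff]
  induction k with
  | zero =>
    intro s t h
    have h1 := congrArg (fun u : AngleSpace 0 => u.1) h
    simp only [turnField, driveField, Prod.smul_mk, Prod.mk_add_mk] at h1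
    have h2 := congrArg Prod.fst h1
    have h3 := congrArg Prod.snd h1
    simp at h2 h3
    exact ⟨h3, h2⟩
  | succ k ih =>
    intro s t h
    rw [turnField_succ, driveField_succ, ← map_smul, ← map_smul, ← map_add,
      EmbeddingLike.map_eq_zero_iff] at h
    have h1 := congrArg Prod.fst h
    have h2 := congrArg Prod.snd h
    simp only [Prod.snd_add, Prod.smul_snd, smul_eq_mul, mul_one, mul_zero, add_zero,
      Prod.snd_zero] at h2
    simp only [Prod.fst_add, Prod.smul_fst, smul_zero, zero_add, Prod.fst_zero] at h1
    set α := ((addAngle k).symm w).2 - lastAngle k ((addAngle k).symm w).1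
    have h3 := ih ((addAngle k).symm w).1 (t * Real.sin α) (t * Real.cos α) (by
      rw [← h1]; module)
    refine ⟨h2, ?_⟩
    have h4 := Real.sin_sq_add_cos_sq α
    by_contra ht
    have h5 : Real.sin α = 0 := (mul_eq_zero.1 h3.1).resolve_left ht
    have h6 : Real.cos α = 0 := (mul_eq_zero.1 h3.2).resolve_left ht
    rw [h5, h6] at h4
    norm_num at h4

theorem finrank_angleSpace (k : ℕ) : Module.finrank ℝ (AngleSpace k) = k + 2 := by
  simp [AngleSpace]; ring

end AngleCoordinates

theorem isInvertible_of_injective {E F : Type*} [NormedAddCommGroup E] [NormedSpace ℝ E]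
    [FiniteDimensional ℝ E] [NormedAddCommGroup F] [NormedSpace ℝ F] [FiniteDimensional ℝ F]
    {L : E →L[ℝ] F} (hL : Function.Injective L)
    (h : Module.finrank ℝ E = Module.finrank ℝ F) : L.IsInvertible :=
  ⟨(LinearEquiv.ofInjectiveOfFinrankEq (L : E →ₗ[ℝ] F) hL h).toContinuousLinearEquiv, by
    ext z; rfl⟩

/-- A Goursat frame has angle coordinates in which the distribution spanned by its first two
fields is the trailer system. -/
protected theorem IsGoursatFrame.exists_angle_coordinates (k : ℕ) :
    ∀ {E : Type} [NormedAddCommGroup E]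
    [NormedSpace ℝ E] [FiniteDimensional ℝ E] {X : ℕ → E → E} {q : E},
    Module.finrank ℝ E = k + 2 → IsGoursatFrame (k + 2) X q →
    ∃ Φ : E → AngleSpace k, SmoothNear Φ q ∧ Function.Injective (fderiv ℝ Φ q) ∧
      ∀ᶠ x in 𝓝 q, (flag X 2 x).map (fderiv ℝ Φ x : E →ₗ[ℝ] AngleSpace k) =
        Submodule.span ℝ {turnField k, driveField k (Φ x)} := by
  induction k with
  | zero =>
    intro E _ _ _ X q hE hX
    -- In dimension two both distributions are the full tangent plane, so any linear isomorphism
    -- serves.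
    let e : E ≃L[ℝ] AngleSpace 0 := ContinuousLinearEquiv.ofFinrankEq (by
      rw [hE, finrank_angleSpace])
    have hd : ∀ x, fderiv ℝ e x = (e : E →L[ℝ] AngleSpace 0) := fun x => e.fderiv
    refine ⟨e, e.contDiff.smoothNear q, ?_, ?_⟩
    · rw [hd]; exact e.injective
    · filter_upwards [eventually_flag_eq hE hX] with x hx
      have h1 := (linearIndependent_turn_drive 0 (e x)).span_eq_top_of_card_eq_finrank
        (by rw [finrank_angleSpace]; rfl)
      rw [Matrix.range_cons, Matrix.range_cons, Matrix.range_empty, union_empty,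
        singleton_union] at h1
      rw [hx, h1, hd, Submodule.map_top, LinearMap.range_eq_top]
      exact e.surjective
  | succ k ih =>
    intro E _ _ _ X q hE hX
    obtain ⟨S, hS, G, hG, rfl, hGi, Y, hY, v, hv, hv0, hvY, hflag, hvt⟩ :=
      hX.exists_deprolongation (by omega) hE
    obtain ⟨Φ, hΦ, hΦi, hΦY⟩ := ih hS hY
    obtain ⟨Φ', hΦ', hΦi', hspan⟩ := exists_prolongation (p := (0 : S × ℝ)) hΦ hΦi hv
      (contDiff_driveField k) (contDiff_lastAngle k) (linearIndependent_turn_drive k) hv0 hvt (by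
        filter_upwards [hvY, (continuous_fst.tendsto (0 : S × ℝ)).eventually hΦY] with z hz hz'
        rw [← hz']
        exact Submodule.mem_map_of_mem hz)
    obtain ⟨e, he, h0e, -, -, hes⟩ := hG.exists_openPartialHomeomorph hGi
    have he0 : e 0 = G 0 := by rw [he]
    have hχ : SmoothNear e.symm (G 0) := by
      rw [← he0]
      filter_upwards [e.open_target.mem_nhds (e.map_source h0e)] with y hy using hes y hy
    have hχ0 : e.symm (G 0) = 0 := by rw [← he0]; exact e.left_inv h0e
    have hχt : Tendsto e.symm (𝓝 (G 0)) (𝓝 0) := by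
      have := hχ.continuousAt.tendsto
      rwa [hχ0] at this
    -- Since `e.symm` inverts `G`, the flow box drops out and only the derivative of the prolonged
    -- map remains.
    have hcomp : ∀ᶠ z in 𝓝 (0 : S × ℝ), ∀ u, fderiv ℝ (fun x => addAngle k (Φ' (e.symm x))) (G z)
        (fderiv ℝ G z u) = addAngle k (fderiv ℝ Φ' z u) := by
      filter_upwards [hG, hΦ', e.open_source.mem_nhds h0e] with z hGz hΦz hz u
      have hsymm : ContDiffAt ℝ ∞ e.symm (G z) := by
        have := hes (e z) (e.map_source hz)
        rwa [he] at this
      have hsz : e.symm (G z) = z := by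
        have := e.left_inv hz
        rwa [he] at this
      have h1 : HasFDerivAt (fun z => e.symm (G z)) _ z :=
        (hsymm.differentiableAt (by simp)).hasFDerivAt.comp z
          (hGz.differentiableAt (by simp)).hasFDerivAt
      have h2 : HasFDerivAt (fun z => e.symm (G z)) (ContinuousLinearMap.id ℝ (S × ℝ)) z := by
        refine (hasFDerivAt_id z).congr_of_eventuallyEq ?_
        filter_upwards [e.open_source.mem_nhds hz] with y hy
        have := e.left_inv hy
        rwa [he] at this
      have h3 : fderiv ℝ e.symm (G z) (fderiv ℝ G z u) = u :=
        DFunLike.congr_fun (h1.unique h2) u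
      have h4 : HasFDerivAt Φ' (fderiv ℝ Φ' z) (e.symm (G z)) := by
        rw [hsz]; exact (hΦz.differentiableAt (by simp)).hasFDerivAt
      have h5 : HasFDerivAt (fun x => addAngle k (Φ' (e.symm x))) _ (G z) :=
        (addAngle k).hasFDerivAt.comp (G z)
          (h4.comp (G z) (hsymm.differentiableAt (by simp)).hasFDerivAt)
      rw [h5.fderiv]
      simp only [ContinuousLinearMap.comp_apply, h3]
      rfl
    refine ⟨fun x => addAngle k (Φ' (e.symm x)), ?_, ?_, ?_⟩
    · refine ((addAngle k).contDiff.smoothNear _).comp (SmoothNear.comp ?_ hχ)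
      rwa [hχ0]
    · intro y y' hyy
      obtain ⟨u, rfl⟩ := hGi.surjective y
      obtain ⟨u', rfl⟩ := hGi.surjective y'
      rw [hcomp.self_of_nhds, hcomp.self_of_nhds] at hyy
      rw [hΦi' ((addAngle k).injective hyy)]
    · filter_upwards [hχt.eventually hcomp, hχt.eventually hspan, hχt.eventually hflag,
        e.open_target.mem_nhds (he0 ▸ e.map_source h0e : G 0 ∈ e.target)] with x h1 h2 h3 hx
      have hGx : G (e.symm x) = x := by
        have := e.right_inv hx
        rwa [he] at this
      rw [hGx] at h1 h3
      set z := e.symm x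
      rw [h3, ← Submodule.map_comp]
      have h4 : (fderiv ℝ (fun x => addAngle k (Φ' (e.symm x))) x : E →ₗ[ℝ] AngleSpace (k + 1)) ∘ₗ
          (fderiv ℝ G z : S × ℝ →ₗ[ℝ] E) = ((addAngle k : AngleSpace k × ℝ →L[ℝ] AngleSpace (k + 1)) :
            AngleSpace k × ℝ →ₗ[ℝ] AngleSpace (k + 1)) ∘ₗ
            (fderiv ℝ Φ' z : S × ℝ →ₗ[ℝ] AngleSpace k × ℝ) := LinearMap.ext h1
      rw [h4, Submodule.map_comp, h2, Submodule.map_span, image_pair]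
      simp only [turnField_succ, driveField_succ, ContinuousLinearEquiv.symm_apply_apply]
      rfl

theorem eventually_chartAt_symm {E M : Type*} [TopologicalSpace E] [TopologicalSpace M]
    [ChartedSpace E M] {q : M} {y : E} (hy : y ∈ (chartAt E q).target) {P : M → Prop}
    (h : ∀ᶠ x in 𝓝 ((chartAt E q).symm y), P x) : ∀ᶠ z in 𝓝 y, P ((chartAt E q).symm z) :=
  ((chartAt E q).continuousAt_symm hy).eventually h

/-! ### Vector fields and brackets in a chart -/

section ChartField

variable {E : Type*} [NormedAddCommGroup E] [NormedSpace ℝ E]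
  {M : Type*} [TopologicalSpace M] [ChartedSpace E M] {q : M} {y : E}

/-- The expression of a vector field in the chart at `q`. -/
def chartField (q : M) (V : (x : M) → TangentSpace 𝓘(ℝ, E) x) : E → E :=
  mpullback 𝓘(ℝ, E) 𝓘(ℝ, E) (chartAt E q).symm V

/-- The derivative of the chart at `q`, at the point with coordinates `y`, as an endomorphism of the
model space. -/
def chartInv (M : Type*) [TopologicalSpace M] [ChartedSpace E M] (q : M) (y : E) : E →L[ℝ] E :=
  (mfderiv 𝓘(ℝ, E) 𝓘(ℝ, E) (chartAt E q).symm y).inverse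

theorem map_flag_chartField (X : ℕ → (x : M) → TangentSpace 𝓘(ℝ, E) x) (j : ℕ) (y : E) :
    (flag X j ((chartAt E q).symm y)).map
      (chartInv M q y : E →ₗ[ℝ] E) =
      flag (fun i => chartField q (X i)) j y := by
  refine (Submodule.map_span (chartInv M q y : E →ₗ[ℝ] E)
    (range fun c : Fin j => (X c ((chartAt E q).symm y) : E))).trans ?_
  exact congrArg (Submodule.span ℝ) (range_comp _ _).symm

theorem chartField_mem_flag {X : ℕ → (x : M) → TangentSpace 𝓘(ℝ, E) x} {j : ℕ}
    {V : (x : M) → TangentSpace 𝓘(ℝ, E) x}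
    (h : V ((chartAt E q).symm y) ∈ flag X j ((chartAt E q).symm y)) :
    chartField q V y ∈ flag (fun i => chartField q (X i)) j y := by
  rw [← map_flag_chartField]
  exact Submodule.mem_map_of_mem h

variable [IsManifold 𝓘(ℝ, E) ∞ M]

theorem isManifold_one : IsManifold 𝓘(ℝ, E) 1 M :=
  IsManifold.of_le (n := ∞) (WithTop.coe_le_coe.2 (le_top (a := (1 : ℕ∞))))

theorem isManifold_infty_add_one : IsManifold 𝓘(ℝ, E) (((⊤ : ℕ∞) : ℕ∞ω) + 1) M :=
  IsManifold.of_le (n := ∞) (by simp)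

theorem minSmoothness_two_le : minSmoothness ℝ 2 ≤ ∞ := by
  rw [minSmoothness_of_isRCLikeNormedField]
  exact WithTop.coe_le_coe.2 (le_top (a := (2 : ℕ∞)))

theorem contMDiffAt_chartAt_symm (hy : y ∈ (chartAt E q).target) :
    ContMDiffAt 𝓘(ℝ, E) 𝓘(ℝ, E) ∞ (chartAt E q).symm y :=
  contMDiffOn_chart_symm.contMDiffAt ((chartAt E q).open_target.mem_nhds hy)

theorem isInvertible_mfderiv_chartAt_symm (hy : y ∈ (chartAt E q).target) :
    (mfderiv 𝓘(ℝ, E) 𝓘(ℝ, E) (chartAt E q).symm y).IsInvertible := by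
  have := isManifold_one (E := E) (M := M)
  have h := mdifferentiable_chart (I := 𝓘(ℝ, E)) q
  have h1 := h.symm_comp_deriv ((chartAt E q).map_target hy)
  have h2 := h.comp_symm_deriv hy
  rw [(chartAt E q).right_inv hy] at h1
  exact ContinuousLinearMap.IsInvertible.of_inverse h1 h2

/-- Pulling back by the inverse chart is pushing forward by the chart: the first form suits
brackets, the second the definition of local equivalence. -/
theorem chartField_apply_chartAt {x : M} (hx : x ∈ (chartAt E q).source)
    (V : (x : M) → TangentSpace 𝓘(ℝ, E) x) :
    chartField q V (chartAt E q x) = mfderiv 𝓘(ℝ, E) 𝓘(ℝ, E) (chartAt E q) x (V x) := by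
  have := isManifold_one (E := E) (M := M)
  obtain ⟨y, hy, rfl⟩ : ∃ y ∈ (chartAt E q).target, (chartAt E q).symm y = x :=
    ⟨_, (chartAt E q).map_source hx, (chartAt E q).left_inv hx⟩
  rw [(chartAt E q).right_inv hy]
  have h2 := (mdifferentiable_chart (I := 𝓘(ℝ, E)) q).comp_symm_deriv hy
  have hi := isInvertible_mfderiv_chartAt_symm hy
  obtain ⟨v, hv⟩ := hi.surjective (V ((chartAt E q).symm y))
  have h3 : chartField q V y = v := by
    change (mfderiv 𝓘(ℝ, E) 𝓘(ℝ, E) (chartAt E q).symm y).inverse (V ((chartAt E q).symm y)) = v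
    rw [← hv]
    exact hi.inverse_apply_self v
  rw [h3, ← hv]
  exact (DFunLike.congr_fun h2 v).symm

theorem linearIndependent_chartField (hy : y ∈ (chartAt E q).target)
    {X : ℕ → (x : M) → TangentSpace 𝓘(ℝ, E) x} {j : ℕ} :
    (LinearIndependent ℝ fun c : Fin j => X c ((chartAt E q).symm y)) ↔
      LinearIndependent ℝ fun c : Fin j => chartField q (X c) y := by
  have := LinearMap.linearIndependent_iff (v := fun c : Fin j => X c ((chartAt E q).symm y))
    (chartInv M q y : E →ₗ[ℝ] E)
    (LinearMap.ker_eq_bot.2 (isInvertible_mfderiv_chartAt_symm hy).inverse.injective)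
  exact this.symm

variable [FiniteDimensional ℝ E]

theorem smoothNear_chartField (hy : y ∈ (chartAt E q).target)
    {V : (x : M) → TangentSpace 𝓘(ℝ, E) x}
    (hV : ∀ᶠ x in 𝓝 ((chartAt E q).symm y), SmoothAt 𝓘(ℝ, E) V x) :
    SmoothNear (chartField q V) y := by
  have := isManifold_one (E := E) (M := M)
  filter_upwards [eventually_chartAt_symm hy hV, (chartAt E q).open_target.mem_nhds hy]
    with z hz hzt
  exact contMDiffAt_vectorSpace_iff_contDiffAt.1
    (ContMDiffAt.mpullback_vectorField_preimage hz (contMDiffAt_chartAt_symm hzt)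
      (isInvertible_mfderiv_chartAt_symm hzt) (by simp))

theorem chartField_mlieBracket (hy : y ∈ (chartAt E q).target)
    {V W : (x : M) → TangentSpace 𝓘(ℝ, E) x}
    (hV : SmoothAt 𝓘(ℝ, E) V ((chartAt E q).symm y))
    (hW : SmoothAt 𝓘(ℝ, E) W ((chartAt E q).symm y)) :
    chartField q (mlieBracket 𝓘(ℝ, E) V W) y =
      lieBracket ℝ (chartField q V) (chartField q W) y := by
  have := isManifold_one (E := E) (M := M)
  have : IsManifold 𝓘(ℝ, E) (minSmoothness ℝ 2) M := IsManifold.of_le minSmoothness_two_le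
  have : IsManifold 𝓘(ℝ, E) (minSmoothness ℝ 3) M := IsManifold.of_le (n := ∞) (by
    rw [minSmoothness_of_isRCLikeNormedField]
    exact WithTop.coe_le_coe.2 (le_top (a := (3 : ℕ∞))))
  have h := mpullback_mlieBracket (hV.mdifferentiableAt (by simp))
    (hW.mdifferentiableAt (by simp)) (contMDiffAt_chartAt_symm hy) minSmoothness_two_le
  refine h.trans ?_
  rw [← mlieBracketWithin_univ, mlieBracketWithin_eq_lieBracketWithin]
  exact congrFun (lieBracketWithin_univ (𝕜 := ℝ) (V := chartField q V) (W := chartField q W)) y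

theorem eventually_linearIndependent_manifold {x : M}
    {X : ℕ → (x : M) → TangentSpace 𝓘(ℝ, E) x} {j : ℕ}
    (hX : ∀ i < j, ∀ᶠ z in 𝓝 x, SmoothAt 𝓘(ℝ, E) (X i) z)
    (hx : LinearIndependent ℝ fun c : Fin j => X c x) :
    ∀ᶠ z in 𝓝 x, LinearIndependent ℝ fun c : Fin j => X c z := by
  have hxs := mem_chart_source E x
  have hy := (chartAt E x).map_source hxs
  have hl : (chartAt E x).symm (chartAt E x x) = x := (chartAt E x).left_inv hxs
  have h1 : LinearIndependent ℝ fun c : Fin j => X c ((chartAt E x).symm (chartAt E x x)) := by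
    rw [hl]; exact hx
  have h2 := eventually_linearIndependent_flag (X := fun i => chartField x (X i))
    (fun i hi => smoothNear_chartField hy (by rw [hl]; exact hX i hi))
    ((linearIndependent_chartField hy).1 h1)
  filter_upwards [((chartAt E x).continuousAt hxs).eventually h2,
    (chartAt E x).open_source.mem_nhds hxs] with z hz hzs
  have h3 := (linearIndependent_chartField ((chartAt E x).map_source hzs)).2 hz
  rw [(chartAt E x).left_inv hzs] at h3
  exact h3

theorem mlieBracket_mem_of_mem_flag {x : M} {X : ℕ → (x : M) → TangentSpace 𝓘(ℝ, E) x} {j : ℕ}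
    (hX : ∀ i < j, ∀ᶠ z in 𝓝 x, SmoothAt 𝓘(ℝ, E) (X i) z)
    (hx : LinearIndependent ℝ fun c : Fin j => X c x)
    {V W : (x : M) → TangentSpace 𝓘(ℝ, E) x}
    (hV : ∀ᶠ z in 𝓝 x, SmoothAt 𝓘(ℝ, E) V z) (hVX : ∀ᶠ z in 𝓝 x, V z ∈ flag X j z)
    (hW : ∀ᶠ z in 𝓝 x, SmoothAt 𝓘(ℝ, E) W z) (hWX : ∀ᶠ z in 𝓝 x, W z ∈ flag X j z)
    {G : Submodule ℝ (TangentSpace 𝓘(ℝ, E) x)} (hG : ∀ i < j, X i x ∈ G)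
    (hG' : ∀ a < j, ∀ b < j, mlieBracket 𝓘(ℝ, E) (X a) (X b) x ∈ G) :
    mlieBracket 𝓘(ℝ, E) V W x ∈ G := by
  obtain ⟨q, y, hy, rfl⟩ : ∃ q : M, ∃ y ∈ (chartAt E q).target, (chartAt E q).symm y = x :=
    ⟨x, _, (chartAt E x).map_source (mem_chart_source E x),
      (chartAt E x).left_inv (mem_chart_source E x)⟩
  set A : E →L[ℝ] E := (mfderiv 𝓘(ℝ, E) 𝓘(ℝ, E) (chartAt E q).symm y).inverse with hA
  have hAinj : Function.Injective A := (isInvertible_mfderiv_chartAt_symm hy).inverse.injective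
  let G' : Submodule ℝ E := Submodule.map (A : E →ₗ[ℝ] E) G
  have hmem : ∀ U : (x : M) → TangentSpace 𝓘(ℝ, E) x,
      chartField q U y ∈ G' ↔ U ((chartAt E q).symm y) ∈ G := by
    intro U
    refine ⟨?_, fun h => Submodule.mem_map_of_mem h⟩
    rintro ⟨u, hu, hu'⟩
    have : u = U ((chartAt E q).symm y) := hAinj hu'
    rwa [← this]
  rw [← hmem, chartField_mlieBracket hy hV.self_of_nhds hW.self_of_nhds]
  refine lieBracket_mem_of_mem_flag (X := fun i => chartField q (X i)) (j := j)
    (fun i hi => smoothNear_chartField hy (hX i hi)) ((linearIndependent_chartField hy).1 hx)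
    (smoothNear_chartField hy hV)
    ((eventually_chartAt_symm hy hVX).mono fun z hz => chartField_mem_flag hz)
    (smoothNear_chartField hy hW)
    ((eventually_chartAt_symm hy hWX).mono fun z hz => chartField_mem_flag hz)
    (fun i hi => (hmem _).2 (hG i hi)) fun a ha b hb => ?_
  rw [← chartField_mlieBracket hy (hX a ha).self_of_nhds (hX b hb).self_of_nhds]
  exact (hmem _).2 (hG' a ha b hb)

end ChartField

/-! ### From the derived flag to a Goursat frame -/

section DerivedFlag

variable {E : Type*} [NormedAddCommGroup E] [NormedSpace ℝ E]
  {M : Type*} [TopologicalSpace M] [ChartedSpace E M] [IsManifold 𝓘(ℝ, E) ∞ M]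
  {D : (p : M) → Submodule ℝ (TangentSpace 𝓘(ℝ, E) p)}

theorem derivedSections_mono (p : M) : Monotone (derivedSections 𝓘(ℝ, E) D p) :=
  monotone_nat_of_le_succ fun _ => le_sup_left

theorem mlieBracket_mem_derivedSections {p : M} {i : ℕ}
    {V W : (x : M) → TangentSpace 𝓘(ℝ, E) x} (hV : V ∈ derivedSections 𝓘(ℝ, E) D p i)
    (hW : W ∈ derivedSections 𝓘(ℝ, E) D p i) :
    mlieBracket 𝓘(ℝ, E) V W ∈ derivedSections 𝓘(ℝ, E) D p (i + 1) :=
  Submodule.mem_sup_right (Submodule.subset_span ⟨V, hV, W, hW, rfl⟩)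

/-- An induction principle for the members of the derived flag. -/
theorem derivedSections_induction {p : M} {P : ((x : M) → TangentSpace 𝓘(ℝ, E) x) → Prop} {i : ℕ}
    {V : (x : M) → TangentSpace 𝓘(ℝ, E) x} (hV : V ∈ derivedSections 𝓘(ℝ, E) D p (i + 1))
    (h0 : P 0) (hadd : ∀ V W, P V → P W → P (V + W)) (hsmul : ∀ (c : ℝ) V, P V → P (c • V))
    (hmem : ∀ V ∈ derivedSections 𝓘(ℝ, E) D p i, P V)
    (hbr : ∀ V ∈ derivedSections 𝓘(ℝ, E) D p i, ∀ W ∈ derivedSections 𝓘(ℝ, E) D p i,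
      P (mlieBracket 𝓘(ℝ, E) V W)) : P V := by
  let N : Submodule ℝ ((x : M) → TangentSpace 𝓘(ℝ, E) x) :=
    { carrier := {V | P V}
      zero_mem' := h0
      add_mem' := fun {V W} hV hW => hadd V W hV hW
      smul_mem' := fun c V hV => hsmul c V hV }
  have : derivedSections 𝓘(ℝ, E) D p (i + 1) ≤ N := by
    refine sup_le hmem (Submodule.span_le.2 ?_)
    rintro _ ⟨V, hV, W, hW, rfl⟩
    exact hbr V hV W hW
  exact this hV

/-- Membership depends on germs only, and each element is built by finitely many operations, so it
persists at nearby points. -/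
theorem eventually_mem_derivedSections {p : M} {i : ℕ} :
    ∀ {V : (x : M) → TangentSpace 𝓘(ℝ, E) x}, V ∈ derivedSections 𝓘(ℝ, E) D p i →
      ∀ᶠ x in 𝓝 p, V ∈ derivedSections 𝓘(ℝ, E) D x i := by
  induction i with
  | zero =>
    intro V hV
    have : ∀ᶠ x in 𝓝 p, SmoothAt 𝓘(ℝ, E) V x ∧ V x ∈ D x := hV
    exact this.eventually_nhds
  | succ i ih =>
    intro V hV
    refine derivedSections_induction
      (P := fun V => ∀ᶠ x in 𝓝 p, V ∈ derivedSections 𝓘(ℝ, E) D x (i + 1)) hV ?_ ?_ ?_ ?_ ?_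
    · exact Eventually.of_forall fun x => Submodule.zero_mem _
    · intro V W hV hW
      filter_upwards [hV, hW] with x h1 h2 using Submodule.add_mem _ h1 h2
    · intro c V hV
      filter_upwards [hV] with x h1 using Submodule.smul_mem _ _ h1
    · intro V hV
      filter_upwards [ih hV] with x hx using derivedSections_mono x (Nat.le_succ i) hx
    · intro V hV W hW
      filter_upwards [ih hV, ih hW] with x h1 h2 using mlieBracket_mem_derivedSections h1 h2

theorem mem_derivedFlag {p : M} {i : ℕ} {V : (x : M) → TangentSpace 𝓘(ℝ, E) x}
    (hV : V ∈ derivedSections 𝓘(ℝ, E) D p i) : V p ∈ derivedFlag 𝓘(ℝ, E) D i p :=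
  Submodule.mem_map_of_mem hV

theorem derivedFlag_zero {k : ℕ} (hD : IsDistribution 𝓘(ℝ, E) k D) (p : M) :
    derivedFlag 𝓘(ℝ, E) D 0 p = D p := by
  refine le_antisymm ?_ ?_
  · rintro _ ⟨V, hV, rfl⟩
    have : ∀ᶠ x in 𝓝 p, SmoothAt 𝓘(ℝ, E) V x ∧ V x ∈ D x := hV
    exact this.self_of_nhds.2
  · obtain ⟨U, hU, hpU, f, hf⟩ := hD p
    rw [← (hf p hpU).2.2, Submodule.span_le]
    rintro _ ⟨i, rfl⟩
    refine mem_derivedFlag (V := f i) ?_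
    change ∀ᶠ x in 𝓝 p, SmoothAt 𝓘(ℝ, E) (f i) x ∧ f i x ∈ D x
    filter_upwards [hU.mem_nhds hpU] with x hx
    refine ⟨(hf x hx).1 i, ?_⟩
    rw [← (hf x hx).2.2]
    exact Submodule.subset_span ⟨i, rfl⟩

variable [FiniteDimensional ℝ E]

theorem smoothAt_of_mem_derivedSections {p : M} {i : ℕ} :
    ∀ {V : (x : M) → TangentSpace 𝓘(ℝ, E) x}, V ∈ derivedSections 𝓘(ℝ, E) D p i →
      SmoothAt 𝓘(ℝ, E) V p := by
  have := isManifold_one (E := E) (M := M)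
  induction i with
  | zero =>
    intro V hV
    have : ∀ᶠ x in 𝓝 p, SmoothAt 𝓘(ℝ, E) V x ∧ V x ∈ D x := hV
    exact this.self_of_nhds.1
  | succ i ih =>
    intro V hV
    refine derivedSections_induction (P := fun V => SmoothAt 𝓘(ℝ, E) V p) hV ?_ ?_ ?_ ?_ ?_
    · exact Bundle.contMDiff_zeroSection ℝ (TangentSpace 𝓘(ℝ, E) : M → Type _) p
    · exact fun V W hV hW => ContMDiffAt.add_section hV hW
    · exact fun c V hV => ContMDiffAt.const_smul_section hV
    · exact fun V hV => ih hV
    · intro V hV W hW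
      have := isManifold_infty_add_one (E := E) (M := M)
      have : IsManifold 𝓘(ℝ, E) (minSmoothness ℝ 2) M := IsManifold.of_le minSmoothness_two_le
      exact ContMDiffAt.mlieBracket_vectorField (m := ⊤) (n := ⊤) (ih hV) (ih hW) (by
        rw [minSmoothness_of_isRCLikeNormedField]; simp)

theorem eventually_smoothAt_of_mem_derivedSections {p : M} {i : ℕ}
    {V : (x : M) → TangentSpace 𝓘(ℝ, E) x} (hV : V ∈ derivedSections 𝓘(ℝ, E) D p i) :
    ∀ᶠ x in 𝓝 p, SmoothAt 𝓘(ℝ, E) V x :=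
  (eventually_mem_derivedSections hV).mono fun _ h => smoothAt_of_mem_derivedSections h

/-- Independence spreads to nearby points, and there the constant dimension turns the inclusion into
an equality. The truncated `j - 1` places both `X 0` and `X 1` in D⁽⁰⁾. -/
theorem eventually_flag_eq_derivedFlag {p : M} {i : ℕ}
    {X : ℕ → (x : M) → TangentSpace 𝓘(ℝ, E) x}
    (hX : ∀ j < i + 2, X j ∈ derivedSections 𝓘(ℝ, E) D p (j - 1))
    (hp : LinearIndependent ℝ fun c : Fin (i + 2) => X c p)
    (hD : ∀ x, Module.finrank ℝ (derivedFlag 𝓘(ℝ, E) D i x) = i + 2) :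
    ∀ᶠ x in 𝓝 p, flag X (i + 2) x = derivedFlag 𝓘(ℝ, E) D i x := by
  filter_upwards [eventually_linearIndependent_manifold
      (fun j hj => eventually_smoothAt_of_mem_derivedSections (hX j hj)) hp,
    eventually_forall_lt fun j hj => eventually_mem_derivedSections (hX j hj)] with x h1 h2
  have : FiniteDimensional ℝ (TangentSpace 𝓘(ℝ, E) x) := inferInstanceAs (FiniteDimensional ℝ E)
  refine Submodule.eq_of_le_of_finrank_eq (flag_le.2 fun j hj => ?_) ?_
  · exact mem_derivedFlag (derivedSections_mono x (by omega) (h2 j hj))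
  · rw [hD, finrank_flag h1]

/-- Near every point the derived flag has a frame made of iterated brackets. -/
theorem exists_derived_frame {m : ℕ} (hD0 : IsDistribution 𝓘(ℝ, E) 2 D)
    (hD : ∀ i, i + 2 ≤ m → ∀ x, Module.finrank ℝ (derivedFlag 𝓘(ℝ, E) D i x) = i + 2)
    (p : M) {j : ℕ} (h2 : 2 ≤ j) (hj : j ≤ m) :
    ∃ X : ℕ → (x : M) → TangentSpace 𝓘(ℝ, E) x,
      (∀ i < j, X i ∈ derivedSections 𝓘(ℝ, E) D p (i - 1)) ∧
      (LinearIndependent ℝ fun c : Fin j => X c p) ∧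
      ∀ i, 2 ≤ i → i < j → ∃ a < i, ∃ b < i, X i = mlieBracket 𝓘(ℝ, E) (X a) (X b) := by
  induction j, h2 using Nat.le_induction with
  | base =>
    obtain ⟨U, hU, hpU, f, hf⟩ := hD0 p
    let X : ℕ → (x : M) → TangentSpace 𝓘(ℝ, E) x := fun i => if h : i < 2 then f ⟨i, h⟩ else 0
    have hXf : ∀ i : Fin 2, X i = f i := fun i => by simp only [X, i.2, dif_pos]
    refine ⟨X, fun i hi => ?_, ?_, fun i h2 hi => by omega⟩
    · have : i - 1 = 0 := by omega
      rw [this, show X i = f ⟨i, hi⟩ from hXf ⟨i, hi⟩]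
      change ∀ᶠ x in 𝓝 p, SmoothAt 𝓘(ℝ, E) (f ⟨i, hi⟩) x ∧ f ⟨i, hi⟩ x ∈ D x
      filter_upwards [hU.mem_nhds hpU] with x hx
      refine ⟨(hf x hx).1 _, ?_⟩
      rw [← (hf x hx).2.2]
      exact Submodule.subset_span ⟨⟨i, hi⟩, rfl⟩
    · have : (fun c : Fin 2 => X c p) = fun i => f i p := by
        funext c; rw [hXf]
      rw [this]
      exact (hf p hpU).2.1
  | succ j h2 ih =>
    obtain ⟨X, hX, hXp, hXb⟩ := ih (by omega)
    obtain ⟨i, rfl⟩ : ∃ i, j = i + 2 := ⟨j - 2, by omega⟩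
    have hflag := eventually_flag_eq_derivedFlag hX hXp (hD i (by omega))
    have hXs := fun j hj => eventually_smoothAt_of_mem_derivedSections (hX j hj)
    have hmem : ∀ V ∈ derivedSections 𝓘(ℝ, E) D p i, ∀ᶠ x in 𝓝 p, V x ∈ flag X (i + 2) x := by
      intro V hV
      filter_upwards [hflag, eventually_mem_derivedSections hV] with x h1 h3
      rw [h1]; exact mem_derivedFlag h3
    obtain ⟨a, ha, b, hb, hab⟩ : ∃ a < i + 2, ∃ b < i + 2,
        mlieBracket 𝓘(ℝ, E) (X a) (X b) p ∉ flag X (i + 2) p := by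
      -- If no bracket of the frame left its span at p, then D⁽ⁱ⁺¹⁾(p) would still have dimension at
      -- most i + 2.
      by_contra! hcon
      have hle : derivedFlag 𝓘(ℝ, E) D (i + 1) p ≤ flag X (i + 2) p := by
        rintro _ ⟨V, hV, rfl⟩
        change V p ∈ flag X (i + 2) p
        refine derivedSections_induction (P := fun V => V p ∈ flag X (i + 2) p) hV
          (Submodule.zero_mem _) (fun V W h1 h2 => Submodule.add_mem _ h1 h2)
          (fun c V h1 => Submodule.smul_mem _ _ h1) (fun V hV => (hmem V hV).self_of_nhds) ?_
        intro V hV W hW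
        exact mlieBracket_mem_of_mem_flag hXs hXp (eventually_smoothAt_of_mem_derivedSections hV)
          (hmem V hV) (eventually_smoothAt_of_mem_derivedSections hW) (hmem W hW)
          (fun i hi => mem_flag X hi p) hcon
      have : FiniteDimensional ℝ (TangentSpace 𝓘(ℝ, E) p) :=
        inferInstanceAs (FiniteDimensional ℝ E)
      have := Submodule.finrank_mono hle
      rw [hD (i + 1) (by omega), finrank_flag hXp] at this
      omega
    let X' : ℕ → (x : M) → TangentSpace 𝓘(ℝ, E) x :=
      Function.update X (i + 2) (mlieBracket 𝓘(ℝ, E) (X a) (X b))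
    have hX' : ∀ c < i + 2, X' c = X c := fun c hc => Function.update_of_ne hc.ne _ _
    have hXi : X' (i + 2) = mlieBracket 𝓘(ℝ, E) (X a) (X b) := Function.update_self _ _ _
    refine ⟨X', fun c hc => ?_, ?_, fun c hc2 hc => ?_⟩
    · rcases (Nat.lt_succ_iff.1 hc).eq_or_lt with rfl | hc
      · rw [hXi]
        exact mlieBracket_mem_derivedSections (derivedSections_mono p (by omega) (hX a ha))
          (derivedSections_mono p (by omega) (hX b hb))
      · rw [hX' c hc]; exact hX c hc
    · refine linearIndependent_flag_succ.2 ⟨?_, ?_⟩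
      · have : (fun c : Fin (i + 2) => X' c p) = fun c : Fin (i + 2) => X c p := by
          funext c; rw [hX' c c.2]
        rw [this]; exact hXp
      · rw [hXi, flag_congr (Y := X) fun c hc => by rw [hX' c hc]]
        exact hab
    · rcases (Nat.lt_succ_iff.1 hc).eq_or_lt with rfl | hc
      · exact ⟨a, ha, b, hb, by rw [hXi, hX' a ha, hX' b hb]⟩
      · obtain ⟨a, ha, b, hb, h⟩ := hXb c hc2 hc
        exact ⟨a, ha, b, hb, by rw [hX' c hc, hX' a (ha.trans hc), hX' b (hb.trans hc), h]⟩

/-- The chart carries a frame of iterated brackets to the model space. Brackets of the first i + 2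
fields lie in D⁽ⁱ⁺¹⁾, which near q is the span of the first i + 3. -/
protected theorem IsGoursatStructure.exists_goursatFrame (hD : IsGoursatStructure 𝓘(ℝ, E) D)
    (q : M) :
    ∃ X : ℕ → E → E, IsGoursatFrame (Module.finrank ℝ E) X (chartAt E q q) ∧
      ∀ᶠ x in 𝓝 q, (D x).map (mfderiv 𝓘(ℝ, E) 𝓘(ℝ, E) (chartAt E q) x).toLinearMap =
        flag X 2 (chartAt E q x) := by
  obtain ⟨h3, hD0, hDi⟩ := hD
  obtain ⟨X, hX, hXq, hXb⟩ := exists_derived_frame hD0 hDi q (by omega) le_rfl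
  set m := Module.finrank ℝ E
  have hqs := mem_chart_source E q
  have hy := (chartAt E q).map_source hqs
  have hl : (chartAt E q).symm (chartAt E q q) = q := (chartAt E q).left_inv hqs
  have hflag : ∀ i, i + 2 ≤ m → ∀ᶠ x in 𝓝 q, flag X (i + 2) x = derivedFlag 𝓘(ℝ, E) D i x :=
    fun i hi => eventually_flag_eq_derivedFlag (fun j hj => hX j (by omega))
      (linearIndependent_of_le hi hXq) (hDi i hi)
  have hsm : ∀ i < m, ∀ᶠ x in 𝓝 ((chartAt E q).symm (chartAt E q q)),
      SmoothAt 𝓘(ℝ, E) (X i) x := fun i hi => by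
    rw [hl]; exact eventually_smoothAt_of_mem_derivedSections (hX i hi)
  have hbr : ∀ a < m, ∀ b < m, ∀ᶠ z in 𝓝 (chartAt E q q),
      chartField q (mlieBracket 𝓘(ℝ, E) (X a) (X b)) z =
        lieBracket ℝ (chartField q (X a)) (chartField q (X b)) z := by
    intro a ha b hb
    filter_upwards [eventually_chartAt_symm hy (hsm a ha), eventually_chartAt_symm hy (hsm b hb),
      (chartAt E q).open_target.mem_nhds hy] with z h1 h2 hz
    exact chartField_mlieBracket hz h1 h2
  refine ⟨fun i => chartField q (X i), ⟨fun i hi => smoothNear_chartField hy (hsm i hi), ?_, ?_,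
    ?_⟩, ?_⟩
  · refine (linearIndependent_chartField hy).1 ?_
    rw [hl]; exact hXq
  · intro j h2 hj
    obtain ⟨a, ha, b, hb, hab⟩ := hXb j h2 hj
    refine ⟨a, ha, b, hb, ?_⟩
    filter_upwards [hbr a (by omega) b (by omega)] with z hz
    rw [hab, hz]
  · intro j h2 hj a ha b hb
    obtain ⟨i, rfl⟩ : ∃ i, j = i + 2 := ⟨j - 2, by omega⟩
    have h4 : mlieBracket 𝓘(ℝ, E) (X a) (X b) ∈ derivedSections 𝓘(ℝ, E) D q (i + 1) :=
      mlieBracket_mem_derivedSections (derivedSections_mono q (by omega) (hX a (by omega)))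
        (derivedSections_mono q (by omega) (hX b (by omega)))
    have h5 : ∀ᶠ x in 𝓝 ((chartAt E q).symm (chartAt E q q)),
        mlieBracket 𝓘(ℝ, E) (X a) (X b) x ∈ flag X (i + 3) x := by
      rw [hl]
      filter_upwards [hflag (i + 1) (by omega), eventually_mem_derivedSections h4] with x h6 h7
      rw [h6]; exact mem_derivedFlag h7
    filter_upwards [hbr a (by omega) b (by omega), eventually_chartAt_symm hy h5] with z h6 h7
    rw [← h6]
    exact chartField_mem_flag h7
  · filter_upwards [hflag 0 (by omega), (chartAt E q).open_source.mem_nhds hqs] with x hx hxs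
    rw [← derivedFlag_zero hD0 x, ← hx, flag, flag, Submodule.map_span, ← range_comp]
    congr 2
    funext i
    exact (chartField_apply_chartAt hxs (X i)).symm

end DerivedFlag

/-! ### Smooth maps into finite products -/

section PiManifold

variable {ι : Type*} [Fintype ι] {E' : ι → Type*} [∀ i, NormedAddCommGroup (E' i)]
  [∀ i, NormedSpace ℝ (E' i)] {H' : ι → Type*} [∀ i, TopologicalSpace (H' i)]
  {J : ∀ i, ModelWithCorners ℝ (E' i) (H' i)} {N : ι → Type*} [∀ i, TopologicalSpace (N i)]
  [∀ i, ChartedSpace (H' i) (N i)]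
  {E : Type*} [NormedAddCommGroup E] [NormedSpace ℝ E] {H : Type*} [TopologicalSpace H]
  {I : ModelWithCorners ℝ E H} {M : Type*} [TopologicalSpace M] [ChartedSpace H M]

theorem contMDiffAt_pi_iff {m : ℕ∞ω} {f : M → ∀ i, N i} {x : M} :
    ContMDiffAt I (ModelWithCorners.pi J) m f x ↔
      ∀ i, ContMDiffAt I (J i) m (fun y => f y i) x := by
  simp only [contMDiffAt_iff, forall_and]
  refine and_congr continuousAt_pi ?_
  exact contDiffWithinAt_pi

theorem contMDiff_pi_apply {m : ℕ∞ω} (i : ι) :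
    ContMDiff (ModelWithCorners.pi J) (J i) m fun y : ∀ i, N i => y i :=
  fun _ => contMDiffAt_pi_iff.1 contMDiffAt_id i

end PiManifold

/-! ### Angle coordinates on the configuration space -/

section AngleExp

/-- The angle coordinates on the circle around the point of angle `θ`. -/
def circleAngle (θ : ℝ) : OpenPartialHomeomorph ℝ Circle where
  toFun := Circle.exp
  invFun z := θ + Complex.arg (z * Circle.exp (-θ) : Circle)
  source := Ioo (θ - Real.pi) (θ + Real.pi)
  -- Rotating by -θ puts the branch cut of `arg` opposite the point of angle θ.
  target := {z | ((z * Circle.exp (-θ) : Circle) : ℂ) ∈ Complex.slitPlane}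
  map_source' := by
    intro x hx
    change ((Circle.exp x * Circle.exp (-θ) : Circle) : ℂ) ∈ Complex.slitPlane
    rw [← Circle.exp_add, Complex.mem_slitPlane_iff_arg,
      Circle.arg_exp (by linarith [hx.1]) (by linarith [hx.2])]
    exact ⟨by linarith [hx.2], Circle.coe_ne_zero _⟩
  map_target' := by
    intro z hz
    have h1 := (Complex.mem_slitPlane_iff_arg.1 hz).1
    have h2 := (Complex.arg_mem_Ioc ((z * Circle.exp (-θ) : Circle) : ℂ))
    have h3 := lt_of_le_of_ne h2.2 h1
    exact ⟨by linarith [h2.1], by linarith⟩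
  left_inv' := by
    intro x hx
    rw [← Circle.exp_add, Circle.arg_exp (by linarith [hx.1]) (by linarith [hx.2])]
    ring
  right_inv' := by
    intro z hz
    rw [Circle.exp_add, Circle.exp_arg, Circle.exp_neg]
    simp
  open_source := isOpen_Ioo
  open_target := Complex.isOpen_slitPlane.preimage (by fun_prop)
  continuousOn_toFun := Circle.exp.continuous.continuousOn
  continuousOn_invFun := by
    intro z hz
    refine ContinuousAt.continuousWithinAt ?_
    refine continuousAt_const.add ?_
    exact ContinuousAt.comp (f := fun z : Circle => ((z * Circle.exp (-θ) : Circle) : ℂ))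
      (Complex.continuousAt_arg hz) (by fun_prop)

theorem mem_circleAngle_source (θ : ℝ) : θ ∈ (circleAngle θ).source :=
  ⟨by linarith [Real.pi_pos], by linarith [Real.pi_pos]⟩

theorem contMDiff_circle_coe : ContMDiff (𝓡 1) 𝓘(ℝ, ℂ) ∞ fun z : Circle => (z : ℂ) := by
  have := Fact.mk (Complex.finrank_real_complex)
  have : Fact (Module.finrank ℝ ℂ = 1 + 1) := this
  exact contMDiff_coe_sphere

theorem contMDiffAt_circleAngle_symm {θ : ℝ} {z : Circle} (hz : z ∈ (circleAngle θ).target) :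
    ContMDiffAt (𝓡 1) 𝓘(ℝ, ℝ) ∞ (circleAngle θ).symm z := by
  have h1 : ContMDiff (𝓡 1) 𝓘(ℝ, ℂ) ∞ fun z : Circle => (z : ℂ) * (Circle.exp (-θ) : ℂ) :=
    (contDiff_id.mul contDiff_const).contMDiff.comp contMDiff_circle_coe
  have h2 : ContDiffAt ℝ ∞ (fun u : ℂ => θ + (Complex.log u).im)
      ((z : ℂ) * (Circle.exp (-θ) : ℂ)) := by
    refine contDiffAt_const.add ?_
    exact Complex.imCLM.contDiff.contDiffAt.comp _
      ((Complex.contDiffAt_log (n := ∞) hz).restrict_scalars ℝ)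
  have h3 := ContMDiffAt.comp (f := fun z : Circle => (z : ℂ) * (Circle.exp (-θ) : ℂ)) z
    h2.contMDiffAt (h1 z)
  refine h3.congr_of_eventuallyEq (Eventually.of_forall fun y => ?_)
  exact congrArg (θ + ·) (Complex.log_im _).symm

variable (n : ℕ)

/-- The map sending the coordinates `(ξ₁, ξ₂, θ₀, …, θₙ)` to the corresponding configuration. -/
def angleExp (w : AngleSpace (n + 1)) : Config n := (w.1, fun i => Circle.exp (w.2 i))

theorem contMDiff_angleExp :
    ContMDiff 𝓘(ℝ, AngleSpace (n + 1)) (configModel n) ∞ (angleExp n) := by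
  intro w
  refine ContMDiffAt.prodMk contDiffAt_fst.contMDiffAt ?_
  refine contMDiffAt_pi_iff.2 fun i => ?_
  refine contMDiff_circleExp.contMDiffAt.comp w ?_
  exact ((contDiff_apply ℝ ℝ i).comp contDiff_snd).contDiffAt.contMDiffAt

/-- The map `angleExp` as a homeomorphism from a neighbourhood of `w` to its image. -/
def angleExpAt (w : AngleSpace (n + 1)) : OpenPartialHomeomorph (AngleSpace (n + 1)) (Config n) :=
  (OpenPartialHomeomorph.refl (ℝ × ℝ)).prod (OpenPartialHomeomorph.pi fun i => circleAngle (w.2 i))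

theorem mem_angleExpAt_source (w : AngleSpace (n + 1)) : w ∈ (angleExpAt n w).source :=
  ⟨mem_univ _, fun _ _ => mem_circleAngle_source _⟩

theorem contMDiffAt_angleExpAt_symm {w : AngleSpace (n + 1)} {p : Config n}
    (hp : p ∈ (angleExpAt n w).target) :
    ContMDiffAt (configModel n) 𝓘(ℝ, AngleSpace (n + 1)) ∞ (angleExpAt n w).symm p := by
  refine ContMDiffAt.prodMk_space contMDiffAt_fst ?_
  refine contMDiffAt_pi_space.2 fun i => ?_
  have h1 : ContMDiffAt (configModel n) (𝓡 1) ∞ (fun p : Config n => p.2 i) p :=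
    (contMDiff_pi_apply i).contMDiffAt.comp p contMDiffAt_snd
  exact ContMDiffAt.comp (f := fun p : Config n => p.2 i) p
    (contMDiffAt_circleAngle_symm (hp.2 i (mem_univ i))) h1

variable {n}

/-- The coordinate fields on the configuration space are velocities of curves. The chain rule
identifies them with images of constant vectors. -/
theorem mfderiv_angleExp_apply {c : ℝ → AngleSpace (n + 1)} {v : AngleSpace (n + 1)}
    {w : AngleSpace (n + 1)} (hc : HasDerivAt c v 0) (hw : c 0 = w)
    {g : ℝ → Config n} (hg : ∀ t, g t = angleExp n (c t)) :
    (mfderiv 𝓘(ℝ, ℝ) (configModel n) g 0 (1 : ℝ) :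
        (ℝ × ℝ) × (Fin (n + 1) → EuclideanSpace ℝ (Fin 1))) =
      mfderiv 𝓘(ℝ, AngleSpace (n + 1)) (configModel n) (angleExp n) w v := by
  subst hw
  obtain rfl : g = angleExp n ∘ c := funext hg
  have h1 := ((contMDiff_angleExp n).contMDiffAt (x := c 0)).mdifferentiableAt (by simp)
  have h2 := h1.hasMFDerivAt.comp 0 hc.hasFDerivAt.hasMFDerivAt
  rw [h2.mfderiv]
  change mfderiv 𝓘(ℝ, AngleSpace (n + 1)) (configModel n) (angleExp n) (c 0) ((1 : ℝ) • v) = _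
  rw [one_smul]

theorem dXi₁_angleExp (w : AngleSpace (n + 1)) :
    dXi₁ (angleExp n w) =
      mfderiv 𝓘(ℝ, AngleSpace (n + 1)) (configModel n) (angleExp n) w ((1, 0), 0) := by
  have hc : HasDerivAt (fun t : ℝ => (((w.1.1 + t, w.1.2), w.2) : AngleSpace (n + 1)))
      ((1, 0), 0) 0 :=
    (((hasDerivAt_id (0 : ℝ)).const_add w.1.1).prodMk (hasDerivAt_const _ _)).prodMk
      (hasDerivAt_const _ _)
  have h := mfderiv_angleExp_apply (w := w) hc (by simp)
    (g := fun t => ((w.1.1 + t, w.1.2), (angleExp n w).2)) fun t => rfl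
  exact h

theorem dXi₂_angleExp (w : AngleSpace (n + 1)) :
    dXi₂ (angleExp n w) =
      mfderiv 𝓘(ℝ, AngleSpace (n + 1)) (configModel n) (angleExp n) w ((0, 1), 0) := by
  have hc : HasDerivAt (fun t : ℝ => (((w.1.1, w.1.2 + t), w.2) : AngleSpace (n + 1)))
      ((0, 1), 0) 0 :=
    ((hasDerivAt_const _ _).prodMk ((hasDerivAt_id (0 : ℝ)).const_add w.1.2)).prodMk
      (hasDerivAt_const _ _)
  have h := mfderiv_angleExp_apply (w := w) hc (by simp)
    (g := fun t => ((w.1.1, w.1.2 + t), (angleExp n w).2)) fun t => rfl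
  exact h

theorem dTheta_angleExp (i : Fin (n + 1)) (w : AngleSpace (n + 1)) :
    dTheta i (angleExp n w) =
      mfderiv 𝓘(ℝ, AngleSpace (n + 1)) (configModel n) (angleExp n) w (0, Pi.single i 1) := by
  have hc : HasDerivAt (fun t : ℝ => ((w.1, w.2 + t • Pi.single i 1) : AngleSpace (n + 1)))
      (0, Pi.single i 1) 0 := by
    refine (hasDerivAt_const _ _).prodMk ?_
    simpa using ((hasDerivAt_id (0 : ℝ)).smul_const (Pi.single i (1 : ℝ))).const_add w.2
  have h := mfderiv_angleExp_apply (w := w) hc (by simp) (g := fun t => ((angleExp n w).1,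
      Function.update (angleExp n w).2 i (Circle.exp t * (angleExp n w).2 i))) fun t => by
    refine Prod.ext rfl (funext fun j => ?_)
    rcases eq_or_ne j i with rfl | hj
    · simp [angleExp, Circle.exp_add, mul_comm]
    · simp [angleExp, hj]
  exact h

theorem re_circleExp (t : ℝ) : ((Circle.exp t : Circle) : ℂ).re = Real.cos t := by
  rw [Circle.coe_exp, Complex.exp_ofReal_mul_I_re]

theorem im_circleExp (t : ℝ) : ((Circle.exp t : Circle) : ℂ).im = Real.sin t := by
  rw [Circle.coe_exp, Complex.exp_ofReal_mul_I_im]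

theorem cosDiff_angleExp (w : AngleSpace (n + 1)) (i : Fin n) :
    cosDiff (angleExp n w) i = Real.cos (w.2 i.succ - w.2 i.castSucc) := by
  rw [cosDiff, angleExp, ← Circle.exp_sub, re_circleExp]

theorem sinDiff_angleExp (w : AngleSpace (n + 1)) (i : Fin n) :
    sinDiff (angleExp n w) i = Real.sin (w.2 i.succ - w.2 i.castSucc) := by
  rw [sinDiff, angleExp, ← Circle.exp_sub, im_circleExp]

theorem piCoeff_last (p : Config n) : piCoeff p (Fin.last n) = 1 := by
  refine Finset.prod_eq_one fun j hj => ?_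
  have := (Finset.mem_filter.1 hj).2
  exact absurd this (not_le.2 (Fin.castSucc_lt_last j))

/-- A new trailer multiplies every earlier πᵢ by the cosine of the new difference of angles. This is
the recursion that turns `driveField` into the product formula. -/
theorem piCoeff_angleExp_castSucc (w : AngleSpace (n + 2)) (i : Fin (n + 1)) :
    piCoeff (angleExp (n + 1) w) i.castSucc =
      Real.cos (w.2 (Fin.last (n + 1)) - w.2 (Fin.last n).castSucc) *
        piCoeff (angleExp n ((addAngle (n + 1)).symm w).1) i := by
  simp only [piCoeff, Finset.prod_filter, Fin.prod_univ_castSucc, cosDiff_angleExp]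
  rw [if_pos (Fin.castSucc_le_castSucc_iff.2 (Fin.le_last i)), mul_comm, Fin.succ_last]
  rfl

/-- Once there is an angle, the turning field has no ξ-component, so each further trailer only
contributes a cosine. -/
theorem driveField_fst (w : AngleSpace (n + 1)) : (driveField (n + 1) w).1 =
    (piCoeff (angleExp n w) 0 * Real.cos (w.2 0), piCoeff (angleExp n w) 0 * Real.sin (w.2 0)) := by
  induction n with
  | zero =>
    have : piCoeff (angleExp 0 w) 0 = 1 := piCoeff_last _
    rw [driveField_succ, addAngle_apply, this]
    simp [driveField, turnField, lastAngle, addAngle_symm_apply]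
  | succ n ih =>
    rw [driveField_succ, addAngle_apply]
    have := piCoeff_angleExp_castSucc w 0
    rw [Fin.castSucc_zero] at this
    simp only [Prod.fst_add, Prod.smul_fst, ih, this, turnField_succ, addAngle_apply]
    simp [addAngle_symm_apply, lastAngle, mul_assoc]

theorem driveField_snd_last (w : AngleSpace (n + 1)) :
    (driveField (n + 1) w).2 (Fin.last n) = 0 := by
  rw [driveField_succ, addAngle_apply]
  simp

theorem driveField_snd_castSucc (w : AngleSpace (n + 1)) (i : Fin n) :
    (driveField (n + 1) w).2 i.castSucc =
      piCoeff (angleExp n w) i.succ * Real.sin (w.2 i.succ - w.2 i.castSucc) := by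
  induction n with
  | zero => exact i.elim0
  | succ n ih =>
    rw [driveField_succ, addAngle_apply]
    simp only [Fin.snoc_castSucc, Prod.snd_add, Prod.smul_snd, Pi.add_apply, Pi.smul_apply,
      smul_eq_mul]
    induction i using Fin.lastCases with
    | last =>
      rw [driveField_snd_last, Fin.succ_last, piCoeff_last, turnField_succ, addAngle_apply]
      simp [addAngle_symm_apply, lastAngle]
    | cast i =>
      rw [ih, Fin.succ_castSucc, piCoeff_angleExp_castSucc, turnField_succ, addAngle_apply]
      simp [addAngle_symm_apply, lastAngle, mul_assoc]

theorem trailerField₁_angleExp (w : AngleSpace (n + 1)) :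
    trailerField₁ (angleExp n w) =
      mfderiv 𝓘(ℝ, AngleSpace (n + 1)) (configModel n) (angleExp n) w (turnField (n + 1)) := by
  rw [trailerField₁, dTheta_angleExp]
  congr 1
  refine Prod.ext rfl (funext fun i => ?_)
  rw [turnField_succ, addAngle_apply]
  induction i using Fin.lastCases <;> simp

theorem driveField_eq (w : AngleSpace (n + 1)) : driveField (n + 1) w =
    (piCoeff (angleExp n w) 0 * Real.cos (w.2 0)) • (((1, 0), 0) : AngleSpace (n + 1)) +
      (piCoeff (angleExp n w) 0 * Real.sin (w.2 0)) • (((0, 1), 0) : AngleSpace (n + 1)) +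
      ∑ i : Fin n, (piCoeff (angleExp n w) i.succ * Real.sin (w.2 i.succ - w.2 i.castSucc)) •
        ((0, Pi.single i.castSucc 1) : AngleSpace (n + 1)) := by
  refine Prod.ext ?_ (funext fun j => ?_)
  · rw [driveField_fst]
    simp [Prod.fst_sum]
  · induction j using Fin.lastCases with
    | last =>
      rw [driveField_snd_last]
      simp [Prod.snd_sum, Finset.sum_apply, Fin.castSucc_ne_last, eq_comm]
    | cast j =>
      rw [driveField_snd_castSucc]
      simp [Prod.snd_sum, Finset.sum_apply, Pi.single_apply]

theorem trailerField₂_angleExp (w : AngleSpace (n + 1)) :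
    trailerField₂ (angleExp n w) =
      mfderiv 𝓘(ℝ, AngleSpace (n + 1)) (configModel n) (angleExp n) w
        (driveField (n + 1) w) := by
  rw [trailerField₂, driveField_eq]
  set L : AngleSpace (n + 1) →L[ℝ] (ℝ × ℝ) × (Fin (n + 1) → EuclideanSpace ℝ (Fin 1)) :=
    mfderiv 𝓘(ℝ, AngleSpace (n + 1)) (configModel n) (angleExp n) w with hL
  refine Eq.trans ?_ (map_add L _ _).symm
  rw [map_add, map_sum, map_smul, map_smul]
  simp only [map_smul, sinDiff_angleExp, dXi₁_angleExp, dXi₂_angleExp, dTheta_angleExp]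
  rw [show ((angleExp n w).2 0) = Circle.exp (w.2 0) from rfl, re_circleExp, im_circleExp]
  rfl

theorem trailerSystem_angleExp (w : AngleSpace (n + 1)) :
    trailerSystem n (angleExp n w) =
      (Submodule.span ℝ {turnField (n + 1), driveField (n + 1) w}).map
        (mfderiv 𝓘(ℝ, AngleSpace (n + 1)) (configModel n) (angleExp n) w).toLinearMap := by
  rw [trailerSystem, trailerField₁_angleExp, trailerField₂_angleExp]
  refine Eq.trans ?_ (Submodule.map_span _ _).symm
  exact congrArg (Submodule.span ℝ) (image_pair _ _ _).symm

end AngleExp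

end Goursat

end

/-! ### The local equivalence, assembled from the chart, the angle coordinates and `angleExp` -/

theorem mainTheorem5 (n : ℕ) {M : Type*} [TopologicalSpace M]
    [ChartedSpace (EuclideanSpace ℝ (Fin (n + 3))) M] [IsManifold (𝓡 (n + 3)) ∞ M]
    (D : (x : M) → Submodule ℝ (TangentSpace (𝓡 (n + 3)) x))
    (hD : Goursat.IsGoursatStructure (𝓡 (n + 3)) D) (q : M) :
    ∃ p : Goursat.Config n,
      Goursat.LocallyEquivalent (𝓡 (n + 3)) (Goursat.configModel n) D q
        (Goursat.trailerSystem n) p := by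
  have hfin : Module.finrank ℝ (EuclideanSpace ℝ (Fin (n + 3))) = n + 1 + 2 := by simp
  obtain ⟨X, hX, hXD⟩ := hD.exists_goursatFrame q
  rw [hfin] at hX
  obtain ⟨Φ, hΦ, hinj, hmap⟩ := hX.exists_angle_coordinates (n + 1) hfin
  obtain ⟨e, he, hqe, hsm, hinv, hsymm⟩ := hΦ.exists_openPartialHomeomorph
    (Goursat.isInvertible_of_injective hinj (by rw [hfin, Goursat.finrank_angleSpace]))
  set c := chartAt (EuclideanSpace ℝ (Fin (n + 3))) q with hc
  have hqc : q ∈ c.source := mem_chart_source _ q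
  set ψ := Goursat.angleExpAt n (e (c q)) with hψ
  -- Both descriptions of the distribution, in the chart and in angle coordinates, hold only near q,
  -- so the equivalence is restricted to a common open set.
  obtain ⟨U, hU, hUo, hqU⟩ := mem_nhds_iff.1 (hXD.and ((c.continuousAt hqc).eventually hmap))
  let φ : OpenPartialHomeomorph M (Goursat.Config n) := ((c.trans e).trans ψ).restrOpen U hUo
  have hsource : ∀ x ∈ φ.source, x ∈ c.source ∧ c x ∈ e.source ∧ x ∈ U := by
    intro x hx
    simp only [φ, OpenPartialHomeomorph.restrOpen_source, OpenPartialHomeomorph.trans_source] at hx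
    exact ⟨hx.1.1.1, hx.1.1.2, hx.2⟩
  have hcd : ∀ x ∈ c.source, ContMDiffAt (𝓡 (n + 3)) (𝓡 (n + 3)) ∞ c x := fun x hx =>
    contMDiffOn_chart.contMDiffAt (c.open_source.mem_nhds hx)
  have hed : ∀ y ∈ e.source,
      ContMDiffAt (𝓡 (n + 3)) 𝓘(ℝ, Goursat.AngleSpace (n + 1)) ∞ Φ y := fun y hy =>
    (hsm y hy).contMDiffAt
  have hφ : ⇑φ = Goursat.angleExp n ∘ Φ ∘ c := by
    rw [← he]; rfl
  refine ⟨φ q, φ, ⟨⟨⟨hqc, hqe⟩, Goursat.mem_angleExpAt_source n _⟩, hqU⟩, rfl, ?_, ?_, ?_⟩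
  · intro x hx
    obtain ⟨hxc, hxe, -⟩ := hsource x hx
    rw [hφ]
    exact (((Goursat.contMDiff_angleExp n).contMDiffAt.comp x
      ((hed _ hxe).comp x (hcd x hxc)))).contMDiffWithinAt
  · intro y hy
    have h1 : y ∈ ((c.trans e).trans ψ).target := hy.1
    obtain ⟨hyψ, hye, hyc⟩ : y ∈ ψ.target ∧ ψ.symm y ∈ e.target ∧ e.symm (ψ.symm y) ∈ c.target := by
      simpa [OpenPartialHomeomorph.trans_target] using h1
    have h2 : ContMDiffAt (𝓡 (n + 3)) (𝓡 (n + 3)) ∞ c.symm (e.symm (ψ.symm y)) :=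
      contMDiffOn_chart_symm.contMDiffAt (c.open_target.mem_nhds hyc)
    exact (h2.comp y ((hsymm _ hye).contMDiffAt.comp y
      (Goursat.contMDiffAt_angleExpAt_symm n hyψ))).contMDiffWithinAt
  · intro x hx
    obtain ⟨hxc, hxe, hxU⟩ := hsource x hx
    obtain ⟨h1, h2⟩ := hU hxU
    have d1 := ((hcd x hxc).mdifferentiableAt (by simp)).hasMFDerivAt
    have d2 := ((hsm _ hxe).differentiableAt (by simp)).hasFDerivAt.hasMFDerivAt
    have d3 := (((Goursat.contMDiff_angleExp n).contMDiffAt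
      (x := Φ (c x))).mdifferentiableAt (by simp)).hasMFDerivAt
    have d := (d3.comp x (d2.comp x d1)).mfderiv
    rw [hφ]
    refine (congrArg (fun L => (D x).map (ContinuousLinearMap.toLinearMap L)) d).trans ?_
    refine Eq.trans ?_ (Goursat.trailerSystem_angleExp (Φ (c x))).symm
    rw [← h2, ← h1]
    exact (Submodule.map_comp _ _ _).trans (congrArg _ (Submodule.map_comp _ _ _))
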